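/- Let $p$ be a prime, $n\ge 0$, $G=\mathbb Z_p^n$, $H=\mathbb Z_p$ and $\tilde G=G\times H=\mathbb Z_p^{n+1}$, regarded as an $(n+1)$-dimensional vector space over $\mathbb Z_p$, and let $e=(0,\dots,0,1)\in\tilde G$. Let $A=A(\tilde G)$ be the Burnside ring (the Grothendieck group of finite $\tilde G$-sets under disjoint union) and $R=R(\tilde G)$ the rational representation ring (the Grothendieck group of finitely generated $\mathbb Q[\tilde G]$-modules under direct sum). Let $A'=A(G,H)$ be the Grothendieck group of the monoid of finite $H$-free $\tilde G$-sets and $R'=R(G,H)$ the Grothendieck group of the monoid of finitely generated $\mathbb Q[H]$-free $\mathbb Q[\tilde G]$-modules. Let $f:A\to R$ and $f':A'\to R'$ be the homomorphisms $[X]\mapsto[\mathbb Q[X]]$. For a subspace $L\le\tilde G$ write $(L)=[\tilde G/L]\in A$. Let $A_k\subset A$ be the subgroup generated by the $(L)$ with $\dim L=k$, and $A'_k=A_k\cap A'$. Let $M_{n-1}$ be the set of $(n-1)$-dimensional subspaces $L\le\tilde G$ with $e\notin L$, and let $A''_{n-1}$ be the subgroup generated by all differences $(L)-(L')$ with $L,L'\in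 M_{n-1}$ and $L+\mathbb Z_pe=L'+\mathbb Z_pe$. Let $G(k,n)$ be the number of $k$-dimensional subspaces of $\mathbb Z_p^n$. For each subspace $L$ of codimension at least $2$ in $\tilde G$ choose a subspace $L^*\supset L$ with $\dim L^*/L=2$ such that $e\notin L^*$ whenever $e\notin L$ and $L$ has codimension at least $3$; put $$t(L)=(L)-\sum_{L<C<L^*}(C)+p\,(L^*),$$ the sum being over all subspaces strictly between $L$ and $L^*$. **Theorem.** (1) $A''_{n-1}$ is a free abelian group of rank $G(1,n)(p^{n-1}-1)$. (2) The subspaces $L^*$ can be chosen as required, and for every such choice the formula for $t(L)$ defines a homomorphism $t:A_0\oplus\dots\oplus A_{n-1}\to A$ whose restriction $t'$ to $A'_0\oplus\dots\oplus A'_{n-2}\oplus A''_{n-1}$ takes values in $A'$, and the diagram $$\begin{array}{ccccccccc} 0&\to& A'_0\oplus\dots\oplus A'_{n-2}\oplus A''_{n-1}&\xrightarrow{t'}&A'&\xrightarrow{f'}&R'&\to&0\\ &&\downarrow&&\downarrow&&\downarrow&&\\ 0&\to& A_0\oplus\dots\oplus A_{n-2}\oplus A_{n-1}&\xrightarrow{t}&A&\xrightarrow{f}&R&\to&0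 \end{array}$$ is commutative with exact rows, where the vertical arrows are the canonical maps and are all injective. (3) Consequently, for every such choice, the elements $t(L)$ with $\dim L\le n-1$ form a $\mathbb Z$-basis of $\ker f$. If moreover one representative is chosen in each class of $M_{n-1}$ under the relation $L+\mathbb Z_pe=L'+\mathbb Z_pe$, then the elements $t(L)$ with $\dim L\le n-2$ and $e\notin L$, together with the elements $t(L)-t(L_0)$, where $L\in M_{n-1}$ is not the representative $L_0$ of its class, form a $\mathbb Z$-basis of $\ker f'$. -/

import Mathlib

open scoped DirectSum

noncomputable section

namespace RelBurnside

/-! ### Finite `Γ`-sets up to isomorphism -/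

/-- A finite `Γ`-set. -/
structure FinGSet (Γ : Type) [Group Γ] where
  carrier : Type
  [act : MulAction Γ carrier]
  [fin : Finite carrier]

attribute [instance] FinGSet.act FinGSet.fin

section GSets

variable (Γ : Type) [Group Γ]

/-- Isomorphism of finite `Γ`-sets: an equivariant bijection. -/
instance FinGSet.setoid : Setoid (FinGSet Γ) where
  r X Y := ∃ e : X.carrier ≃ Y.carrier, ∀ (g : Γ) (x : X.carrier), e (g • x) = g • e x
  iseqv :=
    { refl := fun X => ⟨Equiv.refl _, fun _ _ => rfl⟩
      symm := fun {X Y} ⟨e, he⟩ => ⟨e.symm, fun g y => by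
        rw [Equiv.symm_apply_eq, he, Equiv.apply_symm_apply]⟩
      trans := fun {X Y Z} ⟨e, he⟩ ⟨e', he'⟩ => ⟨e.trans e', fun g x => by
        simp [he, he']⟩ }

/-- The type of isomorphism classes of finite `Γ`-sets. -/
def GSetClass : Type 1 := Quotient (FinGSet.setoid Γ)

variable {Γ}

/-- The isomorphism class of a finite `Γ`-set. -/
def GSetClass.mk (X : FinGSet Γ) : GSetClass Γ := Quotient.mk _ X

/-- Disjoint union of finite `Γ`-sets. -/
def FinGSet.sum (X Y : FinGSet Γ) : FinGSet Γ := ⟨X.carrier ⊕ Y.carrier⟩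

/-- The empty `Γ`-set. -/
def FinGSet.empty : FinGSet Γ :=
  letI : MulAction Γ Empty :=
    { smul := fun _ x => x, one_smul := fun _ => rfl, mul_smul := fun _ _ _ => rfl }
  ⟨Empty⟩

theorem GSetClass.mk_eq_mk {X Y : FinGSet Γ} :
    GSetClass.mk X = GSetClass.mk Y ↔
      ∃ e : X.carrier ≃ Y.carrier, ∀ (g : Γ) (x : X.carrier), e (g • x) = g • e x :=
  Quotient.eq (r := FinGSet.setoid Γ)

instance : Zero (GSetClass Γ) := ⟨GSetClass.mk FinGSet.empty⟩

instance : Add (GSetClass Γ) :=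
  ⟨Quotient.map₂ FinGSet.sum (by
    rintro X X' ⟨e, he⟩ Y Y' ⟨d, hd⟩
    refine ⟨Equiv.sumCongr e d, fun g x => ?_⟩
    rcases x with x | x
    · exact congrArg Sum.inl (he g x)
    · exact congrArg Sum.inr (hd g x))⟩

theorem GSetClass.mk_add_mk (X Y : FinGSet Γ) :
    GSetClass.mk X + GSetClass.mk Y = GSetClass.mk (X.sum Y) := rfl

theorem GSetClass.zero_def : (0 : GSetClass Γ) = GSetClass.mk FinGSet.empty := rfl

theorem GSetClass.ind {P : GSetClass Γ → Prop} (h : ∀ X, P (GSetClass.mk X)) (c) : P c :=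
  Quotient.ind h c

/-- Isomorphism classes of finite `Γ`-sets form a monoid under disjoint union. -/
instance : AddCommMonoid (GSetClass Γ) :=
  have hcomm : ∀ a b : GSetClass Γ, a + b = b + a := by
    intro a b
    induction a using GSetClass.ind with | h X => ?_
    induction b using GSetClass.ind with | h Y => ?_
    exact GSetClass.mk_eq_mk.2 ⟨Equiv.sumComm _ _, by rintro g (x | x) <;> rfl⟩
  have hzero : ∀ a : GSetClass Γ, 0 + a = a := by
    intro a
    induction a using GSetClass.ind with | h X => ?_
    refine GSetClass.mk_eq_mk.2 ⟨Equiv.emptySum Empty X.carrier, ?_⟩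
    rintro g (x | x)
    · exact x.elim
    · rfl
  { add_assoc := by
      intro a b c
      induction a using GSetClass.ind with | h X => ?_
      induction b using GSetClass.ind with | h Y => ?_
      induction c using GSetClass.ind with | h Z => ?_
      exact GSetClass.mk_eq_mk.2 ⟨Equiv.sumAssoc _ _ _, by rintro g ((x | x) | x) <;> rfl⟩
    zero_add := hzero
    add_zero := fun a => by rw [hcomm, hzero]
    add_comm := hcomm
    nsmul := nsmulRec }

variable (Γ)

/-- The additive group of the Burnside ring `A(Γ)`: the Grothendieck group of the monoid of
isomorphism classes of finite `Γ`-sets under disjoint union. -/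
abbrev Burnside : Type 1 := Algebra.GrothendieckAddGroup (GSetClass Γ)

variable {Γ}

/-- The class in the Burnside ring of a finite `Γ`-set. -/
def Burnside.mk (X : FinGSet Γ) : Burnside Γ := Algebra.GrothendieckAddGroup.of (GSetClass.mk X)

end GSets

/-! ### Finitely generated `ℚ[Γ]`-modules up to isomorphism -/

/-- A finitely generated `ℚ[Γ]`-module. -/
structure FGMod (Γ : Type) [Group Γ] where
  carrier : Type
  [grp : AddCommGroup carrier]
  [mod : Module (MonoidAlgebra ℚ Γ) carrier]
  [fg : Module.Finite (MonoidAlgebra ℚ Γ) carrier]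

attribute [instance] FGMod.grp FGMod.mod FGMod.fg

section Mods

variable (Γ : Type) [Group Γ]

/-- Isomorphism of finitely generated `ℚ[Γ]`-modules. -/
instance FGMod.setoid : Setoid (FGMod Γ) where
  r M N := Nonempty (M.carrier ≃ₗ[MonoidAlgebra ℚ Γ] N.carrier)
  iseqv :=
    { refl := fun _ => ⟨LinearEquiv.refl _ _⟩
      symm := fun ⟨e⟩ => ⟨e.symm⟩
      trans := fun ⟨e⟩ ⟨e'⟩ => ⟨e.trans e'⟩ }

/-- The type of isomorphism classes of finitely generated `ℚ[Γ]`-modules. -/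
def ModClass : Type 1 := Quotient (FGMod.setoid Γ)

variable {Γ}

/-- The isomorphism class of a finitely generated `ℚ[Γ]`-module. -/
def ModClass.mk (M : FGMod Γ) : ModClass Γ := Quotient.mk _ M

/-- Direct sum of finitely generated `ℚ[Γ]`-modules. -/
def FGMod.sum (M N : FGMod Γ) : FGMod Γ := ⟨M.carrier × N.carrier⟩

/-- The zero module. -/
def FGMod.zero : FGMod Γ := ⟨PUnit⟩

theorem ModClass.mk_eq_mk {M N : FGMod Γ} :
    ModClass.mk M = ModClass.mk N ↔
      Nonempty (M.carrier ≃ₗ[MonoidAlgebra ℚ Γ] N.carrier) :=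
  Quotient.eq (r := FGMod.setoid Γ)

instance : Zero (ModClass Γ) := ⟨ModClass.mk FGMod.zero⟩

instance : Add (ModClass Γ) :=
  ⟨Quotient.map₂ FGMod.sum (by
    rintro M M' ⟨e⟩ N N' ⟨d⟩
    exact ⟨e.prodCongr d⟩)⟩

theorem ModClass.mk_add_mk (M N : FGMod Γ) :
    ModClass.mk M + ModClass.mk N = ModClass.mk (M.sum N) := rfl

theorem ModClass.zero_def : (0 : ModClass Γ) = ModClass.mk FGMod.zero := rfl

theorem ModClass.ind {P : ModClass Γ → Prop} (h : ∀ M, P (ModClass.mk M)) (c) : P c :=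
  Quotient.ind h c

/-- Isomorphism classes of finitely generated `ℚ[Γ]`-modules form a monoid under direct sum. -/
instance : AddCommMonoid (ModClass Γ) :=
  have hcomm : ∀ a b : ModClass Γ, a + b = b + a := by
    intro a b
    induction a using ModClass.ind with | h X => ?_
    induction b using ModClass.ind with | h Y => ?_
    exact ModClass.mk_eq_mk.2 ⟨LinearEquiv.prodComm _ _ _⟩
  have hzero : ∀ a : ModClass Γ, 0 + a = a := by
    intro a
    induction a using ModClass.ind with | h X => ?_
    exact ModClass.mk_eq_mk.2 ⟨(LinearEquiv.uniqueProd :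
      (PUnit.{1} × X.carrier) ≃ₗ[MonoidAlgebra ℚ Γ] X.carrier)⟩
  { add_assoc := by
      intro a b c
      induction a using ModClass.ind with | h X => ?_
      induction b using ModClass.ind with | h Y => ?_
      induction c using ModClass.ind with | h Z => ?_
      exact ModClass.mk_eq_mk.2 ⟨LinearEquiv.prodAssoc _ _ _ _⟩
    zero_add := hzero
    add_zero := fun a => by rw [hcomm, hzero]
    add_comm := hcomm
    nsmul := nsmulRec }

variable (Γ)

/-- The additive group of the rational representation ring `R(Γ)`: the Grothendieck group of the
monoid of isomorphism classes of finitely generated `ℚ[Γ]`-modules under direct sum. -/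
abbrev RatRep : Type 1 := Algebra.GrothendieckAddGroup (ModClass Γ)

end Mods

/-! ### The permutation module and the natural map -/

section Natural

variable {Γ : Type} [Group Γ]

/-- The permutation module `ℚ[X]` of a finite `Γ`-set `X`. -/
def permMod (X : FinGSet Γ) : FGMod Γ where
  carrier := (Representation.ofMulAction ℚ Γ X.carrier).asModule
  fg :=
    haveI : Module.Finite ℚ (MonoidAlgebra ℚ X.carrier) :=
      Module.Finite.equiv (MonoidAlgebra.coeffLinearEquiv ℚ).symm
    Module.Finite.of_restrictScalars_finite ℚ _ _

theorem permMod_single_smul (X : FinGSet Γ) (g : Γ) (r : ℚ) (x : X.carrier) (a : ℚ) :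
    (MonoidAlgebra.single g r • (show (permMod X).carrier from MonoidAlgebra.single x a) :
      (permMod X).carrier) = MonoidAlgebra.single (g • x) (r * a) := by
  have h := Representation.single_smul (ρ := Representation.ofMulAction ℚ Γ X.carrier) r g
    (MonoidAlgebra.single x a)
  refine h.trans ?_
  erw [Representation.ofMulAction_single]
  exact MonoidAlgebra.smul_single r _ _

/-- An additive bijection commuting with the elements `r g` of `ℚ[Γ]` is `ℚ[Γ]`-linear. -/
def linearEquivOfSingle {M N : Type} [AddCommGroup M] [AddCommGroup N]
    [Module (MonoidAlgebra ℚ Γ) M] [Module (MonoidAlgebra ℚ Γ) N] (e : M ≃+ N)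
    (h : ∀ (g : Γ) (r : ℚ) (m : M),
      e (MonoidAlgebra.single g r • m) = MonoidAlgebra.single g r • e m) :
    M ≃ₗ[MonoidAlgebra ℚ Γ] N :=
  { e with
    map_smul' := fun a m => by
      induction a using MonoidAlgebra.induction_linear with
      | zero => simp
      | add x y hx hy =>
        simp only [AddEquiv.toEquiv_eq_coe, Equiv.toFun_as_coe, EquivLike.coe_coe,
          RingHom.id_apply] at hx hy ⊢
        rw [add_smul, map_add, hx, hy, add_smul]
      | single g r => exact h g r m }

/-- An additive bijection on `ℚ[X]` commuting with the elements `r g` of `ℚ[Γ]` on the elements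
`a x` is `ℚ[Γ]`-linear. -/
def permLinearEquiv (X : FinGSet Γ) {N : Type} [AddCommGroup N] [Module (MonoidAlgebra ℚ Γ) N]
    (e : MonoidAlgebra ℚ X.carrier ≃+ N)
    (h : ∀ (g : Γ) (r : ℚ) (x : X.carrier) (a : ℚ),
      e (MonoidAlgebra.single (g • x) (r * a)) =
        MonoidAlgebra.single g r • e (MonoidAlgebra.single x a)) :
    (permMod X).carrier ≃ₗ[MonoidAlgebra ℚ Γ] N :=
  linearEquivOfSingle (M := (permMod X).carrier) e (by
    intro g r m
    induction m using MonoidAlgebra.induction_linear with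
    | zero =>
      have h0 : (MonoidAlgebra.single g r : MonoidAlgebra ℚ Γ) • (0 : (permMod X).carrier) = 0 :=
        smul_zero _
      refine (congrArg e h0).trans ((map_zero e).trans ?_)
      exact ((congrArg _ (map_zero e)).trans (smul_zero _)).symm
    | add x y hx hy =>
      have h0 := smul_add (MonoidAlgebra.single g r : MonoidAlgebra ℚ Γ)
        (show (permMod X).carrier from x) (show (permMod X).carrier from y)
      refine (congrArg e h0).trans ((map_add e _ _).trans ?_)
      refine (congrArg₂ (· + ·) hx hy).trans ?_
      exact ((congrArg _ (map_add e _ _)).trans (smul_add _ _ _)).symm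
    | single x a => exact (congrArg e (permMod_single_smul X g r x a)).trans (h g r x a))

/-- Sending a finite `Γ`-set to its permutation module, on isomorphism classes. -/
def permClass (Γ : Type) [Group Γ] : GSetClass Γ →+ ModClass Γ where
  toFun := Quotient.map permMod (by
    rintro X Y ⟨e, he⟩
    let E : MonoidAlgebra ℚ X.carrier ≃ₗ[ℚ] MonoidAlgebra ℚ Y.carrier :=
      (MonoidAlgebra.coeffLinearEquiv ℚ).trans
        ((Finsupp.domLCongr e).trans (MonoidAlgebra.coeffLinearEquiv ℚ).symm)
    refine ⟨permLinearEquiv X (N := (permMod Y).carrier) E.toAddEquiv fun g r x a => ?_⟩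
    have hE : ∀ x a, E (MonoidAlgebra.single x a) = MonoidAlgebra.single (e x) a := by
      intro x a
      simp [E]
    refine (hE _ _).trans ?_
    rw [he]
    refine (permMod_single_smul Y g r (e x) a).symm.trans ?_
    exact congrArg (fun v : (permMod Y).carrier =>
      (MonoidAlgebra.single g r : MonoidAlgebra ℚ Γ) • v) (hE x a).symm)
  map_zero' := by
    refine ModClass.mk_eq_mk.2 ⟨?_⟩
    haveI : Subsingleton (permMod (FinGSet.empty (Γ := Γ))).carrier :=
      (MonoidAlgebra.coeffLinearEquiv ℚ : MonoidAlgebra ℚ Empty ≃ₗ[ℚ] _).toEquiv.subsingleton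
    haveI : Subsingleton (FGMod.zero (Γ := Γ)).carrier :=
      inferInstanceAs (Subsingleton PUnit)
    exact LinearEquiv.ofSubsingleton _ _
  map_add' := by
    intro a b
    induction a using GSetClass.ind with | h X => ?_
    induction b using GSetClass.ind with | h Y => ?_
    let E : MonoidAlgebra ℚ (X.carrier ⊕ Y.carrier) ≃ₗ[ℚ]
        MonoidAlgebra ℚ X.carrier × MonoidAlgebra ℚ Y.carrier :=
      (MonoidAlgebra.coeffLinearEquiv ℚ).trans
        ((Finsupp.sumFinsuppLEquivProdFinsupp ℚ).trans
          ((MonoidAlgebra.coeffLinearEquiv ℚ).symm.prodCongr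
            (MonoidAlgebra.coeffLinearEquiv ℚ).symm))
    have hl : ∀ x a, E (MonoidAlgebra.single (Sum.inl x) a) = (MonoidAlgebra.single x a, 0) := by
      intro x a
      refine Prod.ext ?_ ?_ <;> ext z <;> simp [E]
    have hr : ∀ x a, E (MonoidAlgebra.single (Sum.inr x) a) = (0, MonoidAlgebra.single x a) := by
      intro x a
      refine Prod.ext ?_ ?_ <;> ext z <;> simp [E]
    refine ModClass.mk_eq_mk.2 ⟨permLinearEquiv (X.sum Y)
      (N := (permMod X).carrier × (permMod Y).carrier) E.toAddEquiv fun g r x a => ?_⟩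
    rcases x with x | x
    · refine (hl _ _).trans (Eq.trans ?_ (congrArg
        (fun v : (permMod X).carrier × (permMod Y).carrier =>
          (MonoidAlgebra.single g r : MonoidAlgebra ℚ Γ) • v) (hl x a).symm))
      exact Prod.ext (permMod_single_smul X g r x a).symm
        (smul_zero (A := (permMod Y).carrier) _).symm
    · refine (hr _ _).trans (Eq.trans ?_ (congrArg
        (fun v : (permMod X).carrier × (permMod Y).carrier =>
          (MonoidAlgebra.single g r : MonoidAlgebra ℚ Γ) • v) (hr x a).symm))
      exact Prod.ext (smul_zero (A := (permMod X).carrier) _).symm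
        (permMod_single_smul Y g r x a).symm

/-- The natural map `f : A(Γ) → R(Γ)`, sending `[X]` to `[ℚ[X]]`. -/
def natMap (Γ : Type) [Group Γ] : Burnside Γ →ₗ[ℤ] RatRep Γ :=
  (Algebra.GrothendieckAddGroup.lift
    (Algebra.GrothendieckAddGroup.of.comp (permClass Γ))).toIntLinearMap

end Natural

/-! ### The relative Burnside and representation modules -/

section Relative

variable (G H : Type) [Group G] [Group H]

variable {G H} in
/-- A `G × H`-set is `H`-free if no nontrivial element of `H` fixes a point. -/
def FinGSet.IsRightFree (X : FinGSet (G × H)) : Prop :=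
  ∀ (h : H) (x : X.carrier), ((1, h) : G × H) • x = x → h = 1

variable {G H} in
/-- A `ℚ[G × H]`-module is `ℚ[H]`-free if its restriction to `ℚ[H]` is a free module. -/
def FGMod.IsRightFree (M : FGMod (G × H)) : Prop :=
  @Module.Free (MonoidAlgebra ℚ H) M.carrier _ _
    (Module.compHom M.carrier (MonoidAlgebra.mapDomainRingHom ℚ (MonoidHom.inr G H)))

/-- The monoid of isomorphism classes of finite `H`-free `G × H`-sets. -/
def relSets : AddSubmonoid (GSetClass (G × H)) where
  carrier := {c | ∃ X : FinGSet (G × H), X.IsRightFree ∧ GSetClass.mk X = c}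
  zero_mem' := ⟨FinGSet.empty, fun _ x => Empty.elim x, rfl⟩
  add_mem' := by
    rintro _ _ ⟨X, hX, rfl⟩ ⟨Y, hY, rfl⟩
    refine ⟨X.sum Y, ?_, rfl⟩
    rintro h (x | x) hx
    · exact hX h x (Sum.inl_injective hx)
    · exact hY h x (Sum.inr_injective hx)

/-- The monoid of isomorphism classes of finitely generated `ℚ[H]`-free `ℚ[G × H]`-modules. -/
def relMods : AddSubmonoid (ModClass (G × H)) where
  carrier := {c | ∃ M : FGMod (G × H), M.IsRightFree ∧ ModClass.mk M = c}
  zero_mem' := by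
    refine ⟨FGMod.zero, ?_, rfl⟩
    let : Module (MonoidAlgebra ℚ H) PUnit.{1} :=
      Module.compHom PUnit (MonoidAlgebra.mapDomainRingHom ℚ (MonoidHom.inr G H))
    exact (Module.Free.of_subsingleton (MonoidAlgebra ℚ H) PUnit :)
  add_mem' := by
    rintro _ _ ⟨M, hM, rfl⟩ ⟨N, hN, rfl⟩
    refine ⟨M.sum N, ?_, rfl⟩
    let : Module (MonoidAlgebra ℚ H) M.carrier :=
      Module.compHom M.carrier (MonoidAlgebra.mapDomainRingHom ℚ (MonoidHom.inr G H))
    let : Module (MonoidAlgebra ℚ H) N.carrier :=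
      Module.compHom N.carrier (MonoidAlgebra.mapDomainRingHom ℚ (MonoidHom.inr G H))
    have : Module.Free (MonoidAlgebra ℚ H) M.carrier := hM
    have : Module.Free (MonoidAlgebra ℚ H) N.carrier := hN
    exact (Module.Free.prod (MonoidAlgebra ℚ H) M.carrier N.carrier :)

/-- The relative Burnside module `A(G, H)`. -/
abbrev BurnsideRel : Type 1 := Algebra.GrothendieckAddGroup (relSets G H)

/-- The relative rational representation module `R(G, H)`. -/
abbrev RatRepRel : Type 1 := Algebra.GrothendieckAddGroup (relMods G H)

/-- The canonical map `A(G, H) → A(G × H)`. -/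
def relBurnsideIncl : BurnsideRel G H →ₗ[ℤ] Burnside (G × H) :=
  (Algebra.GrothendieckAddGroup.lift
    (Algebra.GrothendieckAddGroup.of.comp (relSets G H).subtype)).toIntLinearMap

/-- The canonical map `R(G, H) → R(G × H)`. -/
def relRatRepIncl : RatRepRel G H →ₗ[ℤ] RatRep (G × H) :=
  (Algebra.GrothendieckAddGroup.lift
    (Algebra.GrothendieckAddGroup.of.comp (relMods G H).subtype)).toIntLinearMap

variable {G H} in
/-- The permutation module of an `H`-free `G × H`-set is `ℚ[H]`-free. -/
theorem permMod_isRightFree (X : FinGSet (G × H)) (hX : X.IsRightFree) :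
    (permMod X).IsRightFree := by
  let : MulAction H X.carrier := MulAction.compHom X.carrier (MonoidHom.inr G H)
  let : Module (MonoidAlgebra ℚ H) (permMod X).carrier :=
    Module.compHom _ (MonoidAlgebra.mapDomainRingHom ℚ (MonoidHom.inr G H))
  let Ω := MulAction.orbitRel.Quotient H X.carrier
  let F : Ω × H → X.carrier := fun q => q.2 • q.1.out
  have hF : Function.Bijective F := by
    constructor
    · rintro ⟨a, h⟩ ⟨b, k⟩ hab
      have hab : h • a.out = k • b.out := hab
      have hq : a = b := by
        rw [← Quotient.out_eq a, ← Quotient.out_eq b]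
        refine Quotient.sound (MulAction.orbitRel_apply.2 ⟨h⁻¹ * k, ?_⟩)
        change (h⁻¹ * k) • b.out = a.out
        rw [mul_smul, ← hab, inv_smul_smul]
      subst hq
      have h1 : (k⁻¹ * h) • a.out = a.out := by
        rw [mul_smul, hab, inv_smul_smul]
      have h2 := hX (k⁻¹ * h) a.out h1
      rw [inv_mul_eq_one] at h2
      rw [h2]
    · intro x
      have hx : x ∈ MulAction.orbit H
          (Quotient.out (Quotient.mk (MulAction.orbitRel H X.carrier) x)) :=
        MulAction.orbitRel_apply.1 ((MulAction.orbitRel H X.carrier).symm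
          (Quotient.mk_out (s := MulAction.orbitRel H X.carrier) x))
      obtain ⟨h, hh⟩ := hx
      exact ⟨(Quotient.mk (MulAction.orbitRel H X.carrier) x, h), hh⟩
  let E : (Ω →₀ MonoidAlgebra ℚ H) ≃ₗ[ℚ] MonoidAlgebra ℚ X.carrier :=
    (Finsupp.mapRange.linearEquiv (MonoidAlgebra.coeffLinearEquiv ℚ)).trans
      ((Finsupp.curryLinearEquiv ℚ).symm.trans
        ((Finsupp.domLCongr (Equiv.ofBijective F hF)).trans
          (MonoidAlgebra.coeffLinearEquiv ℚ).symm))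
  have hE : ∀ ω h r, E (Finsupp.single ω (MonoidAlgebra.single h r)) =
      MonoidAlgebra.single (h • ω.out) r := by
    intro ω h r
    simp [E, F]
  have e : (Ω →₀ MonoidAlgebra ℚ H) ≃ₗ[MonoidAlgebra ℚ H] (permMod X).carrier := by
    refine linearEquivOfSingle (N := (permMod X).carrier) E.toAddEquiv ?_
    intro g r m
    have key : ∀ v : (permMod X).carrier, (MonoidAlgebra.single g r : MonoidAlgebra ℚ H) • v =
        (MonoidAlgebra.single ((1, g) : G × H) r : MonoidAlgebra ℚ (G × H)) • v := by
      intro v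
      change (MonoidAlgebra.mapDomainRingHom ℚ (MonoidHom.inr G H)
        (MonoidAlgebra.single g r)) • v = _
      simp
    rw [key]
    induction m using Finsupp.induction_linear with
    | zero => erw [smul_zero, map_zero, smul_zero]
    | add x y hx hy => erw [smul_add, map_add, map_add, hx, hy, smul_add]
    | single ω m =>
    induction m using MonoidAlgebra.induction_linear with
    | zero => erw [Finsupp.single_zero, smul_zero, map_zero, smul_zero]
    | add x y hx hy => erw [Finsupp.single_add, smul_add, map_add, map_add, hx, hy, smul_add]
    | single h a =>
      erw [Finsupp.smul_single, smul_eq_mul, MonoidAlgebra.single_mul_single, hE, hE,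
        permMod_single_smul, mul_smul]
      rfl
  exact Module.Free.of_equiv e

/-- The natural map on the monoids of free objects. -/
def relPermClass : relSets G H →+ relMods G H :=
  ((permClass (G × H)).comp (relSets G H).subtype).codRestrict (relMods G H) (by
    rintro ⟨_, X, hX, rfl⟩
    exact ⟨permMod X, permMod_isRightFree X hX, rfl⟩)

/-- The natural map `f' : A(G, H) → R(G, H)`, sending `[X]` to `[ℚ[X]]`. -/
def relNatMap : BurnsideRel G H →ₗ[ℤ] RatRepRel G H :=
  (Algebra.GrothendieckAddGroup.lift
    (Algebra.GrothendieckAddGroup.of.comp (relPermClass G H))).toIntLinearMap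

end Relative

/-! ### Elementary abelian groups -/

section ElementaryAbelian

variable (p n : ℕ)

/-- The group `G = ℤ_p^n`. -/
abbrev EG : Type := Multiplicative (Fin n → ZMod p)

/-- The group `H = ℤ_p`. -/
abbrev EH : Type := Multiplicative (ZMod p)

/-- The vector space `ℤ_p^(n+1) = ℤ_p^n × ℤ_p` underlying `G × H`. -/
abbrev EV : Type := (Fin n → ZMod p) × ZMod p

/-- The distinguished vector `e = (0, …, 0, 1)`. -/
def vecE : EV p n := (0, 1)

/-- The line spanned by `e`. -/
def lineE : Submodule (ZMod p) (EV p n) := Submodule.span (ZMod p) {vecE p n}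

variable {p n}

/-- A subspace of `ℤ_p^n × ℤ_p`, as a subgroup of `G × H`. -/
def toSubgroup (L : Submodule (ZMod p) (EV p n)) : Subgroup (EG p n × EH p) where
  carrier := {g | (g.1.toAdd, g.2.toAdd) ∈ L}
  one_mem' := L.zero_mem
  mul_mem' := fun ha hb => L.add_mem ha hb
  inv_mem' := fun ha => L.neg_mem ha

variable [Fact p.Prime]

/-- The coset space `(G × H) / L` as a finite `G × H`-set. -/
def cosetSet (L : Submodule (ZMod p) (EV p n)) : FinGSet (EG p n × EH p) :=
  haveI : Finite (EG p n × EH p) := inferInstanceAs (Finite (EV p n))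
  ⟨(EG p n × EH p) ⧸ toSubgroup L⟩

/-- The basis element `(L) = [(G × H) / L]` of `A(G × H)`. -/
def cl (L : Submodule (ZMod p) (EV p n)) : Burnside (EG p n × EH p) := Burnside.mk (cosetSet L)

variable (p n)

/-- `A_k`, the subgroup of `A(G × H)` generated by all `(L)` with `L` of dimension `k`. -/
def gradeA (k : ℕ) : Submodule ℤ (Burnside (EG p n × EH p)) :=
  Submodule.span ℤ {x | ∃ L : Submodule (ZMod p) (EV p n), Module.finrank (ZMod p) L = k ∧ x = cl L}

/-- `A'_k = A_k ∩ A(G, H)`. -/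
def gradeA' (k : ℕ) : Submodule ℤ (Burnside (EG p n × EH p)) :=
  gradeA p n k ⊓ LinearMap.range (relBurnsideIncl (EG p n) (EH p))

/-- `M_(n-1)`: the `(n-1)`-dimensional subspaces of `ℤ_p^(n+1)` not containing `e`. -/
def setM : Set (Submodule (ZMod p) (EV p n)) :=
  {L | Module.finrank (ZMod p) L + 1 = n ∧ vecE p n ∉ L}

/-- `A''_(n-1)`: generated by the differences `(L) - (L')` of elements of `M_(n-1)`
with `L + ℤ_p e = L' + ℤ_p e`. -/
def gradeA'' : Submodule ℤ (Burnside (EG p n × EH p)) :=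
  Submodule.span ℤ {x | ∃ L ∈ setM p n, ∃ L' ∈ setM p n,
    L ⊔ lineE p n = L' ⊔ lineE p n ∧ x = cl L - cl L'}

/-- The `k`-th summand, `0 ≤ k ≤ n-1`, of the source of `t'`: it is `A'_k` for `k ≤ n-2` and
`A''_(n-1)` for `k = n-1`. -/
def relSummand (k : ℕ) : Submodule ℤ (Burnside (EG p n × EH p)) :=
  if k + 1 = n then gradeA'' p n else gradeA' p n k

theorem cl_mem_gradeA (L : Submodule (ZMod p) (EV p n)) :
    cl L ∈ gradeA p n (Module.finrank (ZMod p) L) :=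
  Submodule.subset_span ⟨L, rfl, rfl⟩

theorem relSummand_le (k : ℕ) : relSummand p n k ≤ gradeA p n k := by
  unfold relSummand
  split_ifs with h
  · refine Submodule.span_le.2 ?_
    rintro _ ⟨L, hL, L', hL', -, rfl⟩
    refine (gradeA p n k).sub_mem ?_ ?_
    · have : Module.finrank (ZMod p) L = k := by have := hL.1; omega
      exact this ▸ cl_mem_gradeA p n L
    · have : Module.finrank (ZMod p) L' = k := by have := hL'.1; omega
      exact this ▸ cl_mem_gradeA p n L'
  · exact inf_le_left

/-- `A_0 ⊕ ⋯ ⊕ A_(n-1)`. -/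
abbrev SourceT : Type 1 := ⨁ k : Fin n, gradeA p n k

/-- `A'_0 ⊕ ⋯ ⊕ A'_(n-2) ⊕ A''_(n-1)`. -/
abbrev SourceT' : Type 1 := ⨁ k : Fin n, relSummand p n k

/-- The summandwise inclusion of the source of `t'` in the source of `t`. -/
def sourceIncl : SourceT' p n →ₗ[ℤ] SourceT p n :=
  DirectSum.lmap fun k => Submodule.inclusion (relSummand_le p n k)

variable {p n}

/-- A choice `L ↦ L*` of distinguished subspaces for the subspaces of codimension at least `2`. -/
def IsStarChoice (S : Submodule (ZMod p) (EV p n) → Submodule (ZMod p) (EV p n)) : Prop :=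
  ∀ L : Submodule (ZMod p) (EV p n), Module.finrank (ZMod p) L + 2 ≤ n + 1 →
    L ≤ S L ∧ Module.finrank (ZMod p) (S L) = Module.finrank (ZMod p) L + 2 ∧
    (vecE p n ∉ L → Module.finrank (ZMod p) L + 3 ≤ n + 1 → vecE p n ∉ S L)

/-- The element `(L) - ∑ (C) + p (L*)`, the sum being over all `C` with `L < C < L*`. -/
def tElt (S : Submodule (ZMod p) (EV p n) → Submodule (ZMod p) (EV p n))
    (L : Submodule (ZMod p) (EV p n)) : Burnside (EG p n × EH p) :=
  cl L - (∑ᶠ C ∈ Set.Ioo L (S L), cl C) + (p : ℤ) • cl (S L)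

variable (p) in
/-- `G(k, n)`: the number of `k`-dimensional subspaces of `ℤ_p^n`. -/
def numSubspaces (k n : ℕ) : ℕ :=
  Nat.card {W : Submodule (ZMod p) (Fin n → ZMod p) // Module.finrank (ZMod p) W = k}

end ElementaryAbelian


end RelBurnside
end

/-! The proof compares explicit bases. The group is abelian, so all points of an orbit have the same
stabilizer; counting points by stabilizer shows that the `(L)` form a basis of `A` (`clBasis`) and
those with `e ∉ L` a basis of `A'` (`relClBasis`).

On the side of representations, a simple rational module is a field generated over `ℚ` by `p`-th
roots of unity. It is therefore trivial or of the form `ℚ[G̃/C]` minus the trivial module, with `C`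
a hyperplane, and by Maschke the classes `f(C)` with `C` of codimension at most 1 span `R`
(`span_natMap_cl`). The dimension of the `K`-invariants (`invDim`), for `K` of codimension at most
1, is `p` on `ℚ[G̃/L]` if `K` is a hyperplane containing `L`, and 1 otherwise. These functionals
show that the spanning classes are independent, and they verify `f(t(L)) = 0` by arithmetic, because
exactly `p + 1` subspaces lie strictly between `L` and `L*` (`natMap_relation`).

Since `t(L)` is `(L)` plus terms of larger dimension, the `t(L)` with `dim L ≤ n - 1` and the `(C)`
with `dim C ≥ n` together form a basis of `A` (`exists_basis_of_unitriangular`). The map `f` kills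
the first family and is injective on the span of the second, which gives the kernel and the bottom
row.

The same argument works in `A'`, except when `L` has codimension 2 and `e ∉ L`: then `L*` is
everything, and `t(L)` contains the non-free terms `-(L + ℤ_p e) + p (G̃)`. These depend only on the
class of `L`, so they cancel in `t(L) - t(L₀)`. The remaining basis elements `(L₀)` and `(C)` with
`dim C = n` have independent images, because `f(L₀)` is the only one involving the hyperplane `L₀ +
ℤ_p e` (`linearIndependent_natMap_cl_of_reps`). Surjectivity of `f'` holds because a `ℚ[H]`-free
module has character 0 at `e`, and the codimension 2 relations express every class with this
property through `H`-free sets. The map `R' → R` is injective because every module is a summand of a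
free one. For the rank, subspaces avoiding `e` are counted as graphs of partial functionals. -/

noncomputable section

namespace RelBurnside

/-! ### Orbit decomposition and counting points by stabilizer -/

section Orbits

variable {Γ : Type} [Group Γ]

/-- The coset space of a finite group as a finite `Γ`-set. -/
def quotSet [Finite Γ] (K : Subgroup Γ) : FinGSet Γ := ⟨Γ ⧸ K⟩

/-- Induction on the cardinality, splitting off one orbit. Only stabilizers of points of `X` itself
are allowed as generators, so that the decomposition of an `H`-free set stays among `H`-free orbits.
-/
theorem mk_mem_closure_quotSet [Finite Γ] (X : FinGSet Γ) :
    GSetClass.mk X ∈ AddSubmonoid.closure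
      {c | ∃ x : X.carrier, c = GSetClass.mk (quotSet (MulAction.stabilizer Γ x))} := by
  generalize hm : Nat.card X.carrier = m
  induction m using Nat.strong_induction_on generalizing X with
  | _ m ih =>
  rcases isEmpty_or_nonempty X.carrier with hX | ⟨⟨x⟩⟩
  · have : GSetClass.mk X = 0 :=
      GSetClass.mk_eq_mk.2 ⟨Equiv.equivOfIsEmpty X.carrier Empty, fun g x => hX.elim x⟩
    rw [this]
    exact zero_mem _
  · let Y : SubMulAction Γ X.carrier :=
      { carrier := (MulAction.orbit Γ x)ᶜ
        smul_mem' := by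
          intro g y hy h
          exact hy (by simpa using MulAction.mem_orbit_of_mem_orbit g⁻¹ h) }
    let Y' : FinGSet Γ := ⟨Y⟩
    have hlt : Nat.card Y'.carrier < m := by
      rw [← hm]
      refine Finite.card_subtype_lt (x := x) ?_
      exact fun h => h (MulAction.mem_orbit_self x)
    have hsum : GSetClass.mk X =
        GSetClass.mk (quotSet (MulAction.stabilizer Γ x)) + GSetClass.mk Y' := by
      symm
      rw [GSetClass.mk_add_mk]
      classical
      let e := (Equiv.sumCongr (MulAction.orbitEquivQuotientStabilizer Γ x).symm
        (Equiv.refl Y)).trans (Equiv.Set.sumCompl (MulAction.orbit Γ x))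
      refine GSetClass.mk_eq_mk.2 ⟨e, ?_⟩
      rintro g (q | y)
      · induction q using Quotient.inductionOn' with | h a => ?_
        change ((MulAction.orbitEquivQuotientStabilizer Γ x).symm ((g * a : Γ) : Γ ⧸ _) : X.carrier)
          = g • ((MulAction.orbitEquivQuotientStabilizer Γ x).symm (a : Γ ⧸ _) : X.carrier)
        rw [MulAction.orbitEquivQuotientStabilizer_symm_apply,
          MulAction.orbitEquivQuotientStabilizer_symm_apply, mul_smul]
      · rfl
    rw [hsum]
    refine add_mem (AddSubmonoid.subset_closure ⟨x, rfl⟩) ?_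
    refine AddSubmonoid.closure_mono ?_ (ih _ hlt Y' rfl)
    rintro _ ⟨y, rfl⟩
    refine ⟨y.1, ?_⟩
    have : MulAction.stabilizer Γ y = MulAction.stabilizer Γ y.1 := by
      ext g
      exact Subtype.ext_iff
    rw [← this]

/-- The number of points with a given stabilizer. -/
def stabCount (K : Subgroup Γ) : GSetClass Γ →+ ℤ where
  toFun := Quotient.lift
    (fun X : FinGSet Γ => (Nat.card {x : X.carrier // MulAction.stabilizer Γ x = K} : ℤ)) (by
      rintro X Y ⟨e, he⟩
      refine congrArg Nat.cast (Nat.card_congr (e.subtypeEquiv fun x => ?_))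
      have : MulAction.stabilizer Γ (e x) = MulAction.stabilizer Γ x := by
        ext g
        rw [MulAction.mem_stabilizer_iff, MulAction.mem_stabilizer_iff, ← he, e.apply_eq_iff_eq]
      rw [this])
  map_zero' := by
    change ((Nat.card {x : Empty // _} : ℕ) : ℤ) = 0
    simp
  map_add' a b := by
    induction a using GSetClass.ind with | h X => ?_
    induction b using GSetClass.ind with | h Y => ?_
    change ((Nat.card {x : X.carrier ⊕ Y.carrier // _} : ℕ) : ℤ) = (Nat.card _ : ℕ) + (Nat.card _ : ℕ)
    rw [Nat.card_congr (Equiv.subtypeSum), Nat.card_sum, Nat.cast_add]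
    have h1 : ∀ x : X.carrier, MulAction.stabilizer Γ (Sum.inl x : (X.sum Y).carrier) =
        MulAction.stabilizer Γ x := by
      intro x
      ext g
      exact Sum.inl_injective.eq_iff
    have h2 : ∀ x : Y.carrier, MulAction.stabilizer Γ (Sum.inr x : (X.sum Y).carrier) =
        MulAction.stabilizer Γ x := by
      intro x
      ext g
      exact Sum.inr_injective.eq_iff
    congr 2
    · exact Nat.card_congr (Equiv.subtypeEquivRight fun x => by rw [← h1]; rfl)
    · exact Nat.card_congr (Equiv.subtypeEquivRight fun x => by rw [← h2]; rfl)

end Orbits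

-- Commutativity makes every point of `Γ ⧸ K'` have stabilizer exactly `K'`, so the counts separate
-- the orbit types subgroup by subgroup, with no conjugacy classes.
open Classical in
theorem stabCount_quotSet {Γ : Type} [CommGroup Γ] [Finite Γ] (K K' : Subgroup Γ) :
    stabCount K (GSetClass.mk (quotSet K')) = if K' = K then (Nat.card (Γ ⧸ K') : ℤ) else 0 := by
  change ((Nat.card {x : Γ ⧸ K' // MulAction.stabilizer Γ x = K} : ℕ) : ℤ) = _
  have h : ∀ x : Γ ⧸ K', MulAction.stabilizer Γ x = K' := by
    intro x
    induction x using QuotientGroup.induction_on with | H a => ?_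
    ext g
    rw [MulAction.mem_stabilizer_iff]
    change ((g * a : Γ) : Γ ⧸ K') = a ↔ _
    rw [eq_comm, QuotientGroup.eq]
    simp
  split_ifs with hK
  · refine congrArg Nat.cast (Nat.card_congr (Equiv.subtypeUnivEquiv fun x => ?_))
    rw [h, hK]
  · have : IsEmpty {x : Γ ⧸ K' // MulAction.stabilizer Γ x = K} :=
      ⟨fun x => hK ((h x.1).symm.trans x.2)⟩
    simp

/-! ### Grothendieck groups of commutative monoids -/

section Grothendieck

theorem grothendieck_mk_zero {M : Type*} [AddCommMonoid M] (a : M) :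
    (AddLocalization.mk a 0 : Algebra.GrothendieckAddGroup M) =
      Algebra.GrothendieckAddGroup.of a :=
  AddLocalization.mk_zero_eq_addMonoidOf_mk a

theorem grothendieck_exists_sub {M : Type*} [AddCommMonoid M]
    (x : Algebra.GrothendieckAddGroup M) :
    ∃ a b : M, x = Algebra.GrothendieckAddGroup.of a - Algebra.GrothendieckAddGroup.of b := by
  induction x using AddLocalization.ind with | H y => ?_
  obtain ⟨a, b⟩ := y
  refine ⟨a, b, ?_⟩
  rw [← grothendieck_mk_zero, ← grothendieck_mk_zero,
    Algebra.GrothendieckAddGroup.mk_sub_mk]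
  simp

theorem grothendieck_of_eq_iff {M : Type*} [AddCommMonoid M] (a b : M) :
    Algebra.GrothendieckAddGroup.of a = Algebra.GrothendieckAddGroup.of b ↔
      ∃ c, c + a = c + b := by
  rw [← grothendieck_mk_zero, ← grothendieck_mk_zero,
    AddLocalization.mk_eq_mk_iff, AddLocalization.r_iff_exists]
  simp

@[simp]
theorem grothendieck_lift_of {M A : Type*} [AddCommMonoid M] [AddCommGroup A] (f : M →+ A)
    (a : M) : Algebra.GrothendieckAddGroup.lift f (Algebra.GrothendieckAddGroup.of a) = f a :=
  DFunLike.congr_fun (Algebra.GrothendieckAddGroup.lift.left_inv f) a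

theorem grothendieck_le {M : Type*} [AddCommMonoid M]
    (P : Submodule ℤ (Algebra.GrothendieckAddGroup M))
    (h : ∀ a : M, Algebra.GrothendieckAddGroup.of a ∈ P) : P = ⊤ := by
  refine eq_top_iff.2 fun x _ => ?_
  obtain ⟨a, b, rfl⟩ := grothendieck_exists_sub x
  exact P.sub_mem (h a) (h b)

theorem grothendieck_span_eq_top {M : Type*} [AddCommMonoid M] (s : Set M)
    (h : ∀ a, a ∈ AddSubmonoid.closure s) :
    Submodule.span ℤ (Algebra.GrothendieckAddGroup.of '' s) = ⊤ := by
  refine grothendieck_le _ fun a => ?_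
  induction h a using AddSubmonoid.closure_induction with
  | mem x hx => exact Submodule.subset_span ⟨x, hx, rfl⟩
  | zero => rw [map_zero]; exact zero_mem _
  | add x y _ _ hx hy => rw [map_add]; exact add_mem hx hy

end Grothendieck

/-! ### The natural and canonical maps on generators, and the commuting square -/

theorem natMap_mk {Γ : Type} [Group Γ] (X : FinGSet Γ) :
    natMap Γ (Burnside.mk X) = Algebra.GrothendieckAddGroup.of (ModClass.mk (permMod X)) :=
  grothendieck_lift_of _ _

theorem relBurnsideIncl_of {G H : Type} [Group G] [Group H] (c : relSets G H) :
    relBurnsideIncl G H (Algebra.GrothendieckAddGroup.of c) =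
      Algebra.GrothendieckAddGroup.of (c : GSetClass (G × H)) :=
  grothendieck_lift_of _ _

theorem relRatRepIncl_of {G H : Type} [Group G] [Group H] (c : relMods G H) :
    relRatRepIncl G H (Algebra.GrothendieckAddGroup.of c) =
      Algebra.GrothendieckAddGroup.of (c : ModClass (G × H)) :=
  grothendieck_lift_of _ _

theorem relNatMap_of {G H : Type} [Group G] [Group H] (c : relSets G H) :
    relNatMap G H (Algebra.GrothendieckAddGroup.of c) =
      Algebra.GrothendieckAddGroup.of (relPermClass G H c) :=
  grothendieck_lift_of _ _

theorem relRatRepIncl_comp_relNatMap (G H : Type) [Group G] [Group H] :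
    relRatRepIncl G H ∘ₗ relNatMap G H = natMap (G × H) ∘ₗ relBurnsideIncl G H := by
  refine LinearMap.ext fun x => ?_
  obtain ⟨a, b, rfl⟩ := grothendieck_exists_sub x
  have key : ∀ a : relSets G H, relRatRepIncl G H (relNatMap G H
      (Algebra.GrothendieckAddGroup.of a)) = natMap (G × H) (relBurnsideIncl G H
      (Algebra.GrothendieckAddGroup.of a)) := by
    intro a
    rw [relNatMap_of, relRatRepIncl_of, relBurnsideIncl_of]
    exact (grothendieck_lift_of (Algebra.GrothendieckAddGroup.of.comp (permClass (G × H))) _).symm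
  simp only [LinearMap.comp_apply, map_sub, key]

/-! ### The bases of `A` and `A'` given by subspaces -/

section Elementary

variable {p n : ℕ}

theorem toSubgroup_injective : Function.Injective (toSubgroup (p := p) (n := n)) := by
  intro L L' h
  ext v
  have := SetLike.ext_iff.1 h (Multiplicative.ofAdd v.1, Multiplicative.ofAdd v.2)
  exact this

/-- Scalars in `ZMod p` act by repeated addition, so every subgroup is automatically a subspace. -/
theorem toSubgroup_surjective : Function.Surjective (toSubgroup (p := p) (n := n)) := by
  intro K
  let K' : AddSubgroup (EV p n) :=
    { carrier := {v | (Multiplicative.ofAdd v.1, Multiplicative.ofAdd v.2) ∈ K}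
      zero_mem' := K.one_mem
      add_mem' := fun ha hb => K.mul_mem ha hb
      neg_mem' := fun ha => K.inv_mem ha }
  exact ⟨AddSubgroup.toZModSubmodule p K', by ext g; exact Iff.rfl⟩

variable [Fact p.Prime]

instance : Finite (EG p n × EH p) := inferInstanceAs (Finite (EV p n))

instance : Finite (Submodule (ZMod p) (EV p n)) :=
  Finite.of_injective (fun L => (L : Set (EV p n))) SetLike.coe_injective

theorem cosetSet_eq (L : Submodule (ZMod p) (EV p n)) : cosetSet L = quotSet (toSubgroup L) := rfl

theorem cosetSet_isRightFree (L : Submodule (ZMod p) (EV p n)) (hL : vecE p n ∉ L) :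
    (cosetSet L).IsRightFree := by
  intro h x hx
  induction x using QuotientGroup.induction_on with | H a => ?_
  have hx' : (((1, h) * a : EG p n × EH p) : (EG p n × EH p) ⧸ toSubgroup L) = a := hx
  rw [eq_comm, QuotientGroup.eq] at hx'
  have h1 : ((1 : EG p n), h) ∈ toSubgroup L := by simpa using hx'
  by_contra hne
  apply hL
  have h0 : h.toAdd ≠ 0 := hne
  have h2 : ((0 : Fin n → ZMod p), h.toAdd) ∈ L := h1
  have h3 := L.smul_mem (h.toAdd)⁻¹ h2
  simpa [vecE, h0] using h3

theorem vecE_notMem_of_isRightFree {X : FinGSet (EG p n × EH p)} (hX : X.IsRightFree)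
    {x : X.carrier} {L : Submodule (ZMod p) (EV p n)}
    (hL : toSubgroup L = MulAction.stabilizer _ x) : vecE p n ∉ L := by
  intro h
  have h1 : ((1 : EG p n), Multiplicative.ofAdd (1 : ZMod p)) ∈ toSubgroup L := h
  rw [hL] at h1
  have h2 := hX _ x h1
  have : (1 : ZMod p) = 0 := h2
  exact one_ne_zero this

-- Counting points with stabilizer `L` turns a relation into the coefficient of `(L)` times the
-- nonzero number of points of the orbit.
open Classical in
theorem linearIndependent_cl :
    LinearIndependent ℤ (cl : Submodule (ZMod p) (EV p n) → Burnside (EG p n × EH p)) := by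
  rw [linearIndependent_iff']
  intro s a ha L hL
  have h := congrArg (Algebra.GrothendieckAddGroup.lift (stabCount (toSubgroup L))) ha
  rw [map_zero, map_sum] at h
  have h2 : ∀ K : Submodule (ZMod p) (EV p n),
      Algebra.GrothendieckAddGroup.lift (stabCount (toSubgroup L)) (a K • cl K) =
        if K = L then a K * (Nat.card ((EG p n × EH p) ⧸ toSubgroup K) : ℤ) else 0 := by
    intro K
    rw [map_zsmul, cl, Burnside.mk, grothendieck_lift_of, cosetSet_eq, stabCount_quotSet]
    simp only [toSubgroup_injective.eq_iff, smul_eq_mul, mul_ite, mul_zero]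
  simp only [h2, Finset.sum_ite_eq', if_pos hL] at h
  refine (mul_eq_zero.1 h).resolve_right ?_
  exact_mod_cast Nat.card_pos.ne'

theorem span_range_cl :
    Submodule.span ℤ (Set.range
      (cl : Submodule (ZMod p) (EV p n) → Burnside (EG p n × EH p))) = ⊤ := by
  rw [← grothendieck_span_eq_top (Set.range fun L : Submodule (ZMod p) (EV p n) =>
    GSetClass.mk (cosetSet L)) ?_, ← Set.range_comp]
  · rfl
  · intro c
    induction c using GSetClass.ind with | h X => ?_
    refine AddSubmonoid.closure_mono ?_ (mk_mem_closure_quotSet X)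
    rintro _ ⟨x, rfl⟩
    obtain ⟨L, hL⟩ := toSubgroup_surjective (MulAction.stabilizer (EG p n × EH p) x)
    exact ⟨L, by rw [← hL]; rfl⟩

variable (p n) in
/-- The basis of the Burnside ring formed by the elements `(L)`. -/
def clBasis : Module.Basis (Submodule (ZMod p) (EV p n)) ℤ (Burnside (EG p n × EH p)) :=
  Module.Basis.mk linearIndependent_cl span_range_cl.ge

@[simp]
theorem clBasis_apply (L : Submodule (ZMod p) (EV p n)) : clBasis p n L = cl L := by
  simp [clBasis]

/-- The class of `(G × H) / L` in the relative Burnside module. -/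
def relCl (L : {L : Submodule (ZMod p) (EV p n) // vecE p n ∉ L}) :
    BurnsideRel (EG p n) (EH p) :=
  Algebra.GrothendieckAddGroup.of
    ⟨GSetClass.mk (cosetSet L.1), cosetSet L.1, cosetSet_isRightFree L.1 L.2, rfl⟩

theorem relBurnsideIncl_relCl (L : {L : Submodule (ZMod p) (EV p n) // vecE p n ∉ L}) :
    relBurnsideIncl _ _ (relCl L) = cl L.1 := relBurnsideIncl_of _

theorem span_range_relCl : Submodule.span ℤ (Set.range (relCl (p := p) (n := n))) = ⊤ := by
  rw [← grothendieck_span_eq_top (Set.range fun L : {L : Submodule (ZMod p) (EV p n) //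
    vecE p n ∉ L} => (⟨GSetClass.mk (cosetSet L.1), cosetSet L.1, cosetSet_isRightFree L.1 L.2,
      rfl⟩ : relSets (EG p n) (EH p))) ?_, ← Set.range_comp]
  · rfl
  · rintro ⟨_, X, hX, rfl⟩
    have h1 := mk_mem_closure_quotSet X
    have h2 : AddSubmonoid.closure
        -- The decomposition takes place among all sets; freeness of `X` puts each orbit in the
        -- image of the submonoid, and injectivity of the inclusion brings the result back.
        {c | ∃ x : X.carrier, c = GSetClass.mk (quotSet (MulAction.stabilizer _ x))} ≤
        (AddSubmonoid.closure (Set.range fun L : {L : Submodule (ZMod p) (EV p n) //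
          vecE p n ∉ L} => (⟨GSetClass.mk (cosetSet L.1), cosetSet L.1,
            cosetSet_isRightFree L.1 L.2, rfl⟩ : relSets (EG p n) (EH p)))).map
          (relSets (EG p n) (EH p)).subtype := by
      rw [AddSubmonoid.closure_le]
      rintro _ ⟨x, rfl⟩
      obtain ⟨L, hL⟩ := toSubgroup_surjective (MulAction.stabilizer (EG p n × EH p) x)
      refine ⟨_, AddSubmonoid.subset_closure ⟨⟨L, vecE_notMem_of_isRightFree hX hL⟩, rfl⟩, ?_⟩
      rw [← hL]
      rfl
    obtain ⟨y, hy, hy'⟩ := h2 h1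
    have : y = ⟨GSetClass.mk X, X, hX, rfl⟩ := Subtype.ext hy'
    rwa [← this]

theorem linearIndependent_relCl : LinearIndependent ℤ (relCl (p := p) (n := n)) := by
  refine LinearIndependent.of_comp (relBurnsideIncl (EG p n) (EH p)) ?_
  have : relBurnsideIncl (EG p n) (EH p) ∘ relCl = cl ∘ Subtype.val :=
    funext relBurnsideIncl_relCl
  rw [this]
  exact linearIndependent_cl.comp _ Subtype.val_injective

variable (p n) in
/-- The basis of the relative Burnside module formed by the `(L)` with `e ∉ L`. -/
def relClBasis : Module.Basis {L : Submodule (ZMod p) (EV p n) // vecE p n ∉ L} ℤ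
    (BurnsideRel (EG p n) (EH p)) :=
  Module.Basis.mk linearIndependent_relCl span_range_relCl.ge

@[simp]
theorem relClBasis_apply (L : {L : Submodule (ZMod p) (EV p n) // vecE p n ∉ L}) :
    relClBasis p n L = relCl L := by
  simp [relClBasis]

theorem relBurnsideIncl_injective : Function.Injective (relBurnsideIncl (EG p n) (EH p)) := by
  rw [injective_iff_map_eq_zero]
  intro x hx
  rw [← (relClBasis p n).linearCombination_repr x, Finsupp.linearCombination_apply, Finsupp.sum,
    map_sum] at hx
  simp only [map_smul, relClBasis_apply, relBurnsideIncl_relCl] at hx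
  have h := linearIndependent_iff'.1 (linearIndependent_cl.comp
    (Subtype.val : {L : Submodule (ZMod p) (EV p n) // vecE p n ∉ L} → _)
    Subtype.val_injective) _ _ hx
  refine (relClBasis p n).repr.map_eq_zero_iff.1 (Finsupp.ext fun L => ?_)
  by_cases hL : L ∈ ((relClBasis p n).repr x).support
  · exact h L hL
  · exact Finsupp.notMem_support_iff.1 hL

theorem range_relBurnsideIncl : LinearMap.range (relBurnsideIncl (EG p n) (EH p)) =
    Submodule.span ℤ (cl '' {L | vecE p n ∉ L}) := by
  rw [LinearMap.range_eq_map, ← span_range_relCl, Submodule.map_span, ← Set.range_comp]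
  congr 1
  ext x
  constructor
  · rintro ⟨L, rfl⟩
    exact ⟨L.1, L.2, (relBurnsideIncl_relCl L).symm⟩
  · rintro ⟨L, hL, rfl⟩
    exact ⟨⟨L, hL⟩, relBurnsideIncl_relCl ⟨L, hL⟩⟩

end Elementary

/-! ### Characters of rational representations -/

section Characters

variable {Γ : Type} [Group Γ]

instance (M : FGMod Γ) : Module ℚ M.carrier :=
  Module.compHom M.carrier (algebraMap ℚ (MonoidAlgebra ℚ Γ))

theorem FGMod.rat_smul (M : FGMod Γ) (q : ℚ) (m : M.carrier) :
    q • m = (MonoidAlgebra.single (1 : Γ) q : MonoidAlgebra ℚ Γ) • m := rfl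

/-- The action of a group element on a module, as a `ℚ`-linear map. -/
def FGMod.act (M : FGMod Γ) (g : Γ) : M.carrier →ₗ[ℚ] M.carrier :=
  Algebra.lsmul ℚ ℚ M.carrier (MonoidAlgebra.single g 1 : MonoidAlgebra ℚ Γ)

theorem FGMod.act_apply (M : FGMod Γ) (g : Γ) (m : M.carrier) :
    M.act g m = (MonoidAlgebra.single g (1 : ℚ) : MonoidAlgebra ℚ Γ) • m := rfl

theorem FGMod.single_smul (M : FGMod Γ) (g : Γ) (r : ℚ) (m : M.carrier) :
    (MonoidAlgebra.single g r : MonoidAlgebra ℚ Γ) • m = r • M.act g m := by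
  rw [FGMod.act_apply, FGMod.rat_smul, smul_smul, MonoidAlgebra.single_mul_single, one_mul, mul_one]

instance [Finite Γ] (M : FGMod Γ) : Module.Finite ℚ M.carrier :=
  haveI : Module.Finite ℚ (MonoidAlgebra ℚ Γ) :=
    Module.Finite.equiv (MonoidAlgebra.coeffLinearEquiv ℚ).symm
  Module.Finite.trans (MonoidAlgebra ℚ Γ) M.carrier

/-- A `ℚ`-linear map commuting with the action of `Γ` is `ℚ[Γ]`-linear. -/
def FGMod.homOfAct {M N : FGMod Γ} (f : M.carrier →ₗ[ℚ] N.carrier)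
    (h : ∀ g m, f (M.act g m) = N.act g (f m)) :
    M.carrier →ₗ[MonoidAlgebra ℚ Γ] N.carrier :=
  { f with
    map_smul' := fun a m => by
      change f _ = a • f m
      induction a using MonoidAlgebra.induction_linear with
      | zero => simp
      | add x y hx hy => rw [add_smul, map_add, hx, hy, add_smul]
      | single g r => rw [FGMod.single_smul, FGMod.single_smul, map_smul, h] }

/-- The character of a module. -/
def FGMod.chi (g : Γ) (M : FGMod Γ) : ℚ := LinearMap.trace ℚ M.carrier (M.act g)

theorem FGMod.chi_eq_card (g : Γ) (M : FGMod Γ) {ι : Type} [Finite ι]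
    (b : Module.Basis ι ℚ M.carrier) (σ : ι → ι) (h : ∀ i, M.act g (b i) = b (σ i)) :
    M.chi g = Nat.card {i // σ i = i} := by
  classical
  have := Fintype.ofFinite ι
  rw [FGMod.chi, LinearMap.trace_eq_matrix_trace ℚ b, Matrix.trace]
  have : ∀ i, (LinearMap.toMatrix b b (M.act g)).diag i = if σ i = i then 1 else 0 := by
    intro i
    rw [Matrix.diag_apply, LinearMap.toMatrix_apply, h, b.repr_self, Finsupp.single_apply]
  simp only [this]
  rw [Finset.sum_boole, Nat.card_eq_fintype_card, Fintype.card_subtype]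

theorem FGMod.chi_congr (g : Γ) {M N : FGMod Γ} (e : M.carrier ≃ₗ[MonoidAlgebra ℚ Γ] N.carrier) :
    M.chi g = N.chi g := by
  have : N.act g = (e.restrictScalars ℚ).conj (M.act g) := by
    ext x
    rw [LinearEquiv.conj_apply_apply, FGMod.act_apply, FGMod.act_apply]
    change _ = e (_ • e.symm x)
    rw [map_smul, e.apply_symm_apply]
  rw [FGMod.chi, FGMod.chi, this, LinearMap.trace_conj']

theorem FGMod.chi_sum [Finite Γ] (g : Γ) (M N : FGMod Γ) :
    (M.sum N).chi g = M.chi g + N.chi g :=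
  LinearMap.trace_prodMap' (R := ℚ) (M.act g) (N.act g)

/-- The character as a function on isomorphism classes. -/
def ModClass.chi [Finite Γ] (g : Γ) : ModClass Γ →+ ℚ where
  toFun := Quotient.lift (FGMod.chi g) (by
    rintro M N ⟨e⟩
    exact FGMod.chi_congr g e)
  map_zero' := by
    have : Subsingleton (FGMod.zero (Γ := Γ)).carrier := inferInstanceAs (Subsingleton PUnit)
    change LinearMap.trace ℚ _ _ = 0
    rw [Subsingleton.elim ((FGMod.zero (Γ := Γ)).act g) 0, map_zero]
  map_add' a b := by
    induction a using ModClass.ind with | h M => ?_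
    induction b using ModClass.ind with | h N => ?_
    exact FGMod.chi_sum g M N

/-- The character as a homomorphism on the representation ring. -/
def RatRep.chi [Finite Γ] (g : Γ) : RatRep Γ →ₗ[ℤ] ℚ :=
  (Algebra.GrothendieckAddGroup.lift (ModClass.chi g)).toIntLinearMap

theorem RatRep.chi_of [Finite Γ] (g : Γ) (M : FGMod Γ) :
    RatRep.chi g (Algebra.GrothendieckAddGroup.of (ModClass.mk M)) = M.chi g :=
  grothendieck_lift_of _ _


/-- The `ℚ`-basis of a permutation module formed by the points. -/
def permBasis (X : FinGSet Γ) : Module.Basis X.carrier ℚ (permMod X).carrier :=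
  Module.Basis.ofRepr
    { ((MonoidAlgebra.coeffLinearEquiv ℚ : MonoidAlgebra ℚ X.carrier ≃ₗ[ℚ] _).toAddEquiv :
        (permMod X).carrier ≃+ (X.carrier →₀ ℚ)) with
      map_smul' := fun q m => map_rat_smul
        ((MonoidAlgebra.coeffLinearEquiv ℚ : MonoidAlgebra ℚ X.carrier ≃ₗ[ℚ] _).toAddEquiv :
        (permMod X).carrier ≃+ (X.carrier →₀ ℚ)) q m }

theorem act_permBasis (X : FinGSet Γ) (g : Γ) (x : X.carrier) :
    (permMod X).act g (permBasis X x) = permBasis X (g • x) := by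
  refine (permMod_single_smul X g 1 x 1).trans ?_
  rw [mul_one]
  rfl

theorem chi_natMap_mk [Finite Γ] (g : Γ) (X : FinGSet Γ) :
    RatRep.chi g (natMap Γ (Burnside.mk X)) = Nat.card {x : X.carrier // g • x = x} := by
  rw [natMap_mk, RatRep.chi_of]
  exact FGMod.chi_eq_card g _ (permBasis X) _ (act_permBasis X g)

/-- The `ℚ[Γ]`-linear map on a permutation module given by an equivariant map on points. -/
def permLift (X : FinGSet Γ) (N : FGMod Γ) (φ : X.carrier → N.carrier)
    (h : ∀ (g : Γ) x, φ (g • x) = N.act g (φ x)) :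
    (permMod X).carrier →ₗ[MonoidAlgebra ℚ Γ] N.carrier :=
  FGMod.homOfAct ((permBasis X).constr ℚ φ) (by
    intro g m
    refine LinearMap.congr_fun (f := (permBasis X).constr ℚ φ ∘ₗ (permMod X).act g)
      (g := N.act g ∘ₗ (permBasis X).constr ℚ φ) ((permBasis X).ext fun x => ?_) m
    rw [LinearMap.comp_apply, LinearMap.comp_apply, act_permBasis, Module.Basis.constr_basis,
      Module.Basis.constr_basis, h])

theorem permLift_permBasis (X : FinGSet Γ) (N : FGMod Γ) (φ : X.carrier → N.carrier)
    (h : ∀ (g : Γ) x, φ (g • x) = N.act g (φ x)) (x : X.carrier) :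
    permLift X N φ h (permBasis X x) = φ x :=
  (permBasis X).constr_basis ℚ φ x

end Characters

/-- The `H`-translates of a `ℚ[H]`-basis form a `ℚ`-basis which `h ≠ 1` permutes without fixed
points, so the trace vanishes. -/
theorem FGMod.IsRightFree.chi_eq_zero {G H : Type} [Group G] [Group H] [Finite G] [Finite H]
    {M : FGMod (G × H)} (hM : M.IsRightFree) {h : H} (hh : h ≠ 1) : M.chi (1, h) = 0 := by
  let : Module (MonoidAlgebra ℚ H) M.carrier :=
    Module.compHom M.carrier (MonoidAlgebra.mapDomainRingHom ℚ (MonoidHom.inr G H))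
  have hf : Module.Free (MonoidAlgebra ℚ H) M.carrier := hM
  let b₀ := Module.Free.chooseBasis (MonoidAlgebra ℚ H) M.carrier
  let c : Module.Basis H ℚ (MonoidAlgebra ℚ H) :=
    Module.Basis.ofRepr (MonoidAlgebra.coeffLinearEquiv ℚ)
  have hc : ∀ k, c k = MonoidAlgebra.single k 1 := fun k => rfl
  let b := c.smulTower b₀
  have hb : ∀ i, b i = (MonoidAlgebra.single i.1 (1 : ℚ) : MonoidAlgebra ℚ H) • b₀ i.2 := by
    rintro ⟨i, j⟩
    rw [Module.Basis.smulTower_apply, hc]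
  have : Finite (H × Module.Free.ChooseBasisIndex (MonoidAlgebra ℚ H) M.carrier) :=
    Module.Finite.finite_basis b
  rw [FGMod.chi_eq_card (1, h) M b (fun i => (h * i.1, i.2))]
  · have : IsEmpty {i : H × Module.Free.ChooseBasisIndex (MonoidAlgebra ℚ H) M.carrier //
        (h * i.1, i.2) = i} := by
      refine ⟨fun i => hh ?_⟩
      have := congrArg Prod.fst i.2
      simpa using this
    simp
  · intro i
    have key : ∀ v : M.carrier, M.act (1, h) v =
        (MonoidAlgebra.single h (1 : ℚ) : MonoidAlgebra ℚ H) • v := by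
      intro v
      change _ = (MonoidAlgebra.mapDomainRingHom ℚ (MonoidHom.inr G H)
        (MonoidAlgebra.single h 1)) • v
      simp [FGMod.act_apply]
    rw [key, hb, hb, smul_smul, MonoidAlgebra.single_mul_single, mul_one]

-- The polynomial `∑ a x X ^ i x` has degree below `p` but is divisible by the coprime factors `X -
-- 1` and `Φ_p` of `X ^ p - 1`, so it is zero. This will be the injectivity of `ℚ[Γ/K] → F × ℚ` for
-- `Γ/K` cyclic of order `p`.
open Polynomial in
theorem eq_zero_of_sum_pow_eq_zero {F ι : Type*} [Field F] [CharZero F] [Fintype ι] {p : ℕ}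
    [Fact p.Prime] {ζ : F} (hζ : IsPrimitiveRoot ζ p) (i : ι → ℕ) (hi : ∀ x, i x < p)
    (hinj : Function.Injective i) (a : ι → ℚ) (h1 : ∑ x, a x = 0)
    (h2 : ∑ x, a x • ζ ^ i x = 0) : a = 0 := by
  classical
  have hp := (Fact.out : p.Prime).one_lt
  let q : ℚ[X] := ∑ x, C (a x) * X ^ i x
  have hq1 : X - 1 ∣ q := by
    rw [← C_1, dvd_iff_isRoot, IsRoot, eval_finsetSum]
    simpa using h1
  have hq2 : cyclotomic p ℚ ∣ q := by
    rw [cyclotomic_eq_minpoly_rat hζ (by omega)]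
    apply minpoly.dvd
    rw [map_sum]
    simpa [Algebra.smul_def] using h2
  have hcop : IsCoprime (cyclotomic 1 ℚ) (cyclotomic p ℚ) := cyclotomic.isCoprime_rat (by omega)
  rw [cyclotomic_one] at hcop
  have hdvd := hcop.mul_dvd hq1 hq2
  have hdvd' : X ^ p - 1 ∣ q := by
    rwa [mul_comm, cyclotomic_prime_mul_X_sub_one] at hdvd
  have hdeg : q.degree < p := by
    refine (degree_sum_le _ _).trans_lt ((Finset.sup_lt_iff (WithBot.bot_lt_coe p)).2 ?_)
    intro x _
    refine (degree_C_mul_X_pow_le _ _).trans_lt ?_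
    exact WithBot.coe_lt_coe.2 (hi x)
  have hq0 : q = 0 := by
    refine eq_zero_of_dvd_of_degree_lt hdvd' ?_
    rwa [← C_1, degree_X_pow_sub_C (by omega)]
  funext x
  have := congrArg (fun r => coeff r (i x)) hq0
  simp only [q, finsetSum_coeff, coeff_C_mul, coeff_X_pow, hinj.eq_iff, mul_ite, mul_one, mul_zero,
    coeff_zero] at this
  simpa using this

/-! ### Representations of abelian groups of exponent `p` as combinations of permutation modules -/

section Simple

variable {Γ : Type} [CommGroup Γ] [Finite Γ]

/-- Let `K` be the kernel of `φ`. If `K = ⊤`, then `N` is the permutation module of a point.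
Otherwise `Γ/K` embeds in the group of `p`-th roots of unity, hence has order `p`, and `ℚ[Γ/K]` is
isomorphic to `N` plus the trivial module; so the class of `N` is a difference of two generators. -/
theorem of_mem_span_of_field {p : ℕ} [Fact p.Prime] (hΓ : ∀ g : Γ, g ^ p = 1)
    {F : Type} [Field F] [CharZero F] (N : FGMod Γ) (E₀ : N.carrier ≃+ F) (φ : Γ →* Fˣ)
    (hE₀ : ∀ g m, E₀ (N.act g m) = φ g * E₀ m)
    (hspan : AddSubgroup.closure {x : F | ∃ (r : ℚ) (g : Γ), x = r * φ g} = ⊤) :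
    Algebra.GrothendieckAddGroup.of (ModClass.mk N) ∈ Submodule.span ℤ
      {x | ∃ K : Subgroup Γ, (K.index = p ∨ K = ⊤) ∧ x = natMap Γ (Burnside.mk (quotSet K))} := by
  have hp := (Fact.out : p.Prime)
  let E : N.carrier ≃ₗ[ℚ] F := { E₀ with map_smul' := map_rat_smul E₀ }
  have hE : ∀ g m, E (N.act g m) = φ g * E m := hE₀
  let K := φ.ker
  let ψ₀ : Γ ⧸ K →* Fˣ := QuotientGroup.kerLift φ
  have hψ₀ : Function.Injective ψ₀ := QuotientGroup.kerLift_injective φ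
  let X := quotSet K
  let mk : Γ → X.carrier := fun g => (g : Γ ⧸ K)
  have hmk : ∀ x, ∃ g, mk g = x := Quotient.exists_rep
  let ψ : X.carrier → Fˣ := ψ₀
  have hψ : Function.Injective ψ := hψ₀
  have hψmk : ∀ g : Γ, ψ (mk g) = φ g := fun g => rfl
  let θ : X.carrier → N.carrier := fun x => E.symm (ψ x)
  have hEθ : ∀ x, E (θ x) = ψ x := fun x => E.apply_symm_apply _
  have hθ : ∀ (g : Γ) x, θ (g • x) = N.act g (θ x) := by
    intro g x
    obtain ⟨a, rfl⟩ := hmk x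
    apply E.injective
    have : g • mk a = mk (g * a) := rfl
    rw [hE, hEθ, hEθ, this, hψmk, hψmk, map_mul, Units.val_mul]
  let f : (permMod X).carrier →ₗ[MonoidAlgebra ℚ Γ] N.carrier := permLift X N θ hθ
  have hfθ : ∀ x, f (permBasis X x) = θ x := permLift_permBasis X N θ hθ
  have hf : ∀ x, E (f (permBasis X x)) = ψ x := fun x => by rw [hfθ, hEθ]
  -- The image is a `ℚ`-subspace containing every `r * φ g`, and these generate `F` additively.
  have hsurj : Function.Surjective f := by
    have h1 : LinearMap.range (E.toLinearMap ∘ₗ f.restrictScalars ℚ) = ⊤ := by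
      have h2 : AddSubgroup.closure {x : F | ∃ (r : ℚ) (g : Γ), x = r * φ g} ≤
          (LinearMap.range (E.toLinearMap ∘ₗ f.restrictScalars ℚ)).toAddSubgroup := by
        rw [AddSubgroup.closure_le]
        rintro _ ⟨r, g, rfl⟩
        refine ⟨r • permBasis X (mk g), ?_⟩
        rw [map_smul, ← Rat.smul_def]
        exact congrArg _ (hf _)
      rw [hspan] at h2
      exact eq_top_iff.2 fun x _ => h2 trivial
    intro m
    obtain ⟨v, hv⟩ := LinearMap.range_eq_top.1 h1 (E m)
    exact ⟨v, E.injective hv⟩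
  let : Fintype X.carrier := Fintype.ofFinite _
  have hsum : ∀ v, E (f v) = ∑ x : X.carrier, (permBasis X).repr v x • (ψ x : F) := by
    intro v
    conv_lhs => rw [← (permBasis X).sum_repr v]
    rw [map_sum, map_sum]
    refine Finset.sum_congr rfl fun x _ => ?_
    change E ((f.restrictScalars ℚ) _) = _
    rw [map_smul, map_smul]
    exact congrArg _ (hf x)
  by_cases hK : K = ⊤
  · have hinj : Function.Injective f := by
      rw [injective_iff_map_eq_zero]
      intro v hv
      have hX : Subsingleton X.carrier := QuotientGroup.subsingleton_iff.2 hK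
      have h0 := hsum v
      rw [hv, map_zero, Fintype.sum_subsingleton _ (mk 1)] at h0
      have h1 := (smul_eq_zero.1 h0.symm).resolve_right (Units.ne_zero _)
      refine (permBasis X).repr.map_eq_zero_iff.1 (Finsupp.ext fun x => ?_)
      rw [hX.elim x (mk 1), h1]
      rfl
    refine Submodule.subset_span ⟨K, Or.inr hK, ?_⟩
    rw [natMap_mk]
    exact congrArg _ (ModClass.mk_eq_mk.2 ⟨(LinearEquiv.ofBijective f ⟨hinj, hsurj⟩).symm⟩)
  · obtain ⟨g₀, hg₀⟩ : ∃ g, g ∉ K := by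
      by_contra! h
      exact hK (eq_top_iff.2 fun g _ => h g)
    have hζ1 : φ g₀ ≠ 1 := hg₀
    have hζp : φ g₀ ^ p = 1 := by rw [← map_pow, hΓ, map_one]
    have hζu : IsPrimitiveRoot (φ g₀) p := orderOf_eq_prime hζp hζ1 ▸ IsPrimitiveRoot.orderOf _
    have hζ : IsPrimitiveRoot (φ g₀ : F) p := IsPrimitiveRoot.coe_units_iff.2 hζu
    have : NeZero p := ⟨hp.ne_zero⟩
    have hi : ∀ x, ∃ i < p, (φ g₀ : F) ^ i = ψ x := by
      intro x
      refine hζ.eq_pow_of_pow_eq_one ?_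
      obtain ⟨a, rfl⟩ := hmk x
      rw [hψmk, ← Units.val_pow_eq_pow_val, ← map_pow, hΓ, map_one, Units.val_one]
    choose i hip hi using hi
    have hiinj : Function.Injective i := by
      intro x y hxy
      apply hψ
      apply Units.ext
      rw [← hi, ← hi, hxy]
    have hindex : K.index = p := by
      apply le_antisymm
      · rw [Subgroup.index, ← Nat.card_fin p]
        exact Nat.card_le_card_of_injective (fun x : Γ ⧸ K => (⟨i x, hip x⟩ : Fin p))
          fun x y h => hiinj (Fin.ext_iff.1 h)
      · have h1 : orderOf ((g₀ : Γ) : Γ ⧸ K) = p :=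
          (orderOf_injective ψ₀ hψ₀ _).symm.trans (orderOf_eq_prime hζp hζ1)
        rw [← h1]
        exact orderOf_le_card
    let T := permMod (quotSet (⊤ : Subgroup Γ))
    let pt : (quotSet (⊤ : Subgroup Γ)).carrier := ((1 : Γ) : Γ ⧸ (⊤ : Subgroup Γ))
    have hpt : ∀ x, x = pt := fun x =>
      (QuotientGroup.subsingleton_iff.2 rfl : Subsingleton (Γ ⧸ (⊤ : Subgroup Γ))).elim _ _
    have hT : ∀ (g : Γ) (_ : X.carrier), permBasis _ pt = T.act g (permBasis _ pt) := by
      intro g x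
      rw [act_permBasis, hpt (g • pt)]
    let f₂ : (permMod X).carrier →ₗ[MonoidAlgebra ℚ Γ] T.carrier :=
      permLift X T (fun _ => permBasis _ pt) hT
    have hf₂ : ∀ x, f₂ (permBasis X x) = permBasis _ pt := permLift_permBasis X T _ hT
    have hsum₂ : ∀ v, f₂ v = (∑ x, (permBasis X).repr v x) • permBasis _ pt := by
      intro v
      conv_lhs => rw [← (permBasis X).sum_repr v]
      rw [map_sum, Finset.sum_smul]
      refine Finset.sum_congr rfl fun x _ => ?_
      change (f₂.restrictScalars ℚ) _ = _
      rw [map_smul]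
      exact congrArg _ (hf₂ x)
    have hinj : Function.Injective (f.prod f₂) := by
      rw [injective_iff_map_eq_zero]
      intro v hv
      have hv1 : f v = 0 := congrArg Prod.fst hv
      have hv2 : f₂ v = 0 := congrArg Prod.snd hv
      rw [hsum₂] at hv2
      have h1 := (smul_eq_zero.1 hv2).resolve_right ((permBasis _).ne_zero _)
      have h2 := hsum v
      rw [hv1, map_zero] at h2
      have := eq_zero_of_sum_pow_eq_zero hζ i hip hiinj _ h1 (by
        rw [h2]
        exact Finset.sum_congr rfl fun x _ => by rw [hi])
      exact (permBasis X).repr.map_eq_zero_iff.1 (Finsupp.ext fun x => congrFun this x)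
    have hsurj₂ : Function.Surjective (f.prod f₂) := by
      -- The sum `w` of all points is fixed by `g₀`, so `φ g₀ ≠ 1` forces `f w = 0`, whereas `f₂ w`
      -- is `p` times the point. Multiples of `w` therefore correct the second component without
      -- changing the first.
      let w : (permMod X).carrier := ∑ x, permBasis X x
      have hw : (permMod X).act g₀ w = w := by
        rw [map_sum]
        simp only [act_permBasis]
        exact Equiv.sum_comp (MulAction.toPerm g₀) fun x => permBasis X x
      have hfw : f w = 0 := by
        have h1 : E (f w) = φ g₀ * E (f w) := by
          rw [← hE]
          conv_lhs => rw [← hw]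
          rw [FGMod.act_apply, FGMod.act_apply, map_smul]
        have h2 : ((φ g₀ : F) - 1) * E (f w) = 0 := by
          rw [sub_mul, ← h1, one_mul, sub_self]
        have h3 := (mul_eq_zero.1 h2).resolve_left (sub_ne_zero.2 (hζ.ne_one hp.one_lt))
        exact E.map_eq_zero_iff.1 h3
      have hf₂w : f₂ w = (p : ℚ) • permBasis _ pt := by
        have hcard : Fintype.card X.carrier = p := by
          rw [← Nat.card_eq_fintype_card, ← hindex]
          rfl
        rw [map_sum]
        simp only [hf₂]
        rw [Finset.sum_const, Finset.card_univ, hcard, Nat.cast_smul_eq_nsmul]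
      rintro ⟨m, t⟩
      obtain ⟨v, rfl⟩ := hsurj m
      have ht : ∃ τ : ℚ, t - f₂ v = τ • permBasis _ pt := by
        refine ⟨(permBasis _).repr (t - f₂ v) pt, ?_⟩
        have hsub : Subsingleton (quotSet (⊤ : Subgroup Γ)).carrier :=
          ⟨fun a b => (hpt a).trans (hpt b).symm⟩
        have : Fintype (quotSet (⊤ : Subgroup Γ)).carrier := Fintype.ofFinite _
        conv_lhs => rw [← (permBasis _).sum_repr (t - f₂ v), Fintype.sum_subsingleton _ pt]
      obtain ⟨τ, hτ⟩ := ht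
      refine ⟨v + (τ / p) • w, ?_⟩
      have hp0 : (p : ℚ) ≠ 0 := Nat.cast_ne_zero.2 hp.ne_zero
      refine Prod.ext ?_ ?_
      · change (f.restrictScalars ℚ) _ = f v
        rw [map_add, map_smul]
        change f v + _ • f w = f v
        rw [hfw, smul_zero, add_zero]
      · change (f₂.restrictScalars ℚ) _ = t
        rw [map_add, map_smul]
        change f₂ v + _ • f₂ w = t
        rw [hf₂w, smul_smul, div_mul_cancel₀ _ hp0, ← hτ, add_sub_cancel]
    have hclass : ModClass.mk N + ModClass.mk T = ModClass.mk (permMod X) := by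
      rw [ModClass.mk_add_mk]
      exact ModClass.mk_eq_mk.2 ⟨(LinearEquiv.ofBijective (f.prod f₂) ⟨hinj, hsurj₂⟩).symm⟩
    have h1 : Algebra.GrothendieckAddGroup.of (ModClass.mk N) =
        natMap Γ (Burnside.mk X) - natMap Γ (Burnside.mk (quotSet ⊤)) := by
      rw [natMap_mk, natMap_mk, ← hclass, map_add, add_sub_cancel_right]
    rw [h1]
    exact Submodule.sub_mem _ (Submodule.subset_span ⟨K, Or.inl hindex, rfl⟩)
      (Submodule.subset_span ⟨⊤, Or.inr rfl, rfl⟩)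

/-- The group algebra is commutative, so a simple module is its quotient by a maximal ideal: a
field, on which each `g` acts as multiplication by its image. -/
theorem of_mem_span_of_isSimpleModule {p : ℕ} [Fact p.Prime] (hΓ : ∀ g : Γ, g ^ p = 1)
    (S : FGMod Γ) (hS : IsSimpleModule (MonoidAlgebra ℚ Γ) S.carrier) :
    Algebra.GrothendieckAddGroup.of (ModClass.mk S) ∈ Submodule.span ℤ
      {x | ∃ K : Subgroup Γ, (K.index = p ∨ K = ⊤) ∧ x = natMap Γ (Burnside.mk (quotSet K))} := by
  obtain ⟨I, hI, ⟨e⟩⟩ := isSimpleModule_iff_quot_maximal.1 hS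
  let F := MonoidAlgebra ℚ Γ ⧸ I
  let N : FGMod Γ := ⟨F⟩
  have h1 : ModClass.mk S = ModClass.mk N := ModClass.mk_eq_mk.2 ⟨e⟩
  rw [h1]
  let : Field F := Ideal.Quotient.field I
  have : CharZero F := charZero_of_injective_algebraMap (algebraMap ℚ F).injective
  let φ : Γ →* Fˣ := ((Ideal.Quotient.mk I).toMonoidHom.comp (MonoidAlgebra.of ℚ Γ)).toHomUnits
  have hφ : ∀ g, (φ g : F) = Ideal.Quotient.mk I (MonoidAlgebra.single g 1) := fun g => rfl
  refine of_mem_span_of_field hΓ (F := F) N (AddEquiv.refl F) φ ?_ ?_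
  · intro g m
    rfl
  · refine eq_top_iff.2 fun x _ => ?_
    obtain ⟨a, rfl⟩ := Ideal.Quotient.mk_surjective x
    induction a using MonoidAlgebra.induction_linear with
    | zero => rw [map_zero]; exact zero_mem _
    | add x y hx hy => rw [map_add]; exact add_mem (hx trivial) (hy trivial)
    | single g r =>
      refine AddSubgroup.subset_closure ⟨r, g, ?_⟩
      have h2 := eq_ratCast ((Ideal.Quotient.mk I).comp (algebraMap ℚ (MonoidAlgebra ℚ Γ))) r
      rw [← h2, hφ, RingHom.comp_apply, ← map_mul]
      simp

/-- Maschke's theorem splits off a simple submodule; induction on the dimension over `ℚ` handles the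
complement. -/
theorem of_mem_span_permMod {p : ℕ} [Fact p.Prime] (hΓ : ∀ g : Γ, g ^ p = 1) (M : FGMod Γ) :
    Algebra.GrothendieckAddGroup.of (ModClass.mk M) ∈ Submodule.span ℤ
      {x | ∃ K : Subgroup Γ, (K.index = p ∨ K = ⊤) ∧ x = natMap Γ (Burnside.mk (quotSet K))} := by
  generalize hm : Module.finrank ℚ M.carrier = m
  induction m using Nat.strong_induction_on generalizing M with
  | _ m ih =>
  rcases subsingleton_or_nontrivial M.carrier with hM | hM
  · have : ModClass.mk M = 0 := by
      have : Subsingleton (FGMod.zero (Γ := Γ)).carrier := inferInstanceAs (Subsingleton PUnit)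
      exact ModClass.mk_eq_mk.2 ⟨LinearEquiv.ofSubsingleton _ _⟩
    rw [this, map_zero]
    exact zero_mem _
  · have : NeZero (Nat.card Γ : ℚ) := ⟨Nat.cast_ne_zero.2 Nat.card_pos.ne'⟩
    obtain ⟨S, hS⟩ := IsSemisimpleModule.exists_simple_submodule (MonoidAlgebra ℚ Γ) M.carrier
    obtain ⟨S', hS'⟩ := exists_isCompl S
    have hM : Module.Finite ℚ M.carrier := inferInstance
    have : Module.Finite ℚ S := Module.Finite.of_injective (S.subtype.restrictScalars ℚ)
      S.subtype_injective
    have : Module.Finite ℚ S' := Module.Finite.of_injective (S'.subtype.restrictScalars ℚ)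
      S'.subtype_injective
    have : Module.Finite (MonoidAlgebra ℚ Γ) S := Module.Finite.of_restrictScalars_finite ℚ _ _
    have : Module.Finite (MonoidAlgebra ℚ Γ) S' := Module.Finite.of_restrictScalars_finite ℚ _ _
    have hdim : Module.finrank ℚ S + Module.finrank ℚ S' = m := by
      rw [← hm, ← Module.finrank_prod]
      exact LinearEquiv.finrank_eq ((Submodule.prodEquivOfIsCompl S S' hS').restrictScalars ℚ)
    have hpos : 0 < Module.finrank ℚ S := by
      have : Nontrivial S := hS.nontrivial
      exact Module.finrank_pos
    let N : FGMod Γ := ⟨S⟩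
    let N' : FGMod Γ := ⟨S'⟩
    have h1 : ModClass.mk M = ModClass.mk N + ModClass.mk N' := by
      rw [ModClass.mk_add_mk]
      exact ModClass.mk_eq_mk.2 ⟨(Submodule.prodEquivOfIsCompl S S' hS').symm⟩
    rw [h1, map_add]
    refine add_mem (of_mem_span_of_isSimpleModule hΓ N hS) ?_
    refine ih (Module.finrank ℚ S') (by omega) N' ?_
    rfl

end Simple

/-! ### Counting intermediate subspaces -/

section Subspaces

/-- The subspaces strictly between `L` and `S` are the lines of the plane `S / L`, that is, the
points of a projective line. -/
theorem ncard_Ioo_of_finrank_add_two {K V : Type*} [Field K] [Finite K] [AddCommGroup V]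
    [Module K V] [Module.Finite K V] {L S : Submodule K V} (h : L ≤ S)
    (hS : Module.finrank K S = Module.finrank K L + 2) :
    (Set.Ioo L S).ncard = Nat.card K + 1 := by
  obtain ⟨L', hL'⟩ : ∃ L', L' = L.submoduleOf S := ⟨_, rfl⟩
  have hrank : Module.finrank K L' = Module.finrank K L :=
    hL' ▸ (Submodule.submoduleOfEquivOfLe h).finrank_eq
  have hQ : Module.finrank K (S ⧸ L') = 2 := by
    have := Submodule.finrank_quotient_add_finrank L'
    omega
  obtain ⟨g, hgdef⟩ : ∃ g : Submodule K (S ⧸ L') → Submodule K V,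
      ∀ H, g H = (H.comap L'.mkQ).map S.subtype := ⟨_, fun _ => rfl⟩
  have hg : ∀ A B, g A ≤ g B ↔ A ≤ B := by
    intro A B
    rw [hgdef, hgdef, Submodule.map_le_map_iff_of_injective S.subtype_injective,
      Submodule.comap_le_comap_iff_of_surjective L'.mkQ_surjective]
  have hginj : Function.Injective g := fun A B hAB =>
    le_antisymm ((hg A B).1 hAB.le) ((hg B A).1 hAB.ge)
  have hglt : ∀ A B, g A < g B ↔ A < B := fun A B => by
    rw [lt_iff_le_not_ge, lt_iff_le_not_ge, hg, hg]
  have hbot : g ⊥ = L := by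
    rw [hgdef, Submodule.comap_bot, Submodule.ker_mkQ, hL']
    exact (Submodule.map_comap_subtype S L).trans (inf_eq_right.2 h)
  have htop : g ⊤ = S := by simp [hgdef]
  have hIoo : ∀ H, g H ∈ Set.Ioo L S ↔ Module.finrank K H = 1 := by
    intro H
    have h1 : L < g H ↔ ⊥ < H := by
      rw [← hglt, hbot]
    have h2 : g H < S ↔ H < ⊤ := by
      rw [← hglt, htop]
    rw [Set.mem_Ioo, h1, h2]
    constructor
    · rintro ⟨h3, h4⟩
      have h3 := Submodule.finrank_lt_finrank_of_lt h3
      have h4 := Submodule.finrank_lt_finrank_of_lt h4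
      rw [finrank_top, hQ] at h4
      rw [finrank_bot] at h3
      omega
    · intro hH
      rw [bot_lt_iff_ne_bot, lt_top_iff_ne_top]
      constructor
      · rintro rfl
        simp at hH
      · rintro rfl
        rw [finrank_top, hQ] at hH
        omega
  have himage : g '' {H | Module.finrank K H = 1} = Set.Ioo L S := by
    ext C
    constructor
    · rintro ⟨H, hH, rfl⟩
      exact (hIoo H).2 hH
    · intro hC
      have hC' : g ((C.submoduleOf S).map L'.mkQ) = C := by
        have h3 : L' ⊔ C.submoduleOf S = C.submoduleOf S := by
          rw [hL']
          exact sup_eq_right.2 (Submodule.comap_mono hC.1.le)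
        rw [hgdef, Submodule.comap_map_mkQ, h3]
        exact (Submodule.map_comap_subtype S C).trans (inf_eq_right.2 hC.2.le)
      refine ⟨_, (hIoo _).1 ?_, hC'⟩
      rwa [hC']
  rw [← himage, Set.ncard_image_of_injective _ hginj, ← Projectivization.card_of_finrank_two K (S ⧸ L') hQ,
    Nat.card_congr (Projectivization.equivSubmodule K (S ⧸ L'))]
  rfl

end Subspaces

/-! ### Dimensions of invariants, a basis of `R`, and the relation behind `t` -/

section Elementary

variable {p n : ℕ}

/-- A vector, as an element of the group `G × H`. -/
def ofVec (v : EV p n) : EG p n × EH p := (Multiplicative.ofAdd v.1, Multiplicative.ofAdd v.2)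

theorem ofVec_mem_toSubgroup {L : Submodule (ZMod p) (EV p n)} {v : EV p n} :
    ofVec v ∈ toSubgroup L ↔ v ∈ L := Iff.rfl

theorem pow_eq_one (g : EG p n × EH p) : g ^ p = 1 := by
  have h : p • ((g.1.toAdd, g.2.toAdd) : EV p n) = 0 := by
    refine Prod.ext ?_ ?_
    · funext i
      simp
    · simp
  exact h

variable [Fact p.Prime]

theorem finrank_EV : Module.finrank (ZMod p) (EV p n) = n + 1 := by simp [EV]

theorem finrank_le (L : Submodule (ZMod p) (EV p n)) : Module.finrank (ZMod p) L ≤ n + 1 :=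
  (Submodule.finrank_le L).trans_eq finrank_EV

theorem eq_top_of_lt_finrank {L : Submodule (ZMod p) (EV p n)}
    (h : n < Module.finrank (ZMod p) L) : L = ⊤ := by
  apply Submodule.eq_top_of_finrank_eq
  rw [finrank_EV]
  have := finrank_le L
  omega

theorem card_submodule (L : Submodule (ZMod p) (EV p n)) :
    Nat.card L = p ^ Module.finrank (ZMod p) L := by
  rw [Module.natCard_eq_pow_finrank (K := ZMod p), Nat.card_zmod]

theorem index_toSubgroup (L : Submodule (ZMod p) (EV p n)) :
    (toSubgroup L).index = p ^ (n + 1 - Module.finrank (ZMod p) L) := by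
  have h1 := (toSubgroup L).index_mul_card
  have h2 : Nat.card (toSubgroup L) = p ^ Module.finrank (ZMod p) L :=
    (Nat.card_congr (Equiv.refl _)).trans (card_submodule L)
  have h3 : Nat.card (EG p n × EH p) = p ^ (n + 1) := by
    rw [← finrank_EV (p := p) (n := n)]
    exact (Module.natCard_eq_pow_finrank (K := ZMod p) (V := EV p n)).trans (by rw [Nat.card_zmod])
  have hp := (Fact.out : p.Prime).pos
  rw [h2, h3, ← Nat.sub_add_cancel (finrank_le L), pow_add] at h1
  exact Nat.eq_of_mul_eq_mul_right (pow_pos hp _) h1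

-- In an abelian group a vector fixes all cosets of `L` or none, according to whether it lies in
-- `L`.
open Classical in
theorem chi_natMap_cl (v : EV p n) (L : Submodule (ZMod p) (EV p n)) :
    RatRep.chi (ofVec v) (natMap _ (cl L)) =
      if v ∈ L then ((p ^ (n + 1 - Module.finrank (ZMod p) L) : ℕ) : ℚ) else 0 := by
  rw [cl, chi_natMap_mk, ← index_toSubgroup]
  have h : ∀ x : (cosetSet L).carrier, ofVec v • x = x ↔ v ∈ L := by
    intro x
    induction x using QuotientGroup.induction_on with | H a => ?_
    change ((ofVec v * a : EG p n × EH p) : (EG p n × EH p) ⧸ toSubgroup L) = a ↔ _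
    rw [eq_comm, QuotientGroup.eq, mul_comm, mul_inv_cancel_right, ofVec_mem_toSubgroup]
  simp only [h]
  split_ifs with hv
  · exact congrArg Nat.cast (Nat.card_congr (Equiv.subtypeUnivEquiv fun _ => hv))
  · have : IsEmpty {_x : (cosetSet L).carrier // v ∈ L} := ⟨fun x => hv x.2⟩
    simp [hv]

/-- The dimension of the invariants of a subspace, computed as an average of characters. -/
def invDim (K : Submodule (ZMod p) (EV p n)) : RatRep (EG p n × EH p) →ₗ[ℤ] ℚ :=
  letI := Fintype.ofFinite K
  ((Nat.card K : ℚ)⁻¹ • LinearMap.lsmul ℚ ℚ 1).restrictScalars ℤ ∘ₗ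
    ∑ v : K, RatRep.chi (ofVec v.1)

/-- The characters add up to `|K ∩ L|` times the index of `L`; after division by `|K|` the dimension
formula leaves the index of `K + L`, which is the number of `K`-orbits on the coset space. -/
theorem invDim_natMap_cl (K L : Submodule (ZMod p) (EV p n)) :
    invDim K (natMap _ (cl L)) =
      ((p ^ (n + 1 - Module.finrank (ZMod p) (K ⊔ L : Submodule (ZMod p) (EV p n))) : ℕ) : ℚ) := by
  classical
  let := Fintype.ofFinite K
  have h1 : invDim K (natMap _ (cl L)) =
      (Nat.card K : ℚ)⁻¹ * ∑ v : K, RatRep.chi (ofVec v.1) (natMap _ (cl L)) := by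
    simp [invDim]
  have h2 : (Finset.univ.filter fun v : K => v.1 ∈ L).card =
      Nat.card (K ⊓ L : Submodule (ZMod p) (EV p n)) := by
    rw [← Fintype.card_subtype, ← Nat.card_eq_fintype_card]
    exact Nat.card_congr (Equiv.subtypeSubtypeEquivSubtypeInter (· ∈ K) (· ∈ L))
  rw [h1]
  simp only [chi_natMap_cl]
  rw [← Finset.sum_filter, Finset.sum_const, h2, card_submodule, card_submodule, nsmul_eq_mul]
  have hp : (p : ℚ) ≠ 0 := Nat.cast_ne_zero.2 (Fact.out : p.Prime).ne_zero
  rw [inv_mul_eq_div, div_eq_iff (by exact_mod_cast pow_ne_zero _ (Fact.out : p.Prime).ne_zero)]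
  have h3 := Submodule.finrank_sup_add_finrank_inf_eq K L
  have h4 := finrank_le (K ⊔ L)
  have h5 := finrank_le L
  push_cast
  rw [← pow_add, ← pow_add]
  congr 1
  omega

theorem invDim_top (L : Submodule (ZMod p) (EV p n)) : invDim ⊤ (natMap _ (cl L)) = 1 := by
  rw [invDim_natMap_cl, top_sup_eq, finrank_top, finrank_EV]
  simp

open Classical in
theorem invDim_hyperplane {K : Submodule (ZMod p) (EV p n)} (hK : Module.finrank (ZMod p) K = n)
    (L : Submodule (ZMod p) (EV p n)) :
    invDim K (natMap _ (cl L)) = 1 + if L ≤ K then (p : ℚ) - 1 else 0 := by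
  rw [invDim_natMap_cl]
  split_ifs with h
  · rw [sup_eq_left.2 h, hK]
    simp
  · have : K ⊔ L = ⊤ := by
      apply eq_top_of_lt_finrank
      refine hK.symm.trans_lt ?_
      exact Submodule.finrank_lt_finrank_of_lt (lt_of_le_of_ne le_sup_left
        fun h' => h (le_sup_right.trans h'.ge))
    rw [this, finrank_top, finrank_EV]
    simp

instance : Fintype {C : Submodule (ZMod p) (EV p n) // n ≤ Module.finrank (ZMod p) C} :=
  Fintype.ofFinite _

/-- `K = ⊤` shows that the coefficients sum to zero. For a hyperplane `K`, the only subspace of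
codimension at most 1 inside `K` is `K` itself, so the value there reduces to `(p - 1) b K`. The
coefficient of `⊤` then vanishes by the first equation. -/
theorem eq_zero_of_invDim_sum
    (b : {C : Submodule (ZMod p) (EV p n) // n ≤ Module.finrank (ZMod p) C} → ℤ)
    (h : ∀ K : Submodule (ZMod p) (EV p n), n ≤ Module.finrank (ZMod p) K →
      invDim K (∑ C, b C • natMap _ (cl C.1)) = 0) (C) : b C = 0 := by
  classical
  have hp : (p : ℚ) - 1 ≠ 0 := by
    rw [sub_ne_zero]
    exact_mod_cast (Fact.out : p.Prime).one_lt.ne'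
  have hsum : ∑ C, (b C : ℚ) = 0 := by
    have := h ⊤ (by rw [finrank_top, finrank_EV]; omega)
    simpa [map_sum, invDim_top] using this
  have hhyp : ∀ K : {C : Submodule (ZMod p) (EV p n) // n ≤ Module.finrank (ZMod p) C},
      K.1 ≠ ⊤ → b K = 0 := by
    intro K hK
    have hKn : Module.finrank (ZMod p) K.1 = n :=
      le_antisymm (not_lt.1 fun h' => hK (eq_top_of_lt_finrank h')) K.2
    have h1 := h K.1 K.2
    rw [map_sum] at h1
    have h2 : ∀ C, invDim K.1 (b C • natMap _ (cl C.1)) =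
        b C + if C = K then (b C : ℚ) * (p - 1) else 0 := by
      intro C
      have : C.1 ≤ K.1 ↔ C = K :=
        ⟨fun h' => Subtype.ext (Submodule.eq_of_le_of_finrank_le h' (hKn.trans_le C.2)),
          fun h' => h' ▸ le_rfl⟩
      rw [map_zsmul, invDim_hyperplane hKn, zsmul_eq_mul, mul_add, mul_one]
      simp only [this, mul_ite, mul_zero]
    simp only [h2] at h1
    rw [Finset.sum_add_distrib, hsum, zero_add, Finset.sum_ite_eq' Finset.univ K,
      if_pos (Finset.mem_univ _)] at h1
    exact_mod_cast (mul_eq_zero.1 h1).resolve_right hp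
  by_cases hC : C.1 = ⊤
  · rw [Finset.sum_eq_single C] at hsum
    · exact_mod_cast hsum
    · intro D _ hD
      rw [hhyp D (fun h' => hD (Subtype.ext (h'.trans hC.symm)))]
      simp
    · simp
  · exact hhyp C hC

theorem linearIndependent_natMap_cl : LinearIndependent ℤ
    (fun C : {C : Submodule (ZMod p) (EV p n) // n ≤ Module.finrank (ZMod p) C} =>
      natMap _ (cl C.1)) := by
  rw [Fintype.linearIndependent_iff]
  intro b hb
  refine eq_zero_of_invDim_sum b fun K _ => ?_
  rw [hb, map_zero]

theorem span_natMap_cl : Submodule.span ℤ (Set.range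
    (fun C : {C : Submodule (ZMod p) (EV p n) // n ≤ Module.finrank (ZMod p) C} =>
      natMap _ (cl C.1))) = ⊤ := by
  refine grothendieck_le _ fun M => ?_
  induction M using ModClass.ind with | h M => ?_
  refine Submodule.span_mono ?_ (of_mem_span_permMod (p := p) pow_eq_one M)
  rintro _ ⟨K, hK, rfl⟩
  obtain ⟨L, rfl⟩ := toSubgroup_surjective K
  refine ⟨⟨L, ?_⟩, rfl⟩
  have hp := (Fact.out : p.Prime).one_lt
  have hle := finrank_le L
  have h1 : p ^ (n + 1 - Module.finrank (ZMod p) L) ≤ p ^ 1 := by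
    rw [← index_toSubgroup, pow_one]
    rcases hK with hK | hK
    · exact hK.le
    · rw [hK, Subgroup.index_top]
      exact hp.le
  have := (Nat.pow_le_pow_iff_right hp).1 h1
  omega

theorem natMap_surjective : Function.Surjective (natMap (EG p n × EH p)) := by
  rw [← LinearMap.range_eq_top, eq_top_iff, ← span_natMap_cl, Submodule.span_le]
  rintro _ ⟨C, rfl⟩
  exact ⟨_, rfl⟩

theorem exists_sum_natMap_cl (x : RatRep (EG p n × EH p)) :
    ∃ b : {C : Submodule (ZMod p) (EV p n) // n ≤ Module.finrank (ZMod p) C} → ℤ,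
      ∑ C, b C • natMap _ (cl C.1) = x :=
  (Submodule.mem_span_range_iff_exists_fun ℤ).1 (span_natMap_cl.ge (Submodule.mem_top (x := x)))

theorem eq_zero_of_invDim {x : RatRep (EG p n × EH p)}
    (h : ∀ K : Submodule (ZMod p) (EV p n), n ≤ Module.finrank (ZMod p) K → invDim K x = 0) :
    x = 0 := by
  obtain ⟨b, rfl⟩ := exists_sum_natMap_cl x
  have := eq_zero_of_invDim_sum b h
  simp [this]

theorem finrank_of_mem_Ioo {L S C : Submodule (ZMod p) (EV p n)}
    (hS : Module.finrank (ZMod p) S = Module.finrank (ZMod p) L + 2) (hC : C ∈ Set.Ioo L S) :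
    Module.finrank (ZMod p) C = Module.finrank (ZMod p) L + 1 := by
  have h1 := Submodule.finrank_lt_finrank_of_lt hC.1
  have h2 := Submodule.finrank_lt_finrank_of_lt hC.2
  omega

/-- It suffices to test with `invDim K`. The constant parts give `1 - (p + 1) + p = 0`. For a
hyperplane `K` there remains `p - 1` times `[L ≤ K] - #{C ≤ K} + p [S ≤ K]`, which is `1 - (p + 1) +
p` if `S ≤ K`, `1 - 1` if only `L ≤ K`, and `0` otherwise. -/
theorem natMap_relation {L S : Submodule (ZMod p) (EV p n)} (hLS : L ≤ S)
    (hS : Module.finrank (ZMod p) S = Module.finrank (ZMod p) L + 2) :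
    natMap _ (cl L - (∑ᶠ C ∈ Set.Ioo L S, cl C) + (p : ℤ) • cl S) = 0 := by
  classical
  have hfin := Set.toFinite (Set.Ioo L S)
  have hcard : hfin.toFinset.card = p + 1 := by
    rw [← Set.ncard_eq_toFinset_card, ncard_Ioo_of_finrank_add_two hLS hS, Nat.card_zmod]
  rw [finsum_mem_eq_finite_toFinset_sum _ hfin]
  refine eq_zero_of_invDim fun K hK => ?_
  rw [map_add, map_sub, map_sum, map_zsmul, map_add, map_sub, map_sum, map_zsmul]
  by_cases hKtop : K = ⊤
  · subst hKtop
    simp only [invDim_top]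
    rw [Finset.sum_const, hcard]
    simp
  · have hKn : Module.finrank (ZMod p) K = n :=
      le_antisymm (not_lt.1 fun h' => hKtop (eq_top_of_lt_finrank h')) hK
    simp only [invDim_hyperplane hKn]
    rw [Finset.sum_add_distrib, Finset.sum_const, hcard]
    by_cases hSK : S ≤ K
    · rw [if_pos (hLS.trans hSK), if_pos hSK, Finset.sum_congr rfl (g := fun _ => (p : ℚ) - 1),
        Finset.sum_const, hcard]
      · simp only [nsmul_eq_mul, zsmul_eq_mul]
        push_cast
        ring
      · intro C hC
        rw [Set.Finite.mem_toFinset] at hC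
        rw [if_pos (hC.2.le.trans hSK)]
    · rw [if_neg hSK]
      by_cases hLK : L ≤ K
      · have hrank := Submodule.finrank_sup_add_finrank_inf_eq S K
        have hsup : S ⊔ K = ⊤ := by
          apply eq_top_of_lt_finrank
          refine hKn.symm.trans_lt ?_
          exact Submodule.finrank_lt_finrank_of_lt (lt_of_le_of_ne le_sup_right
            fun h' => hSK (le_sup_left.trans h'.ge))
        rw [hsup, finrank_top, finrank_EV] at hrank
        -- Here `K` cuts `S` in codimension 1, so `S ⊓ K` is the unique intermediate subspace
        -- contained in `K`.
        have hmem : S ⊓ K ∈ hfin.toFinset := by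
          rw [Set.Finite.mem_toFinset]
          constructor
          · refine lt_of_le_of_ne (le_inf hLS hLK) fun h' => ?_
            rw [← h'] at hrank
            omega
          · refine lt_of_le_of_ne inf_le_left fun h' => hSK (inf_eq_left.1 h')
        rw [if_pos hLK, Finset.sum_eq_single (S ⊓ K)]
        · rw [if_pos inf_le_right]
          simp only [nsmul_eq_mul, zsmul_eq_mul]
          push_cast
          ring
        · intro C hC hne
          rw [if_neg]
          intro hCK
          rw [Set.Finite.mem_toFinset] at hC
          have h1 := finrank_of_mem_Ioo hS hC
          exact hne (Submodule.eq_of_le_of_finrank_le (le_inf hC.2.le hCK) (by omega))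
        · exact fun h' => (h' hmem).elim
      · rw [if_neg hLK, Finset.sum_eq_zero]
        · simp
        · intro C hC
          rw [Set.Finite.mem_toFinset] at hC
          rw [if_neg fun h' => hLK (hC.1.le.trans h')]

end Elementary

/-! ### Injectivity of `R' → R` -/

section Injectivity

variable {G H : Type} [Group G] [Group H] [Finite G] [Finite H]

/-- A finitely generated module is a quotient of a free one of finite rank, and by Maschke the
kernel is a complementary summand. The free module is realized as the permutation module of `k`
copies of the group, which is an `H`-free set. -/
theorem exists_add_mem_relMods (c : ModClass (G × H)) : ∃ d, c + d ∈ relMods G H := by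
  induction c using ModClass.ind with | h P => ?_
  obtain ⟨k, s, hs⟩ := Module.Finite.exists_fin (R := MonoidAlgebra ℚ (G × H)) (M := P.carrier)
  let : MulAction (G × H) ((G × H) × Fin k) :=
    { smul := fun g x => (g * x.1, x.2)
      one_smul := fun x => Prod.ext (one_mul x.1) rfl
      mul_smul := fun a b x => Prod.ext (mul_assoc a b x.1) rfl }
  let X : FinGSet (G × H) := ⟨(G × H) × Fin k⟩
  have hX : X.IsRightFree := by
    intro h x hx
    have h1 : (1, h) * x.1 = x.1 := congrArg Prod.fst hx
    have h2 := mul_eq_right.1 h1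
    exact congrArg Prod.snd h2
  let θ : X.carrier → P.carrier := fun x => P.act x.1 (s x.2)
  have hθ : ∀ (g : G × H) x, θ (g • x) = P.act g (θ x) := by
    intro g x
    change P.act (g * x.1) (s x.2) = P.act g (P.act x.1 (s x.2))
    rw [FGMod.act_apply, FGMod.act_apply, FGMod.act_apply, smul_smul,
      MonoidAlgebra.single_mul_single, mul_one]
  let f := permLift X P θ hθ
  have hf : ∀ x, f (permBasis X x) = θ x := permLift_permBasis X P θ hθ
  have hsurj : Function.Surjective f := by
    rw [← LinearMap.range_eq_top, eq_top_iff, ← hs, Submodule.span_le]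
    rintro _ ⟨i, rfl⟩
    refine ⟨permBasis X (1, i), ?_⟩
    rw [hf]
    change P.act 1 (s i) = s i
    rw [FGMod.act_apply]
    exact one_smul _ _
  have : NeZero (Nat.card (G × H) : ℚ) := ⟨Nat.cast_ne_zero.2 Nat.card_pos.ne'⟩
  obtain ⟨C, hC⟩ := exists_isCompl (LinearMap.ker f)
  have : Module.Finite ℚ (LinearMap.ker f) := Module.Finite.of_injective
    ((LinearMap.ker f).subtype.restrictScalars ℚ) (LinearMap.ker f).subtype_injective
  have : Module.Finite (MonoidAlgebra ℚ (G × H)) (LinearMap.ker f) :=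
    Module.Finite.of_restrictScalars_finite ℚ _ _
  let N : FGMod (G × H) := ⟨LinearMap.ker f⟩
  let e₁ := (Submodule.quotientEquivOfIsCompl _ _ hC).symm.trans
    (f.quotKerEquivOfSurjective hsurj)
  let e₂ := (Submodule.prodEquivOfIsCompl _ _ hC).symm.trans
    ((LinearEquiv.refl _ _).prodCongr e₁)
  refine ⟨ModClass.mk N, permMod X, permMod_isRightFree X hX, ?_⟩
  rw [add_comm, ModClass.mk_add_mk]
  exact ModClass.mk_eq_mk.2 ⟨e₂⟩

/-- Equality in `R` only provides a common summand `c` that need not be free; enlarging it to the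
free class `c + d` gives the same equality in `R'`. -/
theorem relRatRepIncl_injective : Function.Injective (relRatRepIncl G H) := by
  rw [injective_iff_map_eq_zero]
  intro x hx
  obtain ⟨a, b, rfl⟩ := grothendieck_exists_sub x
  rw [map_sub, relRatRepIncl_of, relRatRepIncl_of, sub_eq_zero, grothendieck_of_eq_iff] at hx
  obtain ⟨c, hc⟩ := hx
  obtain ⟨d, hd⟩ := exists_add_mem_relMods c
  rw [sub_eq_zero, grothendieck_of_eq_iff]
  refine ⟨⟨c + d, hd⟩, Subtype.ext ?_⟩
  change c + d + a.1 = c + d + b.1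
  rw [add_right_comm, hc, add_right_comm]

end Injectivity

/-! ### Subspaces avoiding `e` and surjectivity of `f'` -/

section Elementary

variable {p n : ℕ}

/-- The subspace `W × 0` under the image `W` of a subspace in `ℤ_p^n`. -/
def baseRep (D : Submodule (ZMod p) (EV p n)) : Submodule (ZMod p) (EV p n) :=
  (D.map (LinearMap.fst _ _ _)).prod ⊥

variable [Fact p.Prime]

theorem eq_prod_of_vecE_mem {D : Submodule (ZMod p) (EV p n)} (hD : vecE p n ∈ D) :
    D = (D.map (LinearMap.fst _ _ _)).prod ⊤ := by
  ext ⟨a, b⟩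
  rw [Submodule.mem_prod]
  constructor
  · intro h
    exact ⟨⟨_, h, rfl⟩, trivial⟩
  · rintro ⟨⟨⟨a', b'⟩, h, rfl⟩, -⟩
    have h1 := D.add_mem h (D.smul_mem (b - b') hD)
    simpa [vecE] using h1

theorem vecE_notMem_prod_bot (W : Submodule (ZMod p) (Fin n → ZMod p)) :
    vecE p n ∉ W.prod (⊥ : Submodule (ZMod p) (ZMod p)) := by
  intro h
  have := h.2
  simp [vecE] at this

theorem baseRep_sup_lineE {D : Submodule (ZMod p) (EV p n)} (hD : vecE p n ∈ D) :
    baseRep D ⊔ lineE p n = D := by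
  apply le_antisymm
  · refine sup_le ?_ ((Submodule.span_singleton_le_iff_mem _ _).2 hD)
    conv_rhs => rw [eq_prod_of_vecE_mem hD]
    exact Submodule.prod_mono le_rfl bot_le
  · rintro ⟨a, b⟩ h
    have : ((a, b) : EV p n) = (a, 0) + b • vecE p n := by simp [vecE]
    rw [this]
    refine Submodule.add_mem_sup ⟨⟨_, h, rfl⟩, Submodule.zero_mem _⟩
      (Submodule.smul_mem _ _ (Submodule.mem_span_singleton_self _))

theorem finrank_sup_span_singleton {L : Submodule (ZMod p) (EV p n)} {v : EV p n} (hv : v ∉ L) :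
    Module.finrank (ZMod p) (L ⊔ Submodule.span (ZMod p) {v} : Submodule (ZMod p) (EV p n)) =
      Module.finrank (ZMod p) L + 1 := by
  have h0 : v ≠ 0 := fun h => hv (h ▸ L.zero_mem)
  have h1 := Submodule.finrank_sup_add_finrank_inf_eq L (Submodule.span (ZMod p) {v})
  have h2 : L ⊓ Submodule.span (ZMod p) {v} = ⊥ :=
    ((Submodule.disjoint_span_singleton' h0).2 hv).eq_bot
  rw [h2, finrank_bot, finrank_span_singleton h0] at h1
  exact h1

theorem finrank_sup_lineE {L : Submodule (ZMod p) (EV p n)} (hL : vecE p n ∉ L) :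
    Module.finrank (ZMod p) (L ⊔ lineE p n : Submodule (ZMod p) (EV p n)) =
      Module.finrank (ZMod p) L + 1 :=
  finrank_sup_span_singleton hL

theorem vecE_mem_sup_lineE (L : Submodule (ZMod p) (EV p n)) : vecE p n ∈ L ⊔ lineE p n :=
  Submodule.mem_sup_right (Submodule.mem_span_singleton_self _)

theorem eq_sup_lineE_of_finrank {L C : Submodule (ZMod p) (EV p n)} (hL : vecE p n ∉ L)
    (hLC : L ≤ C) (hC : vecE p n ∈ C)
    (h : Module.finrank (ZMod p) C = Module.finrank (ZMod p) L + 1) : C = L ⊔ lineE p n := by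
  refine (Submodule.eq_of_le_of_finrank_le
    (sup_le hLC ((Submodule.span_singleton_le_iff_mem _ _).2 hC)) ?_).symm
  exact (h.trans (finrank_sup_lineE hL).symm).le

theorem vecE_notMem_baseRep (D : Submodule (ZMod p) (EV p n)) : vecE p n ∉ baseRep D :=
  vecE_notMem_prod_bot _

theorem finrank_baseRep {D : Submodule (ZMod p) (EV p n)} (hD : vecE p n ∈ D) :
    Module.finrank (ZMod p) (baseRep D) + 1 = Module.finrank (ZMod p) D := by
  rw [← finrank_sup_lineE (vecE_notMem_baseRep D), baseRep_sup_lineE hD]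

theorem finrank_top_of_mem_setM {L : Submodule (ZMod p) (EV p n)} (hL : L ∈ setM p n) :
    Module.finrank (ZMod p) (⊤ : Submodule (ZMod p) (EV p n)) =
      Module.finrank (ZMod p) L + 2 := by
  rw [finrank_top, finrank_EV]
  have := hL.1
  omega

/-- Among the hyperplanes over `L` only `L + ℤ_p e` contains `e`; separating it isolates the one
term of the sum that is not `H`-free. -/
theorem finsum_Ioo_top_cl {L : Submodule (ZMod p) (EV p n)} (hL : L ∈ setM p n) :
    ∑ᶠ C ∈ Set.Ioo L ⊤, cl C =
      cl (L ⊔ lineE p n) + ∑ᶠ C ∈ {C | C ∈ Set.Ioo L ⊤ ∧ vecE p n ∉ C}, cl C := by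
  have hrank := finrank_top_of_mem_setM hL
  have hset : Set.Ioo L ⊤ =
      insert (L ⊔ lineE p n) {C | C ∈ Set.Ioo L ⊤ ∧ vecE p n ∉ C} := by
    ext C
    constructor
    · intro hC
      by_cases he : vecE p n ∈ C
      · left
        exact eq_sup_lineE_of_finrank hL.2 hC.1.le he (finrank_of_mem_Ioo hrank hC)
      · exact Or.inr ⟨hC, he⟩
    · rintro (rfl | hC)
      · constructor
        · exact lt_of_le_of_ne le_sup_left fun h => hL.2 (h ▸ vecE_mem_sup_lineE L)
        · rw [lt_top_iff_ne_top]
          intro h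
          have h2 := finrank_sup_lineE hL.2
          rw [h, hrank] at h2
          omega
      · exact hC.1
  conv_lhs => rw [hset]
  exact finsum_mem_insert _ (fun h => h.2 (vecE_mem_sup_lineE L)) (Set.toFinite _)

/-- The relation for a subspace `L` of codimension `2` not containing `e`. -/
theorem natMap_cl_sup_lineE {L : Submodule (ZMod p) (EV p n)} (hL : L ∈ setM p n) :
    natMap _ (cl L) = natMap _ (cl (L ⊔ lineE p n)) - (p : ℤ) • natMap _ (cl ⊤) +
      ∑ᶠ C ∈ {C | C ∈ Set.Ioo L ⊤ ∧ vecE p n ∉ C}, natMap _ (cl C) := by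
  have h1 := natMap_relation le_top (finrank_top_of_mem_setM hL)
  have h2 : natMap _ (∑ᶠ C ∈ {C | C ∈ Set.Ioo L ⊤ ∧ vecE p n ∉ C}, cl C) =
      ∑ᶠ C ∈ {C | C ∈ Set.Ioo L ⊤ ∧ vecE p n ∉ C}, natMap _ (cl C) :=
    (natMap (EG p n × EH p)).toAddMonoidHom.map_finsum_mem _ (Set.toFinite _)
  rw [finsum_Ioo_top_cl hL, map_add, map_sub, map_zsmul, map_add, h2] at h1
  have h3 := eq_neg_of_add_eq_zero_left h1
  rw [sub_eq_iff_eq_add] at h3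
  rw [h3]
  abel

/-- The image of `A'` contains `f(C)` when `e ∉ C`, and `f(D) - p f(⊤)` when `D` is a hyperplane
through `e`, by the codimension 2 relation for a complement of `e` in `D`. Vanishing of the
character at `e` is exactly the condition for `x` to be a combination of these. -/
theorem mem_map_range_of_chi_eq_zero {x : RatRep (EG p n × EH p)}
    (hx : RatRep.chi (ofVec (vecE p n)) x = 0) :
    x ∈ (LinearMap.range (relBurnsideIncl (EG p n) (EH p))).map (natMap _) := by
  classical
  set W := (LinearMap.range (relBurnsideIncl (EG p n) (EH p))).map (natMap _)
  have hW : ∀ C, vecE p n ∉ C → natMap _ (cl C) ∈ W := by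
    intro C hC
    refine Submodule.mem_map_of_mem ?_
    rw [range_relBurnsideIncl]
    exact Submodule.subset_span ⟨C, hC, rfl⟩
  have hD : ∀ D : Submodule (ZMod p) (EV p n), vecE p n ∈ D → Module.finrank (ZMod p) D = n →
      natMap _ (cl D) - (p : ℤ) • natMap _ (cl ⊤) ∈ W := by
    intro D he hDn
    have hM : baseRep D ∈ setM p n := ⟨(finrank_baseRep he).trans hDn, vecE_notMem_baseRep D⟩
    have h1 := natMap_cl_sup_lineE hM
    rw [baseRep_sup_lineE he] at h1
    rw [eq_sub_of_add_eq h1.symm]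
    refine W.sub_mem (hW _ hM.2) ?_
    exact finsum_mem_induction (· ∈ W) W.zero_mem (fun _ _ => W.add_mem) fun C hC => hW C hC.2
  obtain ⟨b, rfl⟩ := exists_sum_natMap_cl x
  -- `c C` is the character of `ℚ[G̃/C]` at `e`: `1` for the whole space, `p` for a hyperplane
  -- through `e`, and `0` otherwise.
  let c : {C : Submodule (ZMod p) (EV p n) // n ≤ Module.finrank (ZMod p) C} → ℤ := fun C =>
    if vecE p n ∈ C.1 then (p : ℤ) ^ (n + 1 - Module.finrank (ZMod p) C.1) else 0
  have hc : ∑ C, b C * c C = 0 := by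
    rw [map_sum] at hx
    have : ∀ C, RatRep.chi (ofVec (vecE p n)) (b C • natMap _ (cl C.1)) = ((b C * c C : ℤ) : ℚ) := by
      intro C
      rw [map_zsmul, chi_natMap_cl, zsmul_eq_mul]
      push_cast
      simp only [c]
      split_ifs <;> simp
    simp only [this] at hx
    exact_mod_cast hx
  -- Since `∑ b C * c C = 0`, multiples of `f(⊤)` may be subtracted term by term, after which every
  -- term lies in `W`.
  have hsum : ∑ C, b C • natMap (EG p n × EH p) (cl C.1) =
      ∑ C, b C • (natMap _ (cl C.1) - c C • natMap _ (cl ⊤)) := by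
    simp only [smul_sub, Finset.sum_sub_distrib, smul_smul]
    rw [← Finset.sum_smul, hc, zero_smul, sub_zero]
  rw [hsum]
  refine W.sum_mem fun C _ => W.smul_mem _ ?_
  by_cases he : vecE p n ∈ C.1
  · by_cases hC : C.1 = ⊤
    · simp only [c, if_pos he]
      rw [hC, finrank_top, finrank_EV]
      simp
    · have hCn : Module.finrank (ZMod p) C.1 = n :=
        le_antisymm (not_lt.1 fun h' => hC (eq_top_of_lt_finrank h')) C.2
      have : c C = p := by
        simp only [c, if_pos he, hCn]
        simp
      rw [this]
      exact hD C.1 he hCn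
  · have : c C = 0 := if_neg he
    rw [this, zero_smul, sub_zero]
    exact hW _ he

theorem relNatMap_surjective : Function.Surjective (relNatMap (EG p n) (EH p)) := by
  rw [← LinearMap.range_eq_top]
  refine grothendieck_le _ ?_
  rintro ⟨_, M, hM, rfl⟩
  have h1 : RatRep.chi (ofVec (vecE p n)) (Algebra.GrothendieckAddGroup.of (ModClass.mk M)) = 0 := by
    rw [RatRep.chi_of]
    refine hM.chi_eq_zero (h := Multiplicative.ofAdd (1 : ZMod p)) ?_
    exact fun h => one_ne_zero (α := ZMod p) h
  obtain ⟨_, ⟨a, rfl⟩, ha⟩ := mem_map_range_of_chi_eq_zero h1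
  refine ⟨a, relRatRepIncl_injective ?_⟩
  rw [relRatRepIncl_of]
  exact (LinearMap.congr_fun (relRatRepIncl_comp_relNatMap (EG p n) (EH p)) a).trans ha

end Elementary

/-! ### Unitriangular change of basis and bases of kernels -/

section Triangular

variable {R M N ι κ : Type*} [CommRing R] [AddCommGroup M] [Module R M] [AddCommGroup N]
  [Module R N] [Finite ι]

/-- The endomorphism `N` with `N (b i) = u i - b i` strictly raises the height, and heights are
bounded on a finite index set. So `N` is nilpotent, and the automorphism `1 + N` carries `b` to `u`.
-/
theorem exists_basis_of_unitriangular (b : Module.Basis ι R M) (h : ι → ℕ) (u : ι → M)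
    (hu : ∀ i, u i - b i ∈ Submodule.span R (b '' {j | h i < h j})) :
    ∃ c : Module.Basis ι R M, ∀ i, c i = u i := by
  let N : Module.End R M := b.constr R fun i => u i - b i
  have hN : ∀ k, ∀ x ∈ Submodule.span R (b '' {j | k ≤ h j}),
      N x ∈ Submodule.span R (b '' {j | k + 1 ≤ h j}) := by
    intro k x hx
    induction hx using Submodule.span_induction with
    | mem x hx =>
      obtain ⟨i, hi, rfl⟩ := hx
      have hi : k ≤ h i := hi
      rw [Module.Basis.constr_basis]
      refine Submodule.span_mono (Set.image_mono fun j hj => ?_) (hu i)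
      have hj : h i < h j := hj
      change k + 1 ≤ h j
      omega
    | zero => rw [map_zero]; exact zero_mem _
    | add x y _ _ hx hy => rw [map_add]; exact add_mem hx hy
    | smul a x _ hx => rw [map_smul]; exact Submodule.smul_mem _ _ hx
  have hpow : ∀ k x, (N ^ k) x ∈ Submodule.span R (b '' {j | k ≤ h j}) := by
    intro k x
    induction k with
    | zero =>
      have : {j | 0 ≤ h j} = Set.univ := Set.eq_univ_of_forall fun j => Nat.zero_le _
      rw [this, Set.image_univ, b.span_eq]
      trivial
    | succ k ih =>
      rw [pow_succ', Module.End.mul_apply]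
      exact hN k _ ih
  obtain ⟨B, hB⟩ := (Set.finite_range h).bddAbove
  have hnil : IsNilpotent N := by
    refine ⟨B + 1, LinearMap.ext fun x => ?_⟩
    have h1 := hpow (B + 1) x
    have h2 : {j | B + 1 ≤ h j} = ∅ := by
      refine Set.eq_empty_of_forall_notMem fun j hj => ?_
      have h3 : h j ≤ B := hB ⟨j, rfl⟩
      have h4 : B + 1 ≤ h j := hj
      omega
    rw [h2, Set.image_empty, Submodule.span_empty, Submodule.mem_bot] at h1
    exact h1
  have hbij : Function.Bijective ⇑(1 + N) := (Module.End.isUnit_iff _).1 hnil.isUnit_one_add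
  refine ⟨b.map (LinearEquiv.ofBijective (1 + N) hbij), fun i => ?_⟩
  rw [Module.Basis.map_apply]
  change b i + N (b i) = u i
  rw [Module.Basis.constr_basis, add_sub_cancel]

theorem ker_eq_span_of_basis (c : Module.Basis ι R M) (σ : κ → ι) (f : M →ₗ[R] N)
    (hσ : ∀ k, f (c (σ k)) = 0)
    (hf : LinearIndependent R fun i : {i // i ∉ Set.range σ} => f (c i.1)) :
    LinearMap.ker f = Submodule.span R (Set.range (c ∘ σ)) := by
  classical
  have := Fintype.ofFinite ι
  apply le_antisymm
  · intro x hx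
    have h1 : f x = 0 := hx
    rw [← c.sum_repr x] at h1 ⊢
    have h2 : ∀ i, i ∉ Set.range σ → c.repr x i = 0 := by
      rw [map_sum, ← Fintype.sum_subtype_add_sum_subtype (fun i => i ∉ Set.range σ),
        Finset.sum_eq_zero (s := (Finset.univ : Finset {i // ¬ i ∉ Set.range σ})), add_zero] at h1
      · simp only [map_smul] at h1
        intro i hi
        exact Fintype.linearIndependent_iff.1 hf (fun i => c.repr x i.1) h1 ⟨i, hi⟩
      · rintro ⟨i, hi⟩ -
        obtain ⟨k, rfl⟩ := not_not.1 hi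
        rw [map_smul, hσ, smul_zero]
    refine Submodule.sum_mem _ fun i _ => ?_
    by_cases hi : i ∈ Set.range σ
    · obtain ⟨k, rfl⟩ := hi
      exact Submodule.smul_mem _ _ (Submodule.subset_span ⟨k, rfl⟩)
    · rw [h2 i hi, zero_smul]
      exact zero_mem _
  · rw [Submodule.span_le]
    rintro _ ⟨k, rfl⟩
    exact hσ k

theorem exists_basis_ker (c : Module.Basis ι R M) (σ : κ → ι) (hinj : Function.Injective σ)
    (f : M →ₗ[R] N) (hσ : ∀ k, f (c (σ k)) = 0)
    (hf : LinearIndependent R fun i : {i // i ∉ Set.range σ} => f (c i.1)) :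
    ∃ b : Module.Basis κ R (LinearMap.ker f), ∀ k, (b k : M) = c (σ k) := by
  have h1 : LinearIndependent R (c ∘ σ) := c.linearIndependent.comp σ hinj
  refine ⟨(Module.Basis.span h1).map
    (LinearEquiv.ofEq _ _ (ker_eq_span_of_basis c σ f hσ hf).symm), fun k => ?_⟩
  rw [Module.Basis.map_apply, LinearEquiv.coe_ofEq_apply]
  exact congrArg Subtype.val (Module.Basis.span_apply h1 k)

end Triangular

/-! ### Bases of `ker f` and `ker f'` -/

section Elementary

variable {p n : ℕ} [Fact p.Prime]

/-- The coordinate of a class in the representation ring with respect to the basis of the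
`ℚ[(G × H) / C]` with `C` of codimension at most `1`. -/
def repCoord (D : {C : Submodule (ZMod p) (EV p n) // n ≤ Module.finrank (ZMod p) C}) :
    RatRep (EG p n × EH p) →ₗ[ℤ] ℤ :=
  (Module.Basis.mk linearIndependent_natMap_cl span_natMap_cl.ge).coord D

open Classical in
theorem repCoord_natMap_cl
    (D : {C : Submodule (ZMod p) (EV p n) // n ≤ Module.finrank (ZMod p) C})
    {C : Submodule (ZMod p) (EV p n)} (hC : n ≤ Module.finrank (ZMod p) C) :
    repCoord D (natMap _ (cl C)) = if C = D.1 then 1 else 0 := by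
  have h1 : natMap _ (cl C) =
      Module.Basis.mk linearIndependent_natMap_cl span_natMap_cl.ge ⟨C, hC⟩ := by
    rw [Module.Basis.mk_apply]
  rw [h1, repCoord, Module.Basis.coord_apply, Module.Basis.repr_self, Finsupp.single_apply]
  simp only [Subtype.ext_iff]

variable {S : Submodule (ZMod p) (EV p n) → Submodule (ZMod p) (EV p n)}

theorem IsStarChoice.natMap_tElt (hS : IsStarChoice S) {L : Submodule (ZMod p) (EV p n)}
    (hL : Module.finrank (ZMod p) L + 1 ≤ n) : natMap _ (tElt S L) = 0 := by
  have h := hS L (by omega)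
  exact natMap_relation h.1 h.2.1

/-- All other terms of `t(L)` lie in `S L` and have larger dimension. The set `s` is a parameter
because in `A` only the dimension is recorded, while in `A'` the terms must also avoid `e`. -/
theorem IsStarChoice.tElt_sub_cl_mem (hS : IsStarChoice S) {L : Submodule (ZMod p) (EV p n)}
    (hL : Module.finrank (ZMod p) L + 1 ≤ n) {s : Set (Submodule (ZMod p) (EV p n))}
    (hs : ∀ C, C ≤ S L → Module.finrank (ZMod p) L < Module.finrank (ZMod p) C → C ∈ s) :
    tElt S L - cl L ∈ Submodule.span ℤ (cl '' s) := by
  have h := hS L (by omega)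
  have h1 : tElt S L - cl L = (p : ℤ) • cl (S L) - ∑ᶠ C ∈ Set.Ioo L (S L), cl C := by
    rw [tElt]
    abel
  rw [h1]
  refine Submodule.sub_mem _ (Submodule.smul_mem _ _ (Submodule.subset_span
    ⟨S L, hs _ le_rfl (by omega), rfl⟩)) ?_
  refine finsum_mem_induction (· ∈ Submodule.span ℤ (cl '' s)) (zero_mem _)
    (fun _ _ => add_mem) fun C hC => ?_
  exact Submodule.subset_span ⟨C, hs C hC.2.le (Submodule.finrank_lt_finrank_of_lt hC.1), rfl⟩

theorem IsStarChoice.eq_top (hS : IsStarChoice S) {L : Submodule (ZMod p) (EV p n)}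
    (hL : L ∈ setM p n) : S L = ⊤ := by
  have h1 := hL.1
  have h := hS L (by omega)
  exact eq_top_of_lt_finrank (by omega)

/-- The element `t(L)`, for `L` of codimension `2` not containing `e`, modulo `H`-free sets of
larger dimension. -/
theorem IsStarChoice.tElt_mem_of_mem_setM (hS : IsStarChoice S)
    {L : Submodule (ZMod p) (EV p n)} (hL : L ∈ setM p n) :
    tElt S L - cl L + cl (L ⊔ lineE p n) - (p : ℤ) • cl ⊤ ∈ Submodule.span ℤ
      (cl '' {C | vecE p n ∉ C ∧ Module.finrank (ZMod p) L < Module.finrank (ZMod p) C}) := by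
  have h1 : tElt S L - cl L + cl (L ⊔ lineE p n) - (p : ℤ) • cl ⊤ =
      - ∑ᶠ C ∈ {C | C ∈ Set.Ioo L ⊤ ∧ vecE p n ∉ C}, cl C := by
    rw [tElt, hS.eq_top hL, finsum_Ioo_top_cl hL]
    abel
  rw [h1]
  refine Submodule.neg_mem _ (finsum_mem_induction (· ∈ Submodule.span ℤ _) (zero_mem _)
    (fun _ _ => add_mem) fun C hC => ?_)
  exact Submodule.subset_span ⟨C, ⟨hC.2, Submodule.finrank_lt_finrank_of_lt hC.1.1⟩, rfl⟩

/-- The terms of `t(L)` that are not `H`-free, `-(L + ℤ_p e)` and `p (⊤)`, depend only on the class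
of `L` and cancel in the difference. -/
theorem IsStarChoice.tElt_sub_tElt_mem (hS : IsStarChoice S)
    {L L' : Submodule (ZMod p) (EV p n)} (hL : L ∈ setM p n) (hL' : L' ∈ setM p n)
    (h : L ⊔ lineE p n = L' ⊔ lineE p n) :
    (tElt S L - tElt S L') - (cl L - cl L') ∈ Submodule.span ℤ
      (cl '' {C | vecE p n ∉ C ∧ Module.finrank (ZMod p) L < Module.finrank (ZMod p) C}) := by
  have h1 := hS.tElt_mem_of_mem_setM hL
  have h2 := hS.tElt_mem_of_mem_setM hL'
  have h3 : Module.finrank (ZMod p) L' = Module.finrank (ZMod p) L := by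
    have := hL.1
    have := hL'.1
    omega
  rw [h3, ← h] at h2
  have h4 := Submodule.sub_mem _ h1 h2
  convert h4 using 1
  abel

/-- The elements `t(L)` for `dim L ≤ n - 1`, completed by the `(L)` for `dim L ≥ n`. -/
theorem IsStarChoice.exists_basis (hS : IsStarChoice S) :
    ∃ c : Module.Basis (Submodule (ZMod p) (EV p n)) ℤ (Burnside (EG p n × EH p)),
      ∀ L, c L = if Module.finrank (ZMod p) L + 1 ≤ n then tElt S L else cl L := by
  refine exists_basis_of_unitriangular (clBasis p n) (fun L => Module.finrank (ZMod p) L) _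
    fun L => ?_
  have h1 : ⇑(clBasis p n) = cl := funext clBasis_apply
  rw [h1]
  split_ifs with hL
  · exact hS.tElt_sub_cl_mem hL fun C _ hC => hC
  · rw [sub_self]
    exact zero_mem _

theorem linearIndependent_natMap_cl_comp {ι : Type*}
    (v : ι → Submodule (ZMod p) (EV p n)) (hv : Function.Injective v)
    (h : ∀ i, n ≤ Module.finrank (ZMod p) (v i)) :
    LinearIndependent ℤ fun i => natMap _ (cl (v i)) :=
  linearIndependent_natMap_cl.comp (fun i => ⟨v i, h i⟩)
    fun _ _ hij => hv (Subtype.ext_iff.1 hij)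

theorem IsStarChoice.exists_basis_ker_natMap (hS : IsStarChoice S) :
    ∃ b : Module.Basis {L : Submodule (ZMod p) (EV p n) // Module.finrank (ZMod p) L + 1 ≤ n} ℤ
        (LinearMap.ker (natMap (EG p n × EH p))),
      ∀ L, (b L : Burnside (EG p n × EH p)) = tElt S L := by
  obtain ⟨c, hc⟩ := hS.exists_basis
  have hc1 : ∀ L : Submodule (ZMod p) (EV p n), Module.finrank (ZMod p) L + 1 ≤ n → c L = tElt S L := fun L hL => by
    rw [hc, if_pos hL]
  obtain ⟨b, hb⟩ := exists_basis_ker c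
    (Subtype.val : {L : Submodule (ZMod p) (EV p n) // Module.finrank (ZMod p) L + 1 ≤ n} → _)
    Subtype.val_injective (natMap (EG p n × EH p))
    (fun L => by rw [hc1 L.1 L.2]; exact hS.natMap_tElt L.2) (by
      have h1 : ∀ i : {i : Submodule (ZMod p) (EV p n) // i ∉ Set.range (Subtype.val :
          {L : Submodule (ZMod p) (EV p n) // Module.finrank (ZMod p) L + 1 ≤ n} → _)},
          ¬ Module.finrank (ZMod p) i.1 + 1 ≤ n := fun i hi => i.2 ⟨⟨i.1, hi⟩, rfl⟩
      have h2 : (fun i : {i : Submodule (ZMod p) (EV p n) // i ∉ Set.range (Subtype.val :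
          {L : Submodule (ZMod p) (EV p n) // Module.finrank (ZMod p) L + 1 ≤ n} → _)} =>
          natMap (EG p n × EH p) (c i.1)) = fun i => natMap _ (cl i.1) := by
        funext i
        rw [hc, if_neg (h1 i)]
      rw [h2]
      exact linearIndependent_natMap_cl_comp _ Subtype.val_injective fun i => by
        have := h1 i
        omega)
  exact ⟨b, fun L => (hb L).trans (hc1 L.1 L.2)⟩

/-- A choice of a representative in every class of `M_(n-1)`. -/
def IsRepChoice (r : Submodule (ZMod p) (EV p n) → Submodule (ZMod p) (EV p n)) : Prop :=
  ∀ L ∈ setM p n, r (L ⊔ lineE p n) ∈ setM p n ∧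
    r (L ⊔ lineE p n) ⊔ lineE p n = L ⊔ lineE p n

theorem isRepChoice_baseRep : IsRepChoice (baseRep (p := p) (n := n)) := by
  intro L hL
  have he := vecE_mem_sup_lineE L
  refine ⟨⟨?_, vecE_notMem_baseRep _⟩, baseRep_sup_lineE he⟩
  have h1 := finrank_baseRep he
  have h2 := finrank_sup_lineE hL.2
  have h3 := hL.1
  omega

/-- The index type of the basis of the relative Burnside kernel. -/
abbrev RelKerIndex (r : Submodule (ZMod p) (EV p n) → Submodule (ZMod p) (EV p n)) : Type :=
  {L : Submodule (ZMod p) (EV p n) // Module.finrank (ZMod p) L + 2 ≤ n ∧ vecE p n ∉ L} ⊕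
    {L : Submodule (ZMod p) (EV p n) // L ∈ setM p n ∧ r (L ⊔ lineE p n) ≠ L}

/-- The subspace belonging to an index. -/
def RelKerIndex.subspace {r : Submodule (ZMod p) (EV p n) → Submodule (ZMod p) (EV p n)} :
    RelKerIndex r → {L : Submodule (ZMod p) (EV p n) // vecE p n ∉ L} :=
  Sum.elim (fun L => ⟨L.1, L.2.2⟩) fun L => ⟨L.1, L.2.1.2⟩

theorem RelKerIndex.subspace_injective
    {r : Submodule (ZMod p) (EV p n) → Submodule (ZMod p) (EV p n)} :
    Function.Injective (RelKerIndex.subspace (r := r)) := by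
  rintro (⟨L, hL, hL'⟩ | ⟨L, hL, hL'⟩) (⟨K, hK, hK'⟩ | ⟨K, hK, hK'⟩) h
  · obtain rfl : L = K := Subtype.ext_iff.1 h
    rfl
  · obtain rfl : L = K := Subtype.ext_iff.1 h
    have := hK.1
    omega
  · obtain rfl : L = K := Subtype.ext_iff.1 h
    have := hL.1
    omega
  · obtain rfl : L = K := Subtype.ext_iff.1 h
    rfl

-- For a representative `v i`, the coordinate of `R` at the hyperplane `v i + ℤ_p e` equals 1 on
-- `f(v i)` and 0 on all other members: hyperplanes avoiding `e` are different basis elements, and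
-- other representatives belong to other classes. So the coefficients of the representatives vanish
-- first; what is left is part of the basis of `R`.
open Classical in
theorem linearIndependent_natMap_cl_of_reps
    {r : Submodule (ZMod p) (EV p n) → Submodule (ZMod p) (EV p n)} {ι : Type*} [Finite ι]
    (v : ι → Submodule (ZMod p) (EV p n)) (hv : Function.Injective v)
    (he : ∀ i, vecE p n ∉ v i)
    (h : ∀ i, n ≤ Module.finrank (ZMod p) (v i) ∨
      (v i ∈ setM p n ∧ r (v i ⊔ lineE p n) = v i)) :
    LinearIndependent ℤ fun i => natMap _ (cl (v i)) := by
  have := Fintype.ofFinite ι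
  rw [Fintype.linearIndependent_iff]
  intro g hg
  have hM : ∀ i, v i ∈ setM p n → ¬ n ≤ Module.finrank (ZMod p) (v i) := by
    intro i hi
    have := hi.1
    omega
  have hrep : ∀ i, v i ∈ setM p n → g i = 0 := by
    intro i hi
    have hir := ((h i).resolve_left (hM i hi)).2
    have hD : n ≤ Module.finrank (ZMod p) (v i ⊔ lineE p n : Submodule (ZMod p) (EV p n)) := by
      have := finrank_sup_lineE (he i)
      have := hi.1
      omega
    have hne : ∀ C, vecE p n ∉ C → C ≠ v i ⊔ lineE p n := fun C hC h' =>
      hC (h' ▸ vecE_mem_sup_lineE (v i))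
    have h1 := congrArg (repCoord ⟨_, hD⟩) hg
    have h2 : ∀ j, repCoord ⟨_, hD⟩ (natMap _ (cl (v j))) = if j = i then 1 else 0 := by
      intro j
      by_cases hj : n ≤ Module.finrank (ZMod p) (v j)
      · rw [repCoord_natMap_cl _ hj, if_neg (hne _ (he j)), if_neg]
        rintro rfl
        exact hM j hi hj
      · obtain ⟨hjM, hjr⟩ := (h j).resolve_left hj
        have hDj : n ≤ Module.finrank (ZMod p)
            (v j ⊔ lineE p n : Submodule (ZMod p) (EV p n)) := by
          have := finrank_sup_lineE (he j)
          have := hjM.1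
          omega
        have htop : n ≤ Module.finrank (ZMod p) (⊤ : Submodule (ZMod p) (EV p n)) := by
          rw [finrank_top, finrank_EV]
          omega
        rw [natMap_cl_sup_lineE hjM, map_add, map_sub, map_zsmul, repCoord_natMap_cl _ hDj,
          repCoord_natMap_cl _ htop]
        have h3 : repCoord ⟨_, hD⟩
            (∑ᶠ C ∈ {C | C ∈ Set.Ioo (v j) ⊤ ∧ vecE p n ∉ C}, natMap _ (cl C)) = 0 := by
          refine finsum_mem_induction (fun x => repCoord ⟨_, hD⟩ x = 0) (map_zero _)
            (fun x y hx hy => by rw [map_add, hx, hy, add_zero]) fun C hC => ?_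
          have hCn : n ≤ Module.finrank (ZMod p) C := by
            have := Submodule.finrank_lt_finrank_of_lt hC.1.1
            have := hjM.1
            omega
          rw [repCoord_natMap_cl _ hCn, if_neg (hne _ hC.2)]
        have h4 : (⊤ : Submodule (ZMod p) (EV p n)) ≠ v i ⊔ lineE p n := by
          intro h'
          have h5 := finrank_sup_lineE (he i)
          have h6 := hi.1
          rw [← h', finrank_top, finrank_EV] at h5
          omega
        rw [h3, if_neg h4, smul_zero, sub_zero, add_zero]
        have h7 : v j ⊔ lineE p n = v i ⊔ lineE p n ↔ j = i := by
          constructor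
          · intro h'
            apply hv
            rw [← hir, ← hjr, h']
          · rintro rfl
            rfl
        simp only [h7]
    rw [map_sum, map_zero] at h1
    simp only [map_smul, h2, smul_eq_mul, mul_ite, mul_one, mul_zero] at h1
    rwa [Finset.sum_ite_eq' Finset.univ i, if_pos (Finset.mem_univ _)] at h1
  intro i
  by_cases hi : n ≤ Module.finrank (ZMod p) (v i)
  · have h1 := congrArg (repCoord ⟨_, hi⟩) hg
    have h2 : ∀ j, repCoord ⟨_, hi⟩ (g j • natMap _ (cl (v j))) = if j = i then g j else 0 := by
      intro j
      by_cases hj : n ≤ Module.finrank (ZMod p) (v j)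
      · rw [map_zsmul, repCoord_natMap_cl _ hj]
        simp only [hv.eq_iff, smul_eq_mul, mul_ite, mul_one, mul_zero]
      · rw [hrep j ((h j).resolve_left hj).1, zero_smul, map_zero, ite_self]
    rw [map_sum, map_zero] at h1
    simp only [h2] at h1
    rwa [Finset.sum_ite_eq' Finset.univ i, if_pos (Finset.mem_univ _)] at h1
  · exact hrep i ((h i).resolve_left hi).1

/-- Pulls triangularity back from `A` to `A'`, so that estimates for `t(L)` made in `A` apply to the
basis of `A'`. -/
theorem exists_relBurnsideIncl_eq (L : {L : Submodule (ZMod p) (EV p n) // vecE p n ∉ L})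
    {s : Set {L : Submodule (ZMod p) (EV p n) // vecE p n ∉ L}} {y : Burnside (EG p n × EH p)}
    (hy : y - cl L.1 ∈ Submodule.span ℤ (cl '' (Subtype.val '' s))) :
    ∃ x, relBurnsideIncl (EG p n) (EH p) x = y ∧
      x - relCl L ∈ Submodule.span ℤ (relCl '' s) := by
  have h1 : cl '' (Subtype.val '' s) = relBurnsideIncl (EG p n) (EH p) '' (relCl '' s) := by
    rw [Set.image_image, Set.image_image]
    exact Set.image_congr fun L _ => (relBurnsideIncl_relCl L).symm
  rw [h1, ← Submodule.map_span] at hy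
  obtain ⟨z, hz, hzy⟩ := hy
  refine ⟨relCl L + z, ?_, ?_⟩
  · rw [map_add, hzy, relBurnsideIncl_relCl, add_sub_cancel]
  · rwa [add_sub_cancel_left]

variable {r : Submodule (ZMod p) (EV p n) → Submodule (ZMod p) (EV p n)}

-- Triangularity by dimension alone fails here, as `t(L) - t(L₀)` contains `(L₀)`, which has the
-- same dimension as `L`. The height is therefore twice the dimension, plus one for representatives.
open Classical in
theorem IsStarChoice.exists_relBasis (hS : IsStarChoice S) (hr : IsRepChoice r) :
    ∃ c : Module.Basis {L : Submodule (ZMod p) (EV p n) // vecE p n ∉ L} ℤ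
        (BurnsideRel (EG p n) (EH p)),
      ∀ L, relBurnsideIncl (EG p n) (EH p) (c L) =
        if Module.finrank (ZMod p) L.1 + 2 ≤ n then tElt S L.1
        else if L.1 ∈ setM p n ∧ r (L.1 ⊔ lineE p n) ≠ L.1 then
          tElt S L.1 - tElt S (r (L.1 ⊔ lineE p n))
        else cl L.1 := by
  let ht : {L : Submodule (ZMod p) (EV p n) // vecE p n ∉ L} → ℕ := fun L =>
    2 * Module.finrank (ZMod p) L.1 + if r (L.1 ⊔ lineE p n) = L.1 then 1 else 0
  have hht : ∀ L K : {L : Submodule (ZMod p) (EV p n) // vecE p n ∉ L},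
      Module.finrank (ZMod p) L.1 < Module.finrank (ZMod p) K.1 → ht L < ht K := by
    intro L K hLK
    simp only [ht]
    split_ifs <;> omega
  have key : ∀ L : {L : Submodule (ZMod p) (EV p n) // vecE p n ∉ L}, ∃ x,
      relBurnsideIncl (EG p n) (EH p) x =
        (if Module.finrank (ZMod p) L.1 + 2 ≤ n then tElt S L.1
        else if L.1 ∈ setM p n ∧ r (L.1 ⊔ lineE p n) ≠ L.1 then
          tElt S L.1 - tElt S (r (L.1 ⊔ lineE p n))
        else cl L.1) ∧
      x - relCl L ∈ Submodule.span ℤ (relCl '' {K | ht L < ht K}) := by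
    intro L
    apply exists_relBurnsideIncl_eq
    split_ifs with h1 h2
    · refine hS.tElt_sub_cl_mem (by omega) fun C hC hLC => ?_
      -- Codimension at least 3, so `S L` avoids `e`, and so does every term of `t(L)`.
      have h3 : vecE p n ∉ S L.1 := (hS L.1 (by omega)).2.2 L.2 (by omega)
      exact ⟨⟨C, fun h => h3 (hC h)⟩, hht L ⟨C, _⟩ hLC, rfl⟩
    · have h3 := hr L.1 h2.1
      have h4 := hS.tElt_sub_tElt_mem h2.1 h3.1 h3.2.symm
      have h5 : tElt S L.1 - tElt S (r (L.1 ⊔ lineE p n)) - cl L.1 =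
          (tElt S L.1 - tElt S (r (L.1 ⊔ lineE p n)) - (cl L.1 - cl (r (L.1 ⊔ lineE p n)))) -
            cl (r (L.1 ⊔ lineE p n)) := by abel
      rw [h5]
      refine Submodule.sub_mem _ (Submodule.span_mono (Set.image_mono ?_) h4) ?_
      · rintro C ⟨hC, hLC⟩
        exact ⟨⟨C, hC⟩, hht L ⟨C, hC⟩ hLC, rfl⟩
      · refine Submodule.subset_span ⟨_, ⟨⟨_, h3.1.2⟩, ?_, rfl⟩, rfl⟩
        have h6 : Module.finrank (ZMod p) (r (L.1 ⊔ lineE p n)) =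
            Module.finrank (ZMod p) L.1 := by
          have := h3.1.1
          have := h2.1.1
          omega
        change ht L < ht _
        simp only [ht]
        -- As `r` depends only on `L + ℤ_p e`, the chosen representative is its own representative.
        rw [if_neg h2.2, if_pos (congrArg r h3.2), h6]
        omega
    · rw [sub_self]
      exact zero_mem _
  choose x hx hx' using key
  obtain ⟨c, hc⟩ := exists_basis_of_unitriangular (relClBasis p n) ht x fun L => by
    have h1 : ⇑(relClBasis p n) = relCl := funext relClBasis_apply
    rw [h1]
    exact hx' L
  exact ⟨c, fun L => by rw [hc, hx]⟩

theorem relNatMap_eq_zero {x : BurnsideRel (EG p n) (EH p)}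
    (hx : natMap _ (relBurnsideIncl (EG p n) (EH p) x) = 0) :
    relNatMap (EG p n) (EH p) x = 0 := by
  apply relRatRepIncl_injective
  rw [map_zero, ← hx]
  exact LinearMap.congr_fun (relRatRepIncl_comp_relNatMap (EG p n) (EH p)) x

/-- Both the vanishing of `f'` on the listed elements and the independence of the images of the
remaining basis elements are checked in `R`, through the injection `R' → R`. -/
theorem IsStarChoice.exists_basis_ker_relNatMap (hS : IsStarChoice S) (hr : IsRepChoice r) :
    ∃ b : Module.Basis (RelKerIndex r) ℤ (LinearMap.ker (relNatMap (EG p n) (EH p))),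
      (∀ L, relBurnsideIncl (EG p n) (EH p) (b (Sum.inl L)) = tElt S L) ∧
      (∀ L, relBurnsideIncl (EG p n) (EH p) (b (Sum.inr L)) =
        tElt S L - tElt S (r (L.1 ⊔ lineE p n))) := by
  classical
  obtain ⟨c, hc⟩ := hS.exists_relBasis hr
  have hinl : ∀ L : {L : Submodule (ZMod p) (EV p n) //
      Module.finrank (ZMod p) L + 2 ≤ n ∧ vecE p n ∉ L},
      relBurnsideIncl (EG p n) (EH p) (c (RelKerIndex.subspace (r := r) (Sum.inl L))) =
        tElt S L := by
    intro L
    rw [hc]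
    exact if_pos L.2.1
  have hinr : ∀ L : {L : Submodule (ZMod p) (EV p n) //
      L ∈ setM p n ∧ r (L ⊔ lineE p n) ≠ L},
      relBurnsideIncl (EG p n) (EH p) (c (RelKerIndex.subspace (r := r) (Sum.inr L))) =
        tElt S L - tElt S (r (L.1 ⊔ lineE p n)) := by
    intro L
    rw [hc, if_neg]
    · exact if_pos L.2
    · intro h
      have h : Module.finrank (ZMod p) L.1 + 2 ≤ n := h
      have := L.2.1.1
      omega
  have hker : ∀ k : RelKerIndex r,
      relNatMap (EG p n) (EH p) (c k.subspace) = 0 := by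
    rintro (L | L)
    · apply relNatMap_eq_zero
      rw [hinl]
      have := L.2.1
      exact hS.natMap_tElt (by omega)
    · apply relNatMap_eq_zero
      rw [hinr, map_sub, hS.natMap_tElt L.2.1.1.le, hS.natMap_tElt (hr L.1 L.2.1).1.1.le, sub_zero]
  have hind : LinearIndependent ℤ
      fun i : {i // i ∉ Set.range (RelKerIndex.subspace (r := r))} =>
        relNatMap (EG p n) (EH p) (c i.1) := by
    refine LinearIndependent.of_comp (relRatRepIncl (EG p n) (EH p)) ?_
    have h1 : ∀ i : {i // i ∉ Set.range (RelKerIndex.subspace (r := r))},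
        ¬ Module.finrank (ZMod p) i.1.1 + 2 ≤ n ∧
          ¬ (i.1.1 ∈ setM p n ∧ r (i.1.1 ⊔ lineE p n) ≠ i.1.1) := by
      intro i
      exact ⟨fun h => i.2 ⟨Sum.inl ⟨i.1.1, h, i.1.2⟩, rfl⟩,
        fun h => i.2 ⟨Sum.inr ⟨i.1.1, h⟩, rfl⟩⟩
    have h2 : (relRatRepIncl (EG p n) (EH p) ∘
        fun i : {i // i ∉ Set.range (RelKerIndex.subspace (r := r))} =>
          relNatMap (EG p n) (EH p) (c i.1)) = fun i => natMap _ (cl i.1.1) := by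
      funext i
      refine (LinearMap.congr_fun (relRatRepIncl_comp_relNatMap (EG p n) (EH p)) _).trans ?_
      rw [LinearMap.comp_apply, hc, if_neg (h1 i).1, if_neg (h1 i).2]
    have h3 : ∀ i : {i // i ∉ Set.range (RelKerIndex.subspace (r := r))},
        n ≤ Module.finrank (ZMod p) i.1.1 ∨
          (i.1.1 ∈ setM p n ∧ r (i.1.1 ⊔ lineE p n) = i.1.1) := by
      intro i
      by_cases hn : n ≤ Module.finrank (ZMod p) i.1.1
      · exact Or.inl hn
      · have h3 : i.1.1 ∈ setM p n := ⟨by have := (h1 i).1; omega, i.1.2⟩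
        exact Or.inr ⟨h3, by_contra fun h => (h1 i).2 ⟨h3, h⟩⟩
    have h4 : Function.Injective fun i : {i // i ∉ Set.range (RelKerIndex.subspace (r := r))} =>
        i.1.1 := fun i j h => Subtype.ext (Subtype.ext h)
    have h5 := linearIndependent_natMap_cl_of_reps _ h4 (fun i => i.1.2) h3
    rw [h2]
    exact h5
  obtain ⟨b, hb⟩ := exists_basis_ker c RelKerIndex.subspace
    (RelKerIndex.subspace_injective (r := r)) (relNatMap (EG p n) (EH p)) hker hind
  exact ⟨b, fun L => by rw [hb, hinl], fun L => by rw [hb, hinr]⟩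

end Elementary

/-! ### The rank of `A''_(n-1)` -/

section Counting

variable {p n : ℕ} [Fact p.Prime]

theorem vecE_notMem_graph (f : (Fin n → ZMod p) →ₗ.[ZMod p] ZMod p) : vecE p n ∉ f.graph := by
  intro h
  obtain ⟨y, hy, hfy⟩ := (LinearPMap.mem_graph_iff _).1 h
  have hy0 : y = 0 := Subtype.ext hy
  rw [hy0, LinearPMap.map_zero] at hfy
  exact zero_ne_one hfy

theorem finrank_graph (f : (Fin n → ZMod p) →ₗ.[ZMod p] ZMod p) :
    Module.finrank (ZMod p) f.graph = Module.finrank (ZMod p) f.domain := by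
  have h1 : f.graph = LinearMap.range (f.domain.subtype.prod f.toFun) := by
    ext x
    rw [LinearPMap.mem_graph_iff]
    exact exists_congr fun y => ⟨fun h => Prod.ext h.1 h.2,
      fun h => ⟨congrArg Prod.fst h, congrArg Prod.snd h⟩⟩
  rw [h1, LinearMap.finrank_range_of_inj]
  intro x y h
  exact Subtype.ext (congrArg Prod.fst h)

theorem map_fst_graph (f : (Fin n → ZMod p) →ₗ.[ZMod p] ZMod p) :
    f.graph.map (LinearMap.fst _ _ _) = f.domain := by
  ext x
  constructor
  · rintro ⟨y, hy, rfl⟩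
    obtain ⟨z, hz, -⟩ := (LinearPMap.mem_graph_iff _).1 hy
    change y.1 ∈ f.domain
    rw [← hz]
    exact z.2
  · intro hx
    exact ⟨(x, f ⟨x, hx⟩), (LinearPMap.mem_graph_iff _).2 ⟨⟨x, hx⟩, rfl, rfl⟩, rfl⟩

/-- Adding `e` to a graph forgets the functional and keeps its domain; `baseRep` then returns the
graph of the zero functional on that domain. -/
theorem baseRep_sup_lineE_eq_iff (f : (Fin n → ZMod p) →ₗ.[ZMod p] ZMod p) :
    baseRep (f.graph ⊔ lineE p n) = f.graph ↔ f.toFun = 0 := by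
  have h1 : baseRep (f.graph ⊔ lineE p n) = f.domain.prod ⊥ := by
    have h2 : (lineE p n).map (LinearMap.fst (ZMod p) (Fin n → ZMod p) (ZMod p)) = ⊥ := by
      rw [lineE, Submodule.map_span, Set.image_singleton]
      exact Submodule.span_zero_singleton _
    rw [baseRep, Submodule.map_sup, map_fst_graph, h2, sup_bot_eq]
  rw [h1]
  constructor
  · intro h
    ext x
    have h2 : ((x : Fin n → ZMod p), f x) ∈ f.graph :=
      (LinearPMap.mem_graph_iff _).2 ⟨x, rfl, rfl⟩
    rw [← h] at h2
    exact h2.2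
  · intro h
    ext ⟨a, b⟩
    rw [LinearPMap.mem_graph_iff]
    constructor
    · rintro ⟨ha, hb⟩
      refine ⟨⟨a, ha⟩, rfl, ?_⟩
      have hb : b = 0 := hb
      rw [hb]
      exact LinearMap.congr_fun h ⟨a, ha⟩
    · rintro ⟨y, hy, hfy⟩
      have hy : (y : Fin n → ZMod p) = a := hy
      refine ⟨hy ▸ y.2, ?_⟩
      have hfy : f y = b := hfy
      change b = 0
      rw [← hfy]
      exact LinearMap.congr_fun h y

/-- `e ∉ L` means that `L` meets the vertical line trivially, so `L` is single-valued as a relation.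
-/
theorem graph_toLinearPMap {L : Submodule (ZMod p) (EV p n)} (hL : vecE p n ∉ L) :
    L.toLinearPMap.graph = L := by
  apply Submodule.toLinearPMap_graph_eq
  rintro ⟨a, b⟩ h (rfl : a = 0)
  by_contra hb
  have hb : b ≠ 0 := hb
  apply hL
  simpa [vecE, hb] using L.smul_mem b⁻¹ h

theorem card_nonzero_functionals (W : Submodule (ZMod p) (Fin n → ZMod p)) :
    Nat.card {φ : W →ₗ[ZMod p] ZMod p // φ ≠ 0} = p ^ Module.finrank (ZMod p) W - 1 := by
  classical
  have : Finite (Module.Dual (ZMod p) W) := Module.finite_of_finite (ZMod p)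
  have := Fintype.ofFinite (Module.Dual (ZMod p) W)
  have h1 := Set.card_ne_eq (0 : Module.Dual (ZMod p) W)
  rw [← Nat.card_eq_fintype_card, ← Nat.card_eq_fintype_card,
    Module.natCard_eq_pow_finrank (K := ZMod p) (V := Module.Dual (ZMod p) W), Subspace.dual_finrank_eq, Nat.card_zmod] at h1
  exact h1

-- Annihilators exchange hyperplanes with lines of the dual space, which is then identified with the
-- space itself.
variable (p n) in
theorem card_finrank_add_one :
    Nat.card {W : Submodule (ZMod p) (Fin n → ZMod p) // Module.finrank (ZMod p) W + 1 = n} =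
      numSubspaces p 1 n := by
  let e : Module.Dual (ZMod p) (Fin n → ZMod p) ≃ₗ[ZMod p] (Fin n → ZMod p) :=
    LinearEquiv.ofFinrankEq _ _ Subspace.dual_finrank_eq
  let o : Submodule (ZMod p) (Fin n → ZMod p) ≃ Submodule (ZMod p) (Fin n → ZMod p) :=
    (Subspace.orderIsoFiniteDimensional.toEquiv.trans OrderDual.ofDual).trans
      (Submodule.orderIsoMapComap e).toEquiv
  refine Nat.card_congr (o.subtypeEquiv fun W => ?_)
  have h1 : Module.finrank (ZMod p) (o W) = Module.finrank (ZMod p) W.dualAnnihilator :=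
    LinearEquiv.finrank_map_eq e W.dualAnnihilator
  have h2 := Subspace.finrank_add_finrank_dualAnnihilator_eq W
  rw [Module.finrank_fin_fun] at h2
  rw [h1]
  omega

-- An element of `M_(n-1)` is the graph of a functional on a hyperplane `W` of `ℤ_p^n`. Its class is
-- `W`, and the representative is the zero functional, so each `W` contributes `p ^ (n - 1) - 1`
-- other elements.
variable (p n) in
theorem card_nonreps :
    Nat.card {L : Submodule (ZMod p) (EV p n) // L ∈ setM p n ∧ baseRep (L ⊔ lineE p n) ≠ L} =
      numSubspaces p 1 n * (p ^ (n - 1) - 1) := by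
  let F : {f : (Fin n → ZMod p) →ₗ.[ZMod p] ZMod p //
        Module.finrank (ZMod p) f.domain + 1 = n ∧ f.toFun ≠ 0} →
      {L : Submodule (ZMod p) (EV p n) // L ∈ setM p n ∧ baseRep (L ⊔ lineE p n) ≠ L} :=
    fun f => ⟨f.1.graph, ⟨(congrArg (· + 1) (finrank_graph f.1)).trans f.2.1,
      vecE_notMem_graph f.1⟩, fun h => f.2.2 ((baseRep_sup_lineE_eq_iff f.1).1 h)⟩
  have hF : Function.Bijective F := by
    constructor
    · intro f g h
      exact Subtype.ext (LinearPMap.eq_of_eq_graph (Subtype.ext_iff.1 h))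
    · rintro ⟨L, hL, hLr⟩
      have h1 := graph_toLinearPMap hL.2
      refine ⟨⟨L.toLinearPMap, ?_, ?_⟩, Subtype.ext h1⟩
      · rw [← finrank_graph, h1]
        exact hL.1
      · intro h
        apply hLr
        have h2 := (baseRep_sup_lineE_eq_iff L.toLinearPMap).2 h
        rwa [h1] at h2
  let e : {f : (Fin n → ZMod p) →ₗ.[ZMod p] ZMod p //
        Module.finrank (ZMod p) f.domain + 1 = n ∧ f.toFun ≠ 0} ≃
      Σ W : {W : Submodule (ZMod p) (Fin n → ZMod p) // Module.finrank (ZMod p) W + 1 = n},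
        {φ : W.1 →ₗ[ZMod p] ZMod p // φ ≠ 0} :=
    { toFun := fun f => ⟨⟨f.1.domain, f.2.1⟩, ⟨f.1.toFun, f.2.2⟩⟩
      invFun := fun x => ⟨⟨x.1.1, x.2.1⟩, x.1.2, x.2.2⟩
      left_inv := fun _ => rfl
      right_inv := fun _ => rfl }
  have : Finite (Submodule (ZMod p) (Fin n → ZMod p)) :=
    Finite.of_injective (fun W => (W : Set (Fin n → ZMod p))) SetLike.coe_injective
  have := Fintype.ofFinite
    {W : Submodule (ZMod p) (Fin n → ZMod p) // Module.finrank (ZMod p) W + 1 = n}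
  have hfin : ∀ W : {W : Submodule (ZMod p) (Fin n → ZMod p) //
      Module.finrank (ZMod p) W + 1 = n}, Finite {φ : W.1 →ₗ[ZMod p] ZMod p // φ ≠ 0} := by
    intro W
    have : Finite (Module.Dual (ZMod p) W.1) := Module.finite_of_finite (ZMod p)
    exact Subtype.finite
  rw [← Nat.card_eq_of_bijective F hF, Nat.card_congr e, Nat.card_sigma,
    Finset.sum_congr rfl (g := fun _ => p ^ (n - 1) - 1), Finset.sum_const, Finset.card_univ,
    ← Nat.card_eq_fintype_card, card_finrank_add_one, smul_eq_mul]
  intro W _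
  have hW : n - 1 = Module.finrank (ZMod p) W.1 := by
    have := W.2
    omega
  rw [card_nonzero_functionals, hW]

/-- The difference of an element of `M_(n-1)` and the representative of its class. -/
def nonrepDiff (L : {L : Submodule (ZMod p) (EV p n) //
    L ∈ setM p n ∧ baseRep (L ⊔ lineE p n) ≠ L}) : Burnside (EG p n × EH p) :=
  cl L.1 - cl (baseRep (L.1 ⊔ lineE p n))

-- A representative is never a non-representative, so the coordinate at `K` sees only the difference
-- belonging to `K`.
open Classical in
theorem linearIndependent_nonrepDiff : LinearIndependent ℤ (nonrepDiff (p := p) (n := n)) := by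
  have := Fintype.ofFinite {L : Submodule (ZMod p) (EV p n) //
    L ∈ setM p n ∧ baseRep (L ⊔ lineE p n) ≠ L}
  rw [Fintype.linearIndependent_iff]
  intro g hg K
  have h1 := congrArg ((clBasis p n).coord K.1) hg
  have h2 : ∀ A B : Submodule (ZMod p) (EV p n),
      (clBasis p n).coord A (cl B) = if B = A then 1 else 0 := by
    intro A B
    rw [← clBasis_apply, Module.Basis.coord_apply, Module.Basis.repr_self, Finsupp.single_apply]
  have h3 : ∀ L, (clBasis p n).coord K.1 (nonrepDiff L) = if L = K then 1 else 0 := by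
    intro L
    rw [nonrepDiff, map_sub, h2, h2, if_neg (c := baseRep _ = _), sub_zero]
    · simp only [Subtype.ext_iff]
    · intro h
      apply K.2.2
      rw [← h, baseRep_sup_lineE (vecE_mem_sup_lineE _)]
  rw [map_sum, map_zero] at h1
  simp only [map_smul, h3, smul_eq_mul, mul_ite, mul_one, mul_zero] at h1
  rwa [Finset.sum_ite_eq' Finset.univ K, if_pos (Finset.mem_univ _)] at h1

theorem span_nonrepDiff :
    Submodule.span ℤ (Set.range (nonrepDiff (p := p) (n := n))) = gradeA'' p n := by
  apply le_antisymm
  · rw [Submodule.span_le]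
    rintro _ ⟨L, rfl⟩
    have h := isRepChoice_baseRep L.1 L.2.1
    exact Submodule.subset_span ⟨L.1, L.2.1, _, h.1, h.2.symm, rfl⟩
  · have h1 : ∀ L ∈ setM p n, cl L - cl (baseRep (L ⊔ lineE p n)) ∈
        Submodule.span ℤ (Set.range (nonrepDiff (p := p) (n := n))) := by
      intro L hL
      by_cases h : baseRep (L ⊔ lineE p n) = L
      · rw [h, sub_self]
        exact zero_mem _
      · exact Submodule.subset_span ⟨⟨L, hL, h⟩, rfl⟩
    rw [gradeA'', Submodule.span_le]
    rintro _ ⟨L, hL, L', hL', h, rfl⟩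
    have h2 := Submodule.sub_mem _ (h1 L hL) (h1 L' hL')
    rw [h, sub_sub_sub_cancel_right] at h2
    exact h2

variable (p n) in
/-- A basis of `A''_(n-1)`. -/
def gradeABasis : Module.Basis {L : Submodule (ZMod p) (EV p n) //
    L ∈ setM p n ∧ baseRep (L ⊔ lineE p n) ≠ L} ℤ (gradeA'' p n) :=
  (Module.Basis.span linearIndependent_nonrepDiff).map (LinearEquiv.ofEq _ _ span_nonrepDiff)

variable (p n) in
theorem finrank_gradeA'' :
    Module.finrank ℤ (gradeA'' p n) = numSubspaces p 1 n * (p ^ (n - 1) - 1) := by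
  rw [Module.finrank_eq_nat_card_basis (gradeABasis p n), card_nonreps]

end Counting

/-! ### Existence of the subspaces `L*` -/

section StarChoice

variable {p n : ℕ} [Fact p.Prime]

theorem exists_le_finrank_add_one {L : Submodule (ZMod p) (EV p n)}
    (hL : Module.finrank (ZMod p) L < n + 1) :
    ∃ L', L ≤ L' ∧ Module.finrank (ZMod p) L' = Module.finrank (ZMod p) L + 1 := by
  obtain ⟨v, hv⟩ : ∃ v, v ∉ L := by
    by_contra! h
    have h1 : L = ⊤ := eq_top_iff.2 fun v _ => h v
    rw [h1, finrank_top, finrank_EV] at hL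
    omega
  exact ⟨_, le_sup_left, finrank_sup_span_singleton hv⟩

/-- Adjoin a vector `v` outside `L + ℤ_p e`: if `e` were in `L + ℤ_p v`, exchange would put `v` in
`L + ℤ_p e`. -/
theorem exists_le_finrank_add_one_of_vecE_notMem {L : Submodule (ZMod p) (EV p n)}
    (he : vecE p n ∉ L) (hL : Module.finrank (ZMod p) L < n) :
    ∃ L', L ≤ L' ∧ Module.finrank (ZMod p) L' = Module.finrank (ZMod p) L + 1 ∧
      vecE p n ∉ L' := by
  obtain ⟨v, hv⟩ : ∃ v, v ∉ L ⊔ lineE p n := by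
    by_contra! h
    have h1 := finrank_sup_lineE he
    have h2 : L ⊔ lineE p n = ⊤ := eq_top_iff.2 fun v _ => h v
    rw [h2, finrank_top, finrank_EV] at h1
    omega
  refine ⟨_, le_sup_left, finrank_sup_span_singleton fun h => hv (Submodule.mem_sup_left h), ?_⟩
  intro h
  obtain ⟨l, hl, w, hw, hlw⟩ := Submodule.mem_sup.1 h
  obtain ⟨a, rfl⟩ := Submodule.mem_span_singleton.1 hw
  by_cases ha : a = 0
  · rw [ha, zero_smul, add_zero] at hlw
    exact he (hlw ▸ hl)
  · apply hv
    have h1 : v = a⁻¹ • (vecE p n - l) := by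
      rw [← hlw, add_sub_cancel_left, smul_smul, inv_mul_cancel₀ ha, one_smul]
    rw [h1]
    exact Submodule.smul_mem _ _ (Submodule.sub_mem _ (vecE_mem_sup_lineE L)
      (Submodule.mem_sup_left hl))

variable (p n) in
theorem exists_isStarChoice : ∃ S : Submodule (ZMod p) (EV p n) → Submodule (ZMod p) (EV p n),
    IsStarChoice S := by
  have key : ∀ L : Submodule (ZMod p) (EV p n), ∃ S, Module.finrank (ZMod p) L + 2 ≤ n + 1 →
      L ≤ S ∧ Module.finrank (ZMod p) S = Module.finrank (ZMod p) L + 2 ∧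
      (vecE p n ∉ L → Module.finrank (ZMod p) L + 3 ≤ n + 1 → vecE p n ∉ S) := by
    intro L
    by_cases hL : Module.finrank (ZMod p) L + 2 ≤ n + 1
    · by_cases h : vecE p n ∉ L ∧ Module.finrank (ZMod p) L + 3 ≤ n + 1
      · obtain ⟨L', h1, h2, h3⟩ := exists_le_finrank_add_one_of_vecE_notMem h.1 (by omega)
        obtain ⟨L'', h4, h5, h6⟩ := exists_le_finrank_add_one_of_vecE_notMem h3 (by omega)
        exact ⟨L'', fun _ => ⟨h1.trans h4, by omega, fun _ _ => h6⟩⟩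
      · obtain ⟨L', h1, h2⟩ := exists_le_finrank_add_one (L := L) (by omega)
        obtain ⟨L'', h4, h5⟩ := exists_le_finrank_add_one (L := L') (by omega)
        exact ⟨L'', fun _ => ⟨h1.trans h4, by omega, fun h6 h7 => (h ⟨h6, h7⟩).elim⟩⟩
    · exact ⟨⊤, fun h => (hL h).elim⟩
  choose S hS using key
  exact ⟨S, hS⟩

end StarChoice

/-! ### The two exact rows -/

section Rows

variable {p n : ℕ} [Fact p.Prime]

theorem mem_span_cl_image {s : Set (Submodule (ZMod p) (EV p n))} {x : Burnside (EG p n × EH p)} :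
    x ∈ Submodule.span ℤ (cl '' s) ↔ ↑((clBasis p n).repr x).support ⊆ s := by
  have h : cl = ⇑(clBasis p n) := (funext clBasis_apply).symm
  rw [h, Module.Basis.mem_span_image]

theorem gradeA_eq (k : ℕ) :
    gradeA p n k = Submodule.span ℤ (cl '' {L | Module.finrank (ZMod p) L = k}) := by
  rw [gradeA]
  congr 1
  ext x
  exact exists_congr fun L => and_congr_right fun _ => eq_comm

/-- `A_k` and the image of `A'` are spanned by subsets of one basis, so their intersection is
spanned by the common elements. -/
theorem gradeA'_eq (k : ℕ) : gradeA' p n k =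
    Submodule.span ℤ (cl '' {L | Module.finrank (ZMod p) L = k ∧ vecE p n ∉ L}) := by
  ext x
  rw [gradeA', Submodule.mem_inf, gradeA_eq, range_relBurnsideIncl, mem_span_cl_image,
    mem_span_cl_image, mem_span_cl_image, ← Set.subset_inter_iff]
  rfl

theorem coeLinearMap_gradeA_injective :
    Function.Injective (DirectSum.coeLinearMap fun k : Fin n => gradeA p n k) := by
  have h : iSupIndep fun k : Fin n => gradeA p n k := by
    intro k
    have h1 : ⨆ (j : Fin n) (_ : j ≠ k), gradeA p n j ≤
        Submodule.span ℤ (cl '' {L | Module.finrank (ZMod p) L ≠ k}) := by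
      refine iSup₂_le fun j hj => ?_
      rw [gradeA_eq]
      refine Submodule.span_mono (Set.image_mono fun L hL => ?_)
      intro h
      exact hj (Fin.ext (hL.symm.trans h))
    refine Disjoint.mono_right h1 ?_
    change Disjoint (gradeA p n k) _
    rw [gradeA_eq]
    refine linearIndependent_cl.disjoint_span_image ?_
    rw [Set.disjoint_left]
    exact fun L hL hL' => hL' hL
  exact h.dfinsupp_lsum_injective

theorem sourceIncl_injective : Function.Injective (sourceIncl p n) :=
  (DirectSum.lmap_injective _).2 fun k => Submodule.inclusion_injective (relSummand_le p n k)

theorem cl_mem_relSummand {L : Submodule (ZMod p) (EV p n)}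
    (hL : Module.finrank (ZMod p) L + 2 ≤ n) (he : vecE p n ∉ L) :
    cl L ∈ relSummand p n (Module.finrank (ZMod p) L) := by
  rw [relSummand, if_neg (by omega), gradeA'_eq]
  exact Submodule.subset_span ⟨L, ⟨rfl, he⟩, rfl⟩

theorem cl_sub_cl_mem_relSummand {L L' : Submodule (ZMod p) (EV p n)} (hL : L ∈ setM p n)
    (hL' : L' ∈ setM p n) (h : L ⊔ lineE p n = L' ⊔ lineE p n) :
    cl L - cl L' ∈ relSummand p n (Module.finrank (ZMod p) L) := by
  rw [relSummand, if_pos hL.1]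
  exact Submodule.subset_span ⟨L, hL, L', hL', h, rfl⟩

variable {S : Submodule (ZMod p) (EV p n) → Submodule (ZMod p) (EV p n)}

/-- With `t` the restriction of an automorphism of `A`, its injectivity reduces to the independence
of the summands `A_k`. -/
theorem IsStarChoice.exists_linearEquiv (hS : IsStarChoice S) :
    ∃ T : Burnside (EG p n × EH p) ≃ₗ[ℤ] Burnside (EG p n × EH p),
      ∀ L : Submodule (ZMod p) (EV p n), Module.finrank (ZMod p) L + 1 ≤ n → T (cl L) = tElt S L := by
  obtain ⟨c, hc⟩ := hS.exists_basis
  refine ⟨(clBasis p n).equiv c (Equiv.refl _), fun L hL => ?_⟩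
  rw [← clBasis_apply, Module.Basis.equiv_apply, Equiv.refl_apply, hc, if_pos hL]

theorem IsStarChoice.map_relSummand_le (hS : IsStarChoice S)
    (T : Burnside (EG p n × EH p) →ₗ[ℤ] Burnside (EG p n × EH p))
    (hT : ∀ L : Submodule (ZMod p) (EV p n), Module.finrank (ZMod p) L + 1 ≤ n → T (cl L) = tElt S L) (k : Fin n) :
    (relSummand p n k).map T ≤ LinearMap.range (relBurnsideIncl (EG p n) (EH p)) := by
  rw [Submodule.map_le_iff_le_comap, range_relBurnsideIncl]
  have hk := k.2
  by_cases hkn : k.1 + 1 = n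
  · rw [relSummand, if_pos hkn, gradeA'', Submodule.span_le]
    rintro _ ⟨L, hL, L', hL', h, rfl⟩
    change T _ ∈ Submodule.span ℤ (cl '' {L | vecE p n ∉ L})
    rw [map_sub, hT L hL.1.le, hT L' hL'.1.le]
    have hsub : {C : Submodule (ZMod p) (EV p n) | vecE p n ∉ C ∧
        Module.finrank (ZMod p) L < Module.finrank (ZMod p) C} ⊆ {C | vecE p n ∉ C} := fun C hC => hC.1
    have h1 := Submodule.span_mono (R := ℤ) (Set.image_mono (f := cl) hsub)
      (hS.tElt_sub_tElt_mem hL hL' h)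
    have h2 : cl L - cl L' ∈ Submodule.span ℤ (cl '' {L | vecE p n ∉ L}) :=
      Submodule.sub_mem _ (Submodule.subset_span ⟨L, hL.2, rfl⟩)
        (Submodule.subset_span ⟨L', hL'.2, rfl⟩)
    have h3 := Submodule.add_mem _ h1 h2
    rwa [sub_add_cancel] at h3
  · rw [relSummand, if_neg hkn, gradeA'_eq, Submodule.span_le]
    rintro _ ⟨L, ⟨hL, he⟩, rfl⟩
    change T _ ∈ Submodule.span ℤ (cl '' {L | vecE p n ∉ L})
    have hL : Module.finrank (ZMod p) L = k := hL
    rw [hT L (by omega)]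
    -- `k < n` and `k + 1 ≠ n` give codimension at least 3, so the choice keeps `S L` away from `e`.
    have h3 : vecE p n ∉ S L := (hS L (by omega)).2.2 he (by omega)
    have h1 := hS.tElt_sub_cl_mem (L := L) (by omega) (s := {L | vecE p n ∉ L})
      fun C hC _ h => h3 (hC h)
    have h2 := Submodule.add_mem _ h1 (Submodule.subset_span ⟨L, he, rfl⟩)
    rwa [sub_add_cancel] at h2

theorem IsStarChoice.ker_natMap_le (hS : IsStarChoice S)
    {P : Submodule ℤ (Burnside (EG p n × EH p))}
    (hP : ∀ L : Submodule (ZMod p) (EV p n), Module.finrank (ZMod p) L + 1 ≤ n → tElt S L ∈ P) :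
    LinearMap.ker (natMap (EG p n × EH p)) ≤ P := by
  obtain ⟨b, hb⟩ := hS.exists_basis_ker_natMap
  intro x hx
  have h1 : (⟨x, hx⟩ : LinearMap.ker (natMap (EG p n × EH p))) ∈
      Submodule.span ℤ (Set.range b) := by
    rw [b.span_eq]
    trivial
  have h2 : Submodule.span ℤ (Set.range b) ≤ P.comap (LinearMap.ker _).subtype := by
    rw [Submodule.span_le]
    rintro _ ⟨L, rfl⟩
    change (b L : Burnside (EG p n × EH p)) ∈ P
    rw [hb]
    exact hP L.1 L.2
  exact h2 h1

theorem IsStarChoice.ker_relNatMap_le (hS : IsStarChoice S)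
    {P : Submodule ℤ (BurnsideRel (EG p n) (EH p))}
    (hP : ∀ L : Submodule (ZMod p) (EV p n), Module.finrank (ZMod p) L + 2 ≤ n → vecE p n ∉ L →
      tElt S L ∈ P.map (relBurnsideIncl _ _))
    (hP' : ∀ L ∈ setM p n, ∀ L' ∈ setM p n, L ⊔ lineE p n = L' ⊔ lineE p n →
      tElt S L - tElt S L' ∈ P.map (relBurnsideIncl _ _)) :
    LinearMap.ker (relNatMap (EG p n) (EH p)) ≤ P := by
  obtain ⟨b, hb, hb'⟩ := hS.exists_basis_ker_relNatMap isRepChoice_baseRep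
  intro x hx
  have h1 : (⟨x, hx⟩ : LinearMap.ker (relNatMap (EG p n) (EH p))) ∈
      Submodule.span ℤ (Set.range b) := by
    rw [b.span_eq]
    trivial
  have h0 : ∀ y, relBurnsideIncl _ _ y ∈ P.map (relBurnsideIncl (EG p n) (EH p)) → y ∈ P := by
    rintro y ⟨z, hz, hzy⟩
    exact relBurnsideIncl_injective hzy ▸ hz
  have h2 : Submodule.span ℤ (Set.range b) ≤ P.comap (LinearMap.ker _).subtype := by
    rw [Submodule.span_le]
    rintro _ ⟨L | L, rfl⟩
    · apply h0
      change relBurnsideIncl _ _ (b (Sum.inl L)).1 ∈ _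
      rw [hb]
      exact hP L.1 L.2.1 L.2.2
    · apply h0
      change relBurnsideIncl _ _ (b (Sum.inr L)).1 ∈ _
      rw [hb']
      have h3 := isRepChoice_baseRep L.1 L.2.1
      exact hP' _ L.2.1 _ h3.1 h3.2.symm
  exact h2 h1

theorem IsStarChoice.exists_rows (hS : IsStarChoice S) :
    ∃ (t : SourceT p n →ₗ[ℤ] Burnside (EG p n × EH p))
      (t' : SourceT' p n →ₗ[ℤ] BurnsideRel (EG p n) (EH p)),
      (∀ (k : Fin n) (L : Submodule (ZMod p) (EV p n)) (x : gradeA p n k),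
        Module.finrank (ZMod p) L = k → (x : Burnside (EG p n × EH p)) = cl L →
        t (DirectSum.lof ℤ (Fin n) (fun k => gradeA p n k) k x) = tElt S L) ∧
      relBurnsideIncl (EG p n) (EH p) ∘ₗ t' = t ∘ₗ sourceIncl p n ∧
      Function.Injective t' ∧
      Function.Exact t' (relNatMap (EG p n) (EH p)) ∧
      Function.Injective t ∧
      Function.Exact t (natMap (EG p n × EH p)) := by
  obtain ⟨T, hT⟩ := hS.exists_linearEquiv
  obtain ⟨t, ht⟩ : ∃ t : SourceT p n →ₗ[ℤ] Burnside (EG p n × EH p),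
      ∀ x, t x = T (DirectSum.coeLinearMap (fun k : Fin n => gradeA p n k) x) :=
    ⟨T.toLinearMap ∘ₗ DirectSum.coeLinearMap fun k : Fin n => gradeA p n k, fun _ => rfl⟩
  have htlof : ∀ (k : Fin n) (x : gradeA p n k),
      t (DirectSum.lof ℤ (Fin n) (fun k => gradeA p n k) k x) = T x := by
    intro k x
    rw [ht, DirectSum.coeLinearMap_lof]
  have htL : ∀ (k : Fin n) (L : Submodule (ZMod p) (EV p n)) (x : gradeA p n k),
      Module.finrank (ZMod p) L = k → (x : Burnside (EG p n × EH p)) = cl L →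
      t (DirectSum.lof ℤ (Fin n) (fun k => gradeA p n k) k x) = tElt S L := by
    intro k L x hL hx
    have := k.2
    rw [htlof, hx, hT L (by omega)]
  have htinj : Function.Injective t := by
    intro x y h
    rw [ht, ht] at h
    exact coeLinearMap_gradeA_injective (T.injective h)
  have hft : natMap (EG p n × EH p) ∘ₗ t = 0 := by
    refine DirectSum.linearMap_ext ℤ fun k => LinearMap.ext fun x => ?_
    change natMap _ (t _) = 0
    rw [htlof]
    have h1 : gradeA p n k ≤ LinearMap.ker (natMap (EG p n × EH p) ∘ₗ T.toLinearMap) := by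
      rw [gradeA, Submodule.span_le]
      rintro _ ⟨L, hL, rfl⟩
      have := k.2
      change natMap _ (T (cl L)) = 0
      rw [hT L (by omega), hS.natMap_tElt (by omega)]
    exact h1 x.2
  have hincl : ∀ (k : Fin n) (x : relSummand p n k),
      sourceIncl p n (DirectSum.lof ℤ (Fin n) (fun k => relSummand p n k) k x) =
        DirectSum.lof ℤ (Fin n) (fun k => gradeA p n k) k
          (Submodule.inclusion (relSummand_le p n k) x) :=
    fun k x => DirectSum.lmap_lof (R := ℤ)
      (fun k : Fin n => Submodule.inclusion (relSummand_le p n k)) k x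
  have hrange : ∀ x, (t ∘ₗ sourceIncl p n) x ∈
      LinearMap.range (relBurnsideIncl (EG p n) (EH p)) := by
    have h1 : LinearMap.range (t ∘ₗ sourceIncl p n) ≤
        LinearMap.range (relBurnsideIncl (EG p n) (EH p)) := by
      rintro _ ⟨x, rfl⟩
      induction x using DirectSum.induction_on with
      | zero => rw [map_zero]; exact zero_mem _
      | of k x =>
        refine hS.map_relSummand_le T.toLinearMap hT k ⟨x, x.2, ?_⟩
        exact ((congrArg t (hincl k x)).trans (htlof k _)).symm
      | add x y hx hy => rw [map_add]; exact add_mem hx hy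
    exact fun x => h1 ⟨x, rfl⟩
  -- `t` maps the smaller source into the image of `A'`, and `I` identifies `A'` with this image;
  -- `t'` is the resulting factorization, so the left square commutes by construction.
  let I := LinearEquiv.ofInjective (relBurnsideIncl (EG p n) (EH p)) relBurnsideIncl_injective
  let t' : SourceT' p n →ₗ[ℤ] BurnsideRel (EG p n) (EH p) :=
    I.symm.toLinearMap ∘ₗ (t ∘ₗ sourceIncl p n).codRestrict _ hrange
  have ht' : relBurnsideIncl (EG p n) (EH p) ∘ₗ t' = t ∘ₗ sourceIncl p n := by
    refine LinearMap.ext fun x => ?_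
    exact congrArg Subtype.val (I.apply_symm_apply ⟨_, hrange x⟩)
  have ht'apply : ∀ x, relBurnsideIncl (EG p n) (EH p) (t' x) = t (sourceIncl p n x) :=
    LinearMap.congr_fun ht'
  have hlof : ∀ (k : Fin n) (x : relSummand p n k), T x ∈
      (LinearMap.range t').map (relBurnsideIncl (EG p n) (EH p)) := by
    intro k x
    refine ⟨_, ⟨DirectSum.lof ℤ (Fin n) (fun k => relSummand p n k) k x, rfl⟩, ?_⟩
    rw [ht'apply, hincl, htlof]
    rfl
  refine ⟨t, t', htL, ht', ?_, ?_, htinj, ?_⟩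
  · intro x y h
    apply sourceIncl_injective
    apply htinj
    rw [← ht'apply, ← ht'apply, h]
  · rw [LinearMap.exact_iff]
    apply le_antisymm
    · refine hS.ker_relNatMap_le (fun L hL he => ?_) fun L hL L' hL' h => ?_
      · rw [← hT L (by omega)]
        exact hlof ⟨Module.finrank (ZMod p) L, by omega⟩ ⟨_, cl_mem_relSummand hL he⟩
      · rw [← hT L hL.1.le, ← hT L' hL'.1.le, ← map_sub]
        exact hlof ⟨Module.finrank (ZMod p) L, hL.1.le⟩
          ⟨_, cl_sub_cl_mem_relSummand hL hL' h⟩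
    · rintro _ ⟨x, rfl⟩
      refine relNatMap_eq_zero ?_
      rw [ht'apply]
      exact LinearMap.congr_fun hft _
  · rw [LinearMap.exact_iff]
    apply le_antisymm
    · refine hS.ker_natMap_le fun L hL => ?_
      exact ⟨_, htL ⟨Module.finrank (ZMod p) L, hL⟩ L ⟨cl L, cl_mem_gradeA p n L⟩ rfl rfl⟩
    · rintro _ ⟨x, rfl⟩
      exact LinearMap.congr_fun hft x

end Rows

end RelBurnside

end

theorem mainTheorem1 (p n : ℕ) [Fact p.Prime] :
    -- the rank of `A''_(n-1)`
    (Module.Free ℤ (RelBurnside.gradeA'' p n) ∧ Module.Finite ℤ (RelBurnside.gradeA'' p n) ∧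
      Module.finrank ℤ (RelBurnside.gradeA'' p n) =
        RelBurnside.numSubspaces p 1 n * (p ^ (n - 1) - 1)) ∧
    -- the distinguished subspaces `L*` can be chosen
    (∃ S : Submodule (ZMod p) (RelBurnside.EV p n) → Submodule (ZMod p) (RelBurnside.EV p n),
      RelBurnside.IsStarChoice S) ∧
    -- the two vertical arrows on the right are inclusions, and the right square commutes
    Function.Injective (RelBurnside.relBurnsideIncl (RelBurnside.EG p n) (RelBurnside.EH p)) ∧
    Function.Injective (RelBurnside.relRatRepIncl (RelBurnside.EG p n) (RelBurnside.EH p)) ∧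
    RelBurnside.relRatRepIncl (RelBurnside.EG p n) (RelBurnside.EH p) ∘ₗ
        RelBurnside.relNatMap (RelBurnside.EG p n) (RelBurnside.EH p) =
      RelBurnside.natMap (RelBurnside.EG p n × RelBurnside.EH p) ∘ₗ
        RelBurnside.relBurnsideIncl (RelBurnside.EG p n) (RelBurnside.EH p) ∧
    -- for every choice of the subspaces `L*`
    ∀ S : Submodule (ZMod p) (RelBurnside.EV p n) → Submodule (ZMod p) (RelBurnside.EV p n),
      RelBurnside.IsStarChoice S →
      -- the two rows
      (∃ (t : RelBurnside.SourceT p n →ₗ[ℤ]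
            RelBurnside.Burnside (RelBurnside.EG p n × RelBurnside.EH p))
          (t' : RelBurnside.SourceT' p n →ₗ[ℤ]
            RelBurnside.BurnsideRel (RelBurnside.EG p n) (RelBurnside.EH p)),
        -- `t` sends `(L)` to `(L) - ∑ (C) + p (L*)`
        (∀ (k : Fin n) (L : Submodule (ZMod p) (RelBurnside.EV p n))
          (x : RelBurnside.gradeA p n k), Module.finrank (ZMod p) L = k →
          (x : RelBurnside.Burnside (RelBurnside.EG p n × RelBurnside.EH p)) =
            RelBurnside.cl L →
          t (DirectSum.lof ℤ (Fin n) (fun k => RelBurnside.gradeA p n k) k x) =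
            RelBurnside.tElt S L) ∧
        -- the left vertical arrow is an inclusion, and `t'` is the restriction of `t`
        Function.Injective (RelBurnside.sourceIncl p n) ∧
        RelBurnside.relBurnsideIncl (RelBurnside.EG p n) (RelBurnside.EH p) ∘ₗ t' =
          t ∘ₗ RelBurnside.sourceIncl p n ∧
        -- the top row is exact
        Function.Injective t' ∧
        Function.Exact t' (RelBurnside.relNatMap (RelBurnside.EG p n) (RelBurnside.EH p)) ∧
        Function.Surjective (RelBurnside.relNatMap (RelBurnside.EG p n) (RelBurnside.EH p)) ∧
        -- the bottom row is exact
        Function.Injective t ∧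
        Function.Exact t (RelBurnside.natMap (RelBurnside.EG p n × RelBurnside.EH p)) ∧
        Function.Surjective (RelBurnside.natMap (RelBurnside.EG p n × RelBurnside.EH p))) ∧
      -- the resulting basis of the Burnside kernel
      (∃ b : Module.Basis
          {L : Submodule (ZMod p) (RelBurnside.EV p n) // Module.finrank (ZMod p) L + 1 ≤ n} ℤ
          (LinearMap.ker (RelBurnside.natMap (RelBurnside.EG p n × RelBurnside.EH p))),
        ∀ L, (b L : RelBurnside.Burnside (RelBurnside.EG p n × RelBurnside.EH p)) =
          RelBurnside.tElt S L) ∧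
      -- the resulting bases of the relative Burnside kernel, one for each system `r` of
      -- representatives of the classes of `M_(n-1)` under `L + ℤ_p e = L' + ℤ_p e`
      (∀ r : Submodule (ZMod p) (RelBurnside.EV p n) → Submodule (ZMod p) (RelBurnside.EV p n),
        (∀ L ∈ RelBurnside.setM p n,
          r (L ⊔ RelBurnside.lineE p n) ∈ RelBurnside.setM p n ∧
          r (L ⊔ RelBurnside.lineE p n) ⊔ RelBurnside.lineE p n =
            L ⊔ RelBurnside.lineE p n) →
        ∃ b : Module.Basis
          ({L : Submodule (ZMod p) (RelBurnside.EV p n) //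
              Module.finrank (ZMod p) L + 2 ≤ n ∧ RelBurnside.vecE p n ∉ L} ⊕
            {L : Submodule (ZMod p) (RelBurnside.EV p n) //
              L ∈ RelBurnside.setM p n ∧ r (L ⊔ RelBurnside.lineE p n) ≠ L}) ℤ
          (LinearMap.ker (RelBurnside.relNatMap (RelBurnside.EG p n) (RelBurnside.EH p))),
          (∀ L, RelBurnside.relBurnsideIncl (RelBurnside.EG p n) (RelBurnside.EH p)
              (b (Sum.inl L)) = RelBurnside.tElt S L) ∧
          (∀ L, RelBurnside.relBurnsideIncl (RelBurnside.EG p n) (RelBurnside.EH p)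
              (b (Sum.inr L)) =
            RelBurnside.tElt S L -
              RelBurnside.tElt S (r ((L : Submodule (ZMod p) (RelBurnside.EV p n)) ⊔
                RelBurnside.lineE p n)))) := by
  refine ⟨⟨Module.Free.of_basis (RelBurnside.gradeABasis p n),
      Module.Finite.of_basis (RelBurnside.gradeABasis p n), RelBurnside.finrank_gradeA'' p n⟩,
    RelBurnside.exists_isStarChoice p n, RelBurnside.relBurnsideIncl_injective,
    RelBurnside.relRatRepIncl_injective, RelBurnside.relRatRepIncl_comp_relNatMap _ _,
    fun S hS => ⟨?_, hS.exists_basis_ker_natMap, fun r hr => hS.exists_basis_ker_relNatMap hr⟩⟩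
  obtain ⟨t, t', h1, h2, h3, h4, h5, h6⟩ := hS.exists_rows
  exact ⟨t, t', h1, RelBurnside.sourceIncl_injective, h2, h3, h4,
    RelBurnside.relNatMap_surjective, h5, h6, RelBurnside.natMap_surjective⟩
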